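/- Let $(X,\omega)$ be a symplectic manifold of real dimension $2n$ (Hausdorff, second countable), and let $L\to X$ be a smooth complex line bundle with a Hermitian metric and a Hermitian connection $a_L$ of curvature $2\pi i\,\omega$. Let $k\ge 1$ and let $\Lambda$ be a compact smooth $n$-manifold (without boundary). Denote by $\mathcal{LM}$ the space of Lagrangian submanifolds of $X$ diffeomorphic to $\Lambda$, and by $\mathrm{BS}^k(L)\subset\mathcal{LM}$ the locus of level $k$ Bohr–Sommerfeld ones, i.e. those $\mathcal L$ for which the monodromy character $\pi_1(\mathcal L)\to \mathrm U(1)$ (on each connected component of $\mathcal L$) of the flat line bundle $(L^{k},a_{L^k})|_{\mathcal L}$ is trivial. A tangent vector at $\mathcal L=\iota(\Lambda)$ to a subset $S\subset\mathcal{LM}$ is the velocity at $t=0$ of a smooth path $\mathcal L_t=\Phi_t(\Lambda)\in S$ of Lagrangian embeddings with $\Phi_0=\iota$; the velocity $v=\partial_t\Phi_t|_{t=0}$, taken modulo vectors tangent to $\mathcal L$, is identified with the $1$-form $u\mapsto\omega(v,d\iota(u))$ on $\mathcal L$. Let $\mathcal L=\iota(\Lambda)\in \mathrm{BS}^k(L)$.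 Then, as subsets of the space of $1$-forms on $\mathcal L$, $$T_{\mathcal L}\,\mathcal{LM}=\{\alpha\in\Omega^1(\mathcal L)\mid d\alpha=0\},\qquad T_{\mathcal L}\,\mathrm{BS}^k(L)=\{df\mid f\in C^\infty(\mathcal L,\mathbb R)\}.$$ In particular both are vector spaces, and the normal space of $\mathrm{BS}^k(L)$ in $\mathcal{LM}$ at $\mathcal L$ is $$N_{\mathcal L}\mathrm{BS}^k(L)=T_{\mathcal L}\,\mathcal{LM}\,/\,T_{\mathcal L}\,\mathrm{BS}^k(L)\;\cong\; H^1(\mathcal L,\mathbb R),$$ where $H^1(\mathcal L,\mathbb R)$ is de Rham cohomology and the isomorphism sends the class of a closed $1$-form to its cohomology class. -/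

import Mathlib

open scoped Manifold ContDiff Bundle

noncomputable section

namespace BohrSommerfeld

/-! ### Differential forms on manifolds without boundary -/

section Forms

/-- A (not necessarily smooth) real differential `k`-form on a `d`-dimensional manifold `M`. -/
def DForm (d : ℕ) (M : Type*) [TopologicalSpace M] [ChartedSpace (EuclideanSpace ℝ (Fin d)) M]
    (k : ℕ) : Type _ :=
  ∀ x : M, (TangentSpace (𝓡 d) x) [⋀^Fin k]→L[ℝ] ℝ

variable {d : ℕ} {M : Type*} [TopologicalSpace M] [ChartedSpace (EuclideanSpace ℝ (Fin d)) M]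
  {k : ℕ}

instance : AddCommGroup (DForm d M k) :=
  inferInstanceAs (AddCommGroup (∀ x : M, (TangentSpace (𝓡 d) x) [⋀^Fin k]→L[ℝ] ℝ))

instance : Module ℝ (DForm d M k) :=
  inferInstanceAs (Module ℝ (∀ x : M, (TangentSpace (𝓡 d) x) [⋀^Fin k]→L[ℝ] ℝ))

/-- The expression of a `k`-form in the chart around `x₀`: its pullback under the inverse chart
(only the values on the target of the chart are meaningful). -/
def DForm.inChart (α : DForm d M k) (x₀ : M) :
    EuclideanSpace ℝ (Fin d) → (EuclideanSpace ℝ (Fin d)) [⋀^Fin k]→L[ℝ] ℝ := fun y =>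
  (α ((extChartAt (𝓡 d) x₀).symm y)).compContinuousLinearMap
    (mfderiv (𝓡 d) (𝓡 d) (extChartAt (𝓡 d) x₀).symm y)

/-- A form is smooth if its expressions in the charts are smooth. -/
def DForm.IsSmooth (α : DForm d M k) : Prop :=
  ∀ x₀ : M, ContDiffOn ℝ ∞ (α.inChart x₀) (extChartAt (𝓡 d) x₀).target

/-- `dα = 0`: the exterior derivatives of the expressions of `α` in the charts vanish. -/
def DForm.ExtDerivEqZero (α : DForm d M k) : Prop :=
  ∀ x₀ : M, ∀ y ∈ (extChartAt (𝓡 d) x₀).target, extDeriv (α.inChart x₀) y = 0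

lemma DForm.inChart_add (α β : DForm d M k) (x₀ : M) :
    (α + β).inChart x₀ = α.inChart x₀ + β.inChart x₀ := rfl

lemma DForm.inChart_smul (c : ℝ) (α : DForm d M k) (x₀ : M) :
    (c • α).inChart x₀ = c • α.inChart x₀ := rfl

lemma DForm.inChart_zero (x₀ : M) : (0 : DForm d M k).inChart x₀ = 0 := rfl

lemma DForm.IsSmooth.differentiableAt {α : DForm d M k} (h : α.IsSmooth) (x₀ : M)
    {y : EuclideanSpace ℝ (Fin d)} (hy : y ∈ (extChartAt (𝓡 d) x₀).target) :
    DifferentiableAt ℝ (α.inChart x₀) y :=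
  ((h x₀).contDiffAt ((isOpen_extChartAt_target x₀).mem_nhds hy)).differentiableAt (by simp)

variable (d M k) in
/-- The real vector space of smooth closed `k`-forms. -/
def closedForms : Submodule ℝ (DForm d M k) where
  carrier := {α | α.IsSmooth ∧ α.ExtDerivEqZero}
  add_mem' {α β} hα hβ := by
    refine ⟨fun x₀ => ?_, fun x₀ y hy => ?_⟩
    · rw [DForm.inChart_add]
      exact (hα.1 x₀).add (hβ.1 x₀)
    · rw [DForm.inChart_add, extDeriv_add (hα.1.differentiableAt x₀ hy)
        (hβ.1.differentiableAt x₀ hy), hα.2 x₀ y hy, hβ.2 x₀ y hy, add_zero]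
  zero_mem' := by
    refine ⟨fun x₀ => ?_, fun x₀ y hy => ?_⟩
    · rw [DForm.inChart_zero]
      exact contDiffOn_const
    · have h := extDeriv_smul (𝕜 := ℝ) (x := y) (0 : ℝ) ((0 : DForm d M k).inChart x₀)
      rw [zero_smul] at h
      rw [DForm.inChart_zero] at h ⊢
      rw [zero_smul] at h
      exact h
  smul_mem' c α hα := by
    refine ⟨fun x₀ => ?_, fun x₀ y hy => ?_⟩
    · rw [DForm.inChart_smul]
      exact (hα.1 x₀).const_smul c
    · rw [DForm.inChart_smul, extDeriv_smul, hα.2 x₀ y hy, smul_zero]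

variable (d M) in
/-- The real vector space of exact `1`-forms `df`, with `f` a smooth real function on `M`. -/
def exactOneForms : Submodule ℝ (DForm d M 1) where
  carrier := {α | ∃ f : M → ℝ, ContMDiff (𝓡 d) 𝓘(ℝ, ℝ) ∞ f ∧
    ∀ (x : M) (u : TangentSpace (𝓡 d) x), α x (fun _ => u) = mfderiv (𝓡 d) 𝓘(ℝ, ℝ) f x u}
  add_mem' := by
    rintro α β ⟨f, hf, hαf⟩ ⟨g, hg, hβg⟩
    refine ⟨f + g, hf.add hg, fun x u => ?_⟩
    rw [mfderiv_add (hf.mdifferentiableAt (by simp)) (hg.mdifferentiableAt (by simp))]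
    change α x (fun _ => u) + β x (fun _ => u) = _
    rw [hαf, hβg]
    rfl
  zero_mem' := by
    refine ⟨fun _ => 0, contMDiff_const, fun x u => ?_⟩
    rw [mfderiv_const]
    rfl
  smul_mem' := by
    rintro c α ⟨f, hf, hαf⟩
    refine ⟨c • f, ?_, fun x u => ?_⟩
    · exact (contDiff_const_smul c).contMDiff.comp hf
    · rw [const_smul_mfderiv (hf.mdifferentiableAt (by simp))]
      change c • (α x (fun _ => u)) = _
      rw [hαf]
      rfl

variable (d M) in
/-- The first (de Rham) cohomology `H¹(M, ℝ)`: closed `1`-forms modulo exact `1`-forms. -/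
abbrev H1 : Type _ :=
  (closedForms d M 1) ⧸ (exactOneForms d M).submoduleOf (closedForms d M 1)

/-- A symplectic form: a smooth closed `2`-form that is nondegenerate at every point. -/
structure IsSymplectic (Ω : DForm d M 2) : Prop where
  smooth : Ω.IsSmooth
  closed : Ω.ExtDerivEqZero
  nondegenerate : ∀ (x : M) (u : TangentSpace (𝓡 d) x),
    (∀ v : TangentSpace (𝓡 d) x, Ω x ![u, v] = 0) → u = 0

end Forms

/-! ### Hermitian line bundles with connection -/

section LineBundle

variable {m : ℕ} {X : Type*} [TopologicalSpace X] [ChartedSpace (EuclideanSpace ℝ (Fin m)) X]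
  [IsManifold (𝓡 m) ∞ X]

/-- A smooth vector field on `X`. -/
def IsSmoothField (Y : ∀ x : X, TangentSpace (𝓡 m) x) : Prop :=
  ContMDiff (𝓡 m) (𝓡 m).tangent ∞ (fun x => (⟨x, Y x⟩ : TangentBundle (𝓡 m) X))

variable {L : X → Type*} [TopologicalSpace (Bundle.TotalSpace ℂ L)]
  [∀ x, AddCommGroup (L x)] [∀ x, Module ℂ (L x)] [∀ x, TopologicalSpace (L x)]
  [∀ x, IsTopologicalAddGroup (L x)] [∀ x, ContinuousSMul ℝ (L x)] [FiberBundle ℂ L]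

variable (m) in
/-- A smooth global section of the complex line bundle `L` over the real manifold `X`. -/
def IsSmoothSection (σ : ∀ x : X, L x) : Prop :=
  ContMDiff (𝓡 m) ((𝓡 m).prod 𝓘(ℝ, ℂ)) ∞ (fun x => Bundle.TotalSpace.mk' ℂ x (σ x))

variable [VectorBundle ℝ ℂ L]

variable (m L) in
/-- A smooth Hermitian metric on the complex line bundle `L` together with a smooth Hermitian
(that is, complex linear and metric) connection. -/
structure HermitianConnection where
  /-- The Hermitian form on each fibre, antilinear in the first variable. -/
  metric : ∀ x : X, L x →ₗ⋆[ℂ] L x →ₗ[ℂ] ℂ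
  metric_symm : ∀ (x : X) (u v : L x), (starRingEnd ℂ) (metric x u v) = metric x v u
  metric_pos : ∀ (x : X) (u : L x), u ≠ 0 → 0 < (metric x u u).re
  metric_smooth : ∀ σ τ : ∀ x : X, L x, IsSmoothSection m σ → IsSmoothSection m τ →
    ContMDiff (𝓡 m) 𝓘(ℝ, ℂ) ∞ (fun x => metric x (σ x) (τ x))
  /-- The connection: `cov σ x v` is the covariant derivative of `σ` at `x` along `v`. -/
  cov : CovariantDerivative (𝓡 m) ℂ L
  cov_smooth : ∀ (σ : ∀ x : X, L x) (Y : ∀ x : X, TangentSpace (𝓡 m) x),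
    IsSmoothSection m σ → IsSmoothField Y → IsSmoothSection m (fun x => cov σ x (Y x))
  cov_complex : ∀ (c : ℂ) (σ : ∀ x : X, L x), IsSmoothSection m σ →
    ∀ (x : X) (v : TangentSpace (𝓡 m) x), cov (fun y => c • σ y) x v = c • cov σ x v
  cov_metric : ∀ σ τ : ∀ x : X, L x, IsSmoothSection m σ → IsSmoothSection m τ →
    ∀ (x : X) (v : TangentSpace (𝓡 m) x),
      mfderiv (𝓡 m) 𝓘(ℝ, ℂ) (fun y => metric y (σ y) (τ y)) x v =
        metric x (cov σ x v) (τ x) + metric x (σ x) (cov τ x v)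

/-- The curvature of the connection is `2πi · Ω`:
`∇_Y ∇_Z σ - ∇_Z ∇_Y σ - ∇_[Y,Z] σ = 2πi · Ω(Y, Z) · σ`. -/
def HermitianConnection.HasCurvature (a : HermitianConnection m L) (Ω : DForm m X 2) : Prop :=
  ∀ (σ : ∀ x : X, L x) (Y Z : ∀ x : X, TangentSpace (𝓡 m) x),
    IsSmoothSection m σ → IsSmoothField Y → IsSmoothField Z → ∀ x : X,
      a.cov (fun y => a.cov σ y (Z y)) x (Y x) - a.cov (fun y => a.cov σ y (Y y)) x (Z x)
          - a.cov σ x (VectorField.mlieBracket (𝓡 m) Y Z x) =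
        (2 * Real.pi * Complex.I * (Ω x ![Y x, Z x] : ℝ) : ℂ) • σ x

/-- The smooth curve `c` in the total space of `L` is parallel (covariant constant) along its
projection `γ` to `X`: whenever `c = z · (σ ∘ γ)` near `s₀`, with `σ` a smooth section and `z` a
complex function, one has `z' σ + z ∇_γ' σ = 0` at `s₀`. (Near each `s₀` the curve `c` can be
written so, with `σ` nowhere zero near `γ(s₀)`.) -/
def HermitianConnection.IsParallel (a : HermitianConnection m L)
    (c : ℝ → Bundle.TotalSpace ℂ L) : Prop :=
  ContMDiff 𝓘(ℝ, ℝ) ((𝓡 m).prod 𝓘(ℝ, ℂ)) ∞ c ∧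
  ∀ (s₀ : ℝ) (σ : ∀ x : X, L x) (z : ℝ → ℂ), IsSmoothSection m σ → DifferentiableAt ℝ z s₀ →
    (∀ᶠ s in nhds s₀, (c s).2 = z s • σ (c s).1) →
      deriv z s₀ • σ (c s₀).1 +
        z s₀ • a.cov σ (c s₀).1 (mfderiv 𝓘(ℝ, ℝ) (𝓡 m) (fun s => (c s).1) s₀ (1 : ℝ)) = 0

/-- The monodromy character of the restriction of `(L^k, a_{L^k})` to `N` is trivial: if `c` is a
nonzero parallel curve of `L` over a smooth loop in `N` and `c(1) = z · c(0)`, so that `z` is the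
monodromy of `L` and `z ^ k` is the monodromy of the tensor power `L^k`, then `z ^ k = 1`. -/
def HermitianConnection.TrivialCharacter (a : HermitianConnection m L) (k : ℕ) (N : Set X) :
    Prop :=
  ∀ c : ℝ → Bundle.TotalSpace ℂ L, a.IsParallel c → (∀ s, (c s).1 ∈ N) → (c 0).2 ≠ 0 →
    ∀ z : ℂ, c 1 = Bundle.TotalSpace.mk' ℂ (c 0).1 (z • (c 0).2) → z ^ k = 1

end LineBundle

/-! ### Lagrangian cycles, the Bohr–Sommerfeld locus and tangent spaces -/

section Lagrangian

variable {n : ℕ} {X : Type*} [TopologicalSpace X]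
  [ChartedSpace (EuclideanSpace ℝ (Fin (2 * n))) X]
  {Λ : Type*} [TopologicalSpace Λ] [ChartedSpace (EuclideanSpace ℝ (Fin n)) Λ]

/-- A smooth injective immersion of the `n`-manifold `Λ` into the `2n`-manifold `X` that pulls `Ω`
back to zero. (When `Λ` is compact, an injective immersion is an embedding.) -/
structure IsLagrangianEmbedding (Ω : DForm (2 * n) X 2) (f : Λ → X) : Prop where
  smooth : ContMDiff (𝓡 n) (𝓡 (2 * n)) ∞ f
  injective : Function.Injective f
  immersion : ∀ x : Λ, Function.Injective (mfderiv (𝓡 n) (𝓡 (2 * n)) f x)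
  isotropic : ∀ (x : Λ) (u v : TangentSpace (𝓡 n) x),
    Ω (f x) ![mfderiv (𝓡 n) (𝓡 (2 * n)) f x u, mfderiv (𝓡 n) (𝓡 (2 * n)) f x v] = 0

variable (Λ) in
/-- The space of all (smooth) Lagrangian cycles in `X` of diffeomorphism type `Λ`. -/
def lagrangianCycles (Ω : DForm (2 * n) X 2) : Set (Set X) :=
  {N | ∃ f : Λ → X, IsLagrangianEmbedding Ω f ∧ Set.range f = N}

/-- The tangent vectors at the cycle `ι(Λ)` to a set `S` of Lagrangian cycles: the velocities at
`t = 0` of the smooth paths of Lagrangian cycles `Φ_t(Λ)` that stay in `S` and start at `ι`. The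
velocity `v = ∂Φ_t/∂t` at `t = 0` matters only modulo vectors tangent to the cycle, and it is
recorded by the `1`-form `u ↦ Ω(v, dι u)` on `Λ`, which determines it modulo such vectors. -/
def tangentVectors (Ω : DForm (2 * n) X 2) (S : Set (Set X)) (ι : Λ → X) : Set (DForm n Λ 1) :=
  {α | ∃ Φ : ℝ → Λ → X,
    ContMDiff (𝓘(ℝ, ℝ).prod (𝓡 n)) (𝓡 (2 * n)) ∞ (fun p : ℝ × Λ => Φ p.1 p.2) ∧
    (∀ t, IsLagrangianEmbedding Ω (Φ t)) ∧ (∀ t, Set.range (Φ t) ∈ S) ∧ Φ 0 = ι ∧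
    ∀ (x : Λ) (u : TangentSpace (𝓡 n) x),
      α x (fun _ => u) = Ω (Φ 0 x) ![mfderiv 𝓘(ℝ, ℝ) (𝓡 (2 * n)) (fun t => Φ t x) 0 (1 : ℝ),
        mfderiv (𝓡 n) (𝓡 (2 * n)) (Φ 0) x u]}

/-- The tangent space: the vector space spanned by the tangent vectors. -/
def tangentSpace (Ω : DForm (2 * n) X 2) (S : Set (Set X)) (ι : Λ → X) :
    Submodule ℝ (DForm n Λ 1) :=
  Submodule.span ℝ (tangentVectors Ω S ι)

/-- The normal space at `ι(Λ)` of `S` in a larger set `T` of Lagrangian cycles. -/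
abbrev normalSpace (Ω : DForm (2 * n) X 2) (S T : Set (Set X)) (ι : Λ → X) : Type _ :=
  (tangentSpace Ω T ι) ⧸ (tangentSpace Ω S ι).submoduleOf (tangentSpace Ω T ι)

variable {L : X → Type*} [TopologicalSpace (Bundle.TotalSpace ℂ L)]
  [∀ x, AddCommGroup (L x)] [∀ x, Module ℂ (L x)] [∀ x, TopologicalSpace (L x)]
  [∀ x, IsTopologicalAddGroup (L x)] [∀ x, ContinuousSMul ℝ (L x)] [FiberBundle ℂ L]
  [IsManifold (𝓡 (2 * n)) ∞ X] [VectorBundle ℝ ℂ L]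

variable (Λ) in
/-- The locus of level `k` Bohr–Sommerfeld Lagrangian cycles. -/
def bohrSommerfeldCycles (Ω : DForm (2 * n) X 2) (a : HermitianConnection (2 * n) L) (k : ℕ) :
    Set (Set X) :=
  {N | N ∈ lagrangianCycles Λ Ω ∧ a.TrivialCharacter k N}

end Lagrangian

end BohrSommerfeld

end

/-! Each of the two tangent sets is computed by two inclusions; the normal space is then a quotient
of known submodules.

All Lagrangian deformations. Read a path of embeddings as one map `F` of (t, x). The form F^*Ω is
closed. On ∂_t and two spatial vectors u, v, the cyclic identity contains the term ∂_t F^*Ω(u, v),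
which vanishes because every slice is isotropic; the rest says that α is closed
(`tangentVectors_lagrangianCycles_subset`). Conversely, a closed form on the compact Λ extends to a
closed form near the image: local primitives are composed with local retractions and averaged by a
partition of unity (`exists_differences_extension`). A closed form without a global primitive is
carried by a function `G` of two points, equal to g q - g p for a local primitive g, so that the
differential of `G p` at p is the form at p. Its symplectically dual field moves Λ for a short time,
slowed down so as to exist for all real t, and the images stay Lagrangian because the t-derivative
of F^*Ω on slices is the differential of a closed form (`exists_lagrangian_family`).

Bohr–Sommerfeld deformations. Let λ be a loop in Λ, F(t, s) = Φ_t(λ(s)), and let ψ satisfy ∂_s ψ =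
-2π Ω(∂_t F, ∂_s F). Then d(iψ dt) is the pullback of the curvature, so F^*L has local nonvanishing
sections c with ∇_s c = 0 and ∇_t c = iψ c. They glue over the strip 0 ≤ s ≤ 1, and comparison of
its two edges yields the holonomy W(t) of the loops, with W' = i(ψ(t,1) - ψ(t,0)) W
(`exists_holonomy_function`). On a path in the locus W^k = 1, hence W' = 0, and at t = 0 this says
that the period of α along λ vanishes (`period_eq_zero`); a closed form without periods is exact
(`mem_exactOneForms_of_periods`). Conversely, for α = df extend f to a function h on X and move
along its Hamiltonian field. Then ψ is a function of t times h ∘ F, which takes equal values at s =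
0 and s = 1, so W is constant and the condition at t = 0 persists
(`range_mem_bohrSommerfeldCycles`).

The analytic base is the smooth dependence of flows on initial values. It comes from the inverse
function theorem in the Banach space of continuous paths, where composition with a smooth map is a
smooth operation (`contDiff_postcomp`). -/

namespace BohrSommerfeld

open Set Filter Topology

set_option linter.unusedSectionVars false

/-! ### Composition with a smooth map on spaces of continuous functions -/

section PathSpace

universe u

variable {K : Type*} [TopologicalSpace K] [CompactSpace K]

/-- The pointwise application of a continuous bilinear map to continuous functions. -/
noncomputable def pointwiseApply (K : Type*) [TopologicalSpace K] [CompactSpace K]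
    {G E F : Type*} [NormedAddCommGroup G] [NormedSpace ℝ G]
    [NormedAddCommGroup E] [NormedSpace ℝ E]
    [NormedAddCommGroup F] [NormedSpace ℝ F] (B : G →L[ℝ] E →L[ℝ] F) :
    C(K, G) →L[ℝ] C(K, E) →L[ℝ] C(K, F) :=
  LinearMap.mkContinuous₂
    (LinearMap.mk₂ ℝ
      (fun (A : C(K, G)) (γ : C(K, E)) =>
        (⟨fun k => B (A k) (γ k), by fun_prop⟩ : C(K, F)))
      (fun _ _ _ => by ext; simp) (fun _ _ _ => by ext; simp)
      (fun _ _ _ => by ext; simp) (fun _ _ _ => by ext; simp)) ‖B‖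
    (fun A γ => by
      refine (ContinuousMap.norm_le _ (by positivity)).2 fun k => ?_
      refine (B.le_opNorm₂ _ _).trans ?_
      gcongr
      · exact A.norm_coe_le_norm k
      · exact γ.norm_coe_le_norm k)

/-- The mean value inequality is applied at each point of `K`. Uniformity of the estimate over `K`
comes from the continuity of `γ ↦ f' ∘ γ` in the sup norm, so `E` may be infinite-dimensional. -/
lemma hasFDerivAt_postcomp {G E F : Type*} [NormedAddCommGroup G] [NormedSpace ℝ G]
    [NormedAddCommGroup E] [NormedSpace ℝ E] [NormedAddCommGroup F] [NormedSpace ℝ F]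
    (B : G →L[ℝ] E →L[ℝ] F) (f : C(E, F)) (f' : C(E, G))
    (hf : ∀ x, HasFDerivAt f (B (f' x)) x) (γ : C(K, E)) :
    HasFDerivAt (fun γ : C(K, E) => f.comp γ) (pointwiseApply K B (f'.comp γ)) γ := by
  rw [hasFDerivAt_iff_isLittleO_nhds_zero, Asymptotics.isLittleO_iff]
  intro ε hε
  have hc : Continuous (fun γ : C(K, E) => f'.comp γ) := ContinuousMap.continuous_postcomp f'
  obtain ⟨δ, hδ, hball⟩ := Metric.continuousAt_iff.1 (hc.continuousAt (x := γ))
    (ε / (‖B‖ + 1)) (by positivity)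
  filter_upwards [Metric.ball_mem_nhds (0 : C(K, E)) hδ] with h hh
  refine (ContinuousMap.norm_le _ (by positivity)).2 fun k => ?_
  -- The function `γ + const (x - γ k)` is within `δ` of `γ` and takes the value `x` at `k`;
  -- continuity in the sup norm thus bounds `f'` at `x` with a `δ` independent of `k`.
  have key : ∀ x ∈ Metric.ball (γ k) δ, ‖B (f' x) - B (f' (γ k))‖ ≤ ε := by
    intro x hx
    have h1 : dist (γ + ContinuousMap.const K (x - γ k)) γ < δ := by
      rw [dist_eq_norm, add_sub_cancel_left]
      exact lt_of_le_of_lt ((ContinuousMap.norm_le _ (norm_nonneg _)).2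
        fun k' => le_of_eq (by simp))
        (mem_ball_iff_norm.1 hx)
    have h2 := (ContinuousMap.dist_apply_le_dist k).trans (hball h1).le
    have h3 : ‖f' x - f' (γ k)‖ ≤ ε / (‖B‖ + 1) := by simpa [dist_eq_norm] using h2
    rw [← map_sub]
    calc ‖B (f' x - f' (γ k))‖ ≤ (‖B‖ + 1) * (ε / (‖B‖ + 1)) :=
          (B.le_opNorm _).trans (by gcongr; simp)
      _ = ε := by field_simp
  have hhk : ‖h k‖ < δ := (h.norm_coe_le_norm k).trans_lt (by simpa using hh)
  have := (convex_ball (γ k) δ).norm_image_sub_le_of_norm_hasFDerivWithin_le'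
    (f := f) (f' := fun x => B (f' x)) (φ := B (f' (γ k))) (C := ε)
    (fun x _ => (hf x).hasFDerivWithinAt) key (Metric.mem_ball_self hδ)
    (y := γ k + h k) (by simpa using hhk)
  simp only [add_sub_cancel_left] at this
  exact this.trans (mul_le_mul_of_nonneg_left (h.norm_coe_le_norm k) hε.le)

/-- The space of operators is hidden behind an abstract `G`. One universe for `E` and `F` puts `G`
there as well, so the induction on the order of smoothness, which quantifies over all codomains, can
be applied to `f'`. -/
lemma exists_bilinear_fderiv {E F : Type u} [NormedAddCommGroup E] [NormedSpace ℝ E]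
    [NormedAddCommGroup F] [NormedSpace ℝ F] {m : ℕ} {f : E → F} (hf : ContDiff ℝ (m + 1) f) :
    ∃ (G : Type u) (_ : NormedAddCommGroup G) (_ : NormedSpace ℝ G) (B : G →L[ℝ] E →L[ℝ] F)
      (f' : E → G), ContDiff ℝ m f' ∧ ∀ x, HasFDerivAt f (B (f' x)) x :=
  have h := contDiff_succ_iff_fderiv.1 hf
  ⟨E →L[ℝ] F, inferInstance, inferInstance, .id ℝ _, fderiv ℝ f, h.2.2, fun x =>
    (h.1 x).hasFDerivAt⟩

lemma contDiff_postcomp_nat {E : Type u} [NormedAddCommGroup E] [NormedSpace ℝ E] (m : ℕ) :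
    ∀ {F : Type u} [NormedAddCommGroup F] [NormedSpace ℝ F] (f : C(E, F)), ContDiff ℝ m f →
      ContDiff ℝ m (fun γ : C(K, E) => f.comp γ) := by
  induction m with
  | zero =>
    intro F _ _ f _
    exact contDiff_zero.2 (ContinuousMap.continuous_postcomp f)
  | succ m ih =>
    intro F _ _ f hf
    push_cast at hf ⊢
    obtain ⟨G, _, _, B, f', hf', hd⟩ := exists_bilinear_fderiv hf
    exact contDiff_succ_iff_hasFDerivAt.2
      ⟨_, (pointwiseApply K B).contDiff.comp (ih ⟨f', hf'.continuous⟩ hf'),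
        hasFDerivAt_postcomp B f ⟨f', hf'.continuous⟩ hd⟩

/-- Composition with a smooth map is a smooth map of spaces of continuous functions. -/
lemma contDiff_postcomp {E F : Type u} [NormedAddCommGroup E] [NormedSpace ℝ E]
    [NormedAddCommGroup F] [NormedSpace ℝ F] (f : C(E, F)) (hf : ContDiff ℝ ∞ f) :
    ContDiff ℝ ∞ (fun γ : C(K, E) => f.comp γ) :=
  contDiff_infty.2 fun m => contDiff_postcomp_nat m f (contDiff_infty.1 hf m)

end PathSpace

/-! ### Inverse function theorem on a neighbourhood -/

section InverseFunction

variable {E F : Type*} [NormedAddCommGroup E] [NormedSpace ℝ E] [CompleteSpace E]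
  [NormedAddCommGroup F] [NormedSpace ℝ F]

/-- The inverse function theorem, with a local inverse that is smooth on a neighbourhood. -/
lemma exists_contDiffOn_local_inverse {f : E → F} {U : Set E} (hU : IsOpen U)
    (hf : ContDiffOn ℝ ∞ f U) {a : E} (ha : a ∈ U) (f' : E ≃L[ℝ] F)
    (hf' : HasFDerivAt f (f' : E →L[ℝ] F) a) :
    ∃ (g : F → E) (V : Set F), IsOpen V ∧ f a ∈ V ∧ ContDiffOn ℝ ∞ g V ∧
      (∀ᶠ x in 𝓝 a, g (f x) = x) ∧ ∀ y ∈ V, f (g y) = y := by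
  have hfa : ContDiffAt ℝ ∞ f a := hf.contDiffAt (hU.mem_nhds ha)
  let e := hfa.toOpenPartialHomeomorph f hf' (by simp)
  have hea : a ∈ e.source := hfa.mem_toOpenPartialHomeomorph_source hf' (by simp)
  have hef : ∀ x, e x = f x := fun x => rfl
  have hsa : e.symm (f a) = a := e.left_inv hea
  -- Invertible operators form an open set, so the derivative is invertible at all points near `a`.
  -- The inverse is then smooth at each point of a fixed `V`; smoothness at the single point `f a`
  -- would only give neighbourhoods depending on the order.
  have hW : {x | x ∈ U ∧ fderiv ℝ f x ∈ range ((↑) : (E ≃L[ℝ] F) → E →L[ℝ] F)} ∈ 𝓝 a := by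
    have hc : ContinuousAt (fderiv ℝ f) a := (hfa.fderiv_right (m := 0) (by simp)).continuousAt
    have h1 : range ((↑) : (E ≃L[ℝ] F) → E →L[ℝ] F) ∈ 𝓝 (fderiv ℝ f a) := by
      rw [hf'.fderiv]; exact f'.nhds
    exact inter_mem (hU.mem_nhds ha) (hc h1)
  have hV : e.target ∩ e.symm ⁻¹'
      {x | x ∈ U ∧ fderiv ℝ f x ∈ range ((↑) : (E ≃L[ℝ] F) → E →L[ℝ] F)} ∈ 𝓝 (f a) := by
    refine inter_mem (e.open_target.mem_nhds (e.map_source hea)) ?_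
    refine (e.continuousAt_symm (e.map_source hea)).preimage_mem_nhds ?_
    rw [hef, hsa]; exact hW
  obtain ⟨V, hVs, hVo, haV⟩ := mem_nhds_iff.1 hV
  refine ⟨e.symm, V, hVo, haV, fun y hy => ?_, ?_, fun y hy => e.right_inv (hVs hy).1⟩
  · obtain ⟨hyt, hyU, f0, hf0⟩ := hVs hy
    have hd : ContDiffAt ℝ ∞ f (e.symm y) := hf.contDiffAt (hU.mem_nhds hyU)
    refine (e.contDiffAt_symm hyt (f₀' := f0) ?_ hd).contDiffWithinAt
    rw [hf0]
    exact (hd.differentiableAt (by simp)).hasFDerivAt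
  · filter_upwards [e.open_source.mem_nhds hea] with x hx using e.left_inv hx

end InverseFunction

/-! ### Primitives of paths and integrals with parameters -/

section Primitive

variable {E : Type*} [NormedAddCommGroup E] [NormedSpace ℝ E]

/-- The primitive vanishing at `0`, on continuous functions on `[-1, 1]`. -/
noncomputable def primitiveCLM (E : Type*) [NormedAddCommGroup E] [NormedSpace ℝ E] :
    C(Icc (-1 : ℝ) 1, E) →L[ℝ] C(Icc (-1 : ℝ) 1, E) :=
  LinearMap.mkContinuous
    { toFun := fun γ => ⟨fun s => ∫ r in (0 : ℝ)..s, IccExtend (by norm_num) γ r,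
        (intervalIntegral.continuous_primitive (fun a b =>
          (γ.continuous.Icc_extend' (h := by norm_num)).intervalIntegrable a b) 0).comp
          continuous_subtype_val⟩
      map_add' := fun γ η => by
        ext s
        have h : ∀ γ : C(Icc (-1 : ℝ) 1, E), IntervalIntegrable
            (IccExtend (show (-1 : ℝ) ≤ 1 by norm_num) γ) MeasureTheory.volume 0 s := fun γ =>
          (γ.continuous.Icc_extend' (h := by norm_num)).intervalIntegrable _ _
        exact intervalIntegral.integral_add (h γ) (h η)
      map_smul' := fun c γ => by
        ext s
        exact intervalIntegral.integral_smul c _ } 1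
    (fun γ => by
      rw [one_mul]
      refine (ContinuousMap.norm_le _ (norm_nonneg _)).2 fun s => ?_
      have h := intervalIntegral.norm_integral_le_of_norm_le_const (a := 0) (b := (s : ℝ))
        (f := IccExtend (show (-1 : ℝ) ≤ 1 by norm_num) γ) (C := ‖γ‖)
        (fun r _ => γ.norm_coe_le_norm _)
      refine h.trans ?_
      have : |(s : ℝ) - 0| ≤ 1 := by rw [sub_zero, abs_le]; exact s.2
      exact mul_le_of_le_one_right (norm_nonneg _) this)

lemma primitiveCLM_apply (γ : C(Icc (-1 : ℝ) 1, E)) (s : Icc (-1 : ℝ) 1) :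
    primitiveCLM E γ s = ∫ r in (0 : ℝ)..s, IccExtend (by norm_num) γ r := rfl

/-- The substitution `r = l * s` in the integral. It lets a solution on a long time interval be
reread as a solution on a shorter one. -/
lemma primitiveCLM_scale (γ γ' : C(Icc (-1 : ℝ) 1, E)) (l : Icc (-1 : ℝ) 1)
    (h : ∀ s r : Icc (-1 : ℝ) 1, (r : ℝ) = l * s → γ' s = γ r) (s r : Icc (-1 : ℝ) 1)
    (hr : (r : ℝ) = l * s) :
    (l : ℝ) • primitiveCLM E γ' s = primitiveCLM E γ r := by
  rw [primitiveCLM_apply, primitiveCLM_apply, hr]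
  have h1 := intervalIntegral.smul_integral_comp_mul_left (a := 0) (b := (s : ℝ))
    (fun r => IccExtend (show (-1 : ℝ) ≤ 1 by norm_num) γ r) (l : ℝ)
  rw [mul_zero] at h1
  rw [← h1]
  congr 1
  refine intervalIntegral.integral_congr fun x hx => ?_
  have hx1 : x ∈ Icc (-1 : ℝ) 1 := by
    have := uIcc_subset_Icc (a₁ := (0 : ℝ)) (a₂ := -1) (b₂ := 1) ⟨by norm_num, by norm_num⟩ s.2
    exact this hx
  have hx2 : (l : ℝ) * x ∈ Icc (-1 : ℝ) 1 := by
    rw [mem_Icc, ← abs_le, abs_mul]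
    exact mul_le_one₀ (abs_le.2 l.2) (abs_nonneg _) (abs_le.2 hx1)
  change IccExtend _ γ' x = IccExtend _ γ (l * x)
  rw [IccExtend_of_mem _ _ hx1, IccExtend_of_mem _ _ hx2]
  exact h ⟨x, hx1⟩ ⟨_, hx2⟩ rfl

lemma hasDerivAt_primitiveCLM [CompleteSpace E] (γ : C(Icc (-1 : ℝ) 1, E)) {s : ℝ}
    (hs : s ∈ Ioo (-1 : ℝ) 1) :
    HasDerivAt (fun s => IccExtend (show (-1 : ℝ) ≤ 1 by norm_num) (primitiveCLM E γ) s)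
      (γ ⟨s, Ioo_subset_Icc_self hs⟩) s := by
  have hc : Continuous (IccExtend (show (-1 : ℝ) ≤ 1 by norm_num) γ) :=
    γ.continuous.Icc_extend'
  have h := intervalIntegral.integral_hasDerivAt_right (hc.intervalIntegrable 0 s)
    hc.stronglyMeasurable.stronglyMeasurableAtFilter hc.continuousAt
  rw [IccExtend_of_mem _ _ (Ioo_subset_Icc_self hs)] at h
  refine h.congr_of_eventuallyEq ?_
  filter_upwards [Ioo_mem_nhds hs.1 hs.2] with r hr
  rw [IccExtend_of_mem _ _ (Ioo_subset_Icc_self hr)]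
  rfl

/-- A smooth function of two variables has a smooth primitive in the second one. -/
lemma exists_contDiff_primitive_snd {b : ℝ × ℝ → ℝ} (hb : ContDiff ℝ ∞ b) :
    ∃ ψ : ℝ × ℝ → ℝ, ContDiff ℝ ∞ ψ ∧ ∀ t s, HasDerivAt (fun s => ψ (t, s)) (b (t, s)) s := by
  let P : ℝ × ℝ →L[ℝ] C(Icc (-1 : ℝ) 1, ℝ × ℝ) :=
    (ContinuousLinearMap.fst ℝ ℝ ℝ).smulRight (ContinuousMap.const _ ((1, 0) : ℝ × ℝ)) +
      (ContinuousLinearMap.snd ℝ ℝ ℝ).smulRight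
        (⟨fun r => ((0, (r : ℝ)) : ℝ × ℝ), by fun_prop⟩)
  have hP : ∀ t s r, P (t, s) r = (t, s * r) := fun t s r => by simp [P]
  let one : Icc (-1 : ℝ) 1 := ⟨1, by norm_num, le_rfl⟩
  -- This is ψ(t, s) = s ∫₀¹ b(t, s r) dr. With the integrand seen as a path in r, it is built from
  -- a linear map, a postcomposition, the primitive and an evaluation, all smooth.
  let ψ : ℝ × ℝ → ℝ := fun p => p.2 *
    primitiveCLM ℝ ((⟨b, hb.continuous⟩ : C(ℝ × ℝ, ℝ)).comp (P p)) one
  refine ⟨ψ, ?_, fun t s => ?_⟩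
  · refine contDiff_snd.mul ?_
    exact (ContinuousMap.evalCLM ℝ one).contDiff.comp ((primitiveCLM ℝ).contDiff.comp
      ((contDiff_postcomp ⟨b, hb.continuous⟩ hb).comp P.contDiff))
  · have h : ∀ s, ψ (t, s) = ∫ r in (0 : ℝ)..s, b (t, r) := fun s => by
      have h1 := intervalIntegral.smul_integral_comp_mul_left (a := 0) (b := 1)
        (fun r => b (t, r)) s
      rw [mul_zero, mul_one] at h1
      rw [← h1]
      change s * _ = s * _
      rw [primitiveCLM_apply]
      congr 1
      refine intervalIntegral.integral_congr fun x hx => ?_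
      rw [uIcc_of_le zero_le_one] at hx
      rw [IccExtend_of_mem _ _ (⟨by linarith [hx.1], hx.2⟩ : x ∈ Icc (-1 : ℝ) 1)]
      simp [hP]
    simp only [h]
    have hc : Continuous fun r => b (t, r) := hb.continuous.comp (by fun_prop)
    exact intervalIntegral.integral_hasDerivAt_right (hc.intervalIntegrable 0 s)
      hc.stronglyMeasurable.stronglyMeasurableAtFilter hc.continuousAt

end Primitive

/-! ### Smooth local flows in Banach spaces -/

section Flow

universe u

variable {E : Type u} [NormedAddCommGroup E] [NormedSpace ℝ E] [CompleteSpace E]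

/-- Local solutions of an autonomous smooth ordinary differential equation, as functions of the
length of the time interval and of the initial value. -/
lemma exists_smooth_solution_path {f : E → E} (hf : ContDiff ℝ ∞ f) (x₀ : E) :
    ∃ (Γ : ℝ × E → C(Icc (-1 : ℝ) 1, E)) (U : Set (ℝ × E)), IsOpen U ∧ (0, x₀) ∈ U ∧
      ContDiffOn ℝ ∞ Γ U ∧
      (∀ p ∈ U, Γ p = ContinuousMap.const _ p.2 +
        p.1 • primitiveCLM E ((⟨f, hf.continuous⟩ : C(E, E)).comp (Γ p))) ∧
      Γ (0, x₀) = ContinuousMap.const _ x₀ ∧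
      ∀ᶠ v in 𝓝 ((((0 : ℝ), x₀), ContinuousMap.const _ x₀) : (ℝ × E) × C(Icc (-1 : ℝ) 1, E)),
        v.2 = ContinuousMap.const _ v.1.2 +
          v.1.1 • primitiveCLM E ((⟨f, hf.continuous⟩ : C(E, E)).comp v.2) → Γ v.1 = v.2 := by
  let W := C(Icc (-1 : ℝ) 1, E)
  let c : E →L[ℝ] W := ContinuousLinearMap.const ℝ (Icc (-1 : ℝ) 1)
  have hc : ∀ x, ContinuousMap.const _ x = c x := fun x => rfl
  -- After rescaling time, a solution of length ε starting at x is a path on [-1, 1] with γ = x + ε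
  -- N(γ). At ε = 0 the equation degenerates to γ = x, so its linearization in γ there is the
  -- identity.
  let N : W → W := fun γ => primitiveCLM E ((⟨f, hf.continuous⟩ : C(E, E)).comp γ)
  have hN : ContDiff ℝ ∞ N := (primitiveCLM E).contDiff.comp (contDiff_postcomp _ hf)
  let G : (ℝ × E) × W → W := fun v => v.2 - c v.1.2 - v.1.1 • N v.2
  have hG : ContDiff ℝ ∞ G := by
    refine (contDiff_snd.sub (c.contDiff.comp contDiff_fst.snd)).sub ?_
    exact contDiff_fst.fst.smul (hN.comp contDiff_snd)
  let H : (ℝ × E) × W → (ℝ × E) × W := fun v => (v.1, G v)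
  have hH : ContDiff ℝ ∞ H := contDiff_fst.prodMk hG
  let u : (ℝ × E) × W := ((0, x₀), c x₀)
  have hGu : G u = 0 := by simp [G, u]
  -- The derivative of the right-hand side in (ε, x) at ε = 0; the term ε dN is absent because its
  -- factor vanishes there.
  let T : (ℝ × E) →L[ℝ] W := c ∘L ContinuousLinearMap.snd ℝ ℝ E +
    (ContinuousLinearMap.fst ℝ ℝ E).smulRight (N (c x₀))
  have hGd : HasFDerivAt G (ContinuousLinearMap.snd ℝ (ℝ × E) W -
      T ∘L ContinuousLinearMap.fst ℝ (ℝ × E) W) u := by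
    have h1 : HasFDerivAt (fun v : (ℝ × E) × W => v.2) (ContinuousLinearMap.snd ℝ (ℝ × E) W) u :=
      hasFDerivAt_snd
    have h2 : HasFDerivAt (fun v : (ℝ × E) × W => c v.1.2)
        (c ∘L (ContinuousLinearMap.snd ℝ ℝ E ∘L ContinuousLinearMap.fst ℝ (ℝ × E) W)) u :=
      ContinuousLinearMap.hasFDerivAt
        (c ∘L (ContinuousLinearMap.snd ℝ ℝ E ∘L ContinuousLinearMap.fst ℝ (ℝ × E) W))
    have h3 : HasFDerivAt (fun v : (ℝ × E) × W => v.1.1)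
        (ContinuousLinearMap.fst ℝ ℝ E ∘L ContinuousLinearMap.fst ℝ (ℝ × E) W) u :=
      ContinuousLinearMap.hasFDerivAt
        (ContinuousLinearMap.fst ℝ ℝ E ∘L ContinuousLinearMap.fst ℝ (ℝ × E) W)
    have h4 : HasFDerivAt (fun v : (ℝ × E) × W => N v.2)
        ((fderiv ℝ N u.2) ∘L ContinuousLinearMap.snd ℝ (ℝ × E) W) u :=
      (hN.differentiable (by simp) u.2).hasFDerivAt.comp u hasFDerivAt_snd
    refine ((h1.sub h2).sub (h3.smul h4)).congr_fderiv ?_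
    ext v
    · simp [T, u]
    · simp [T, u]
    · simp [T, u]
  -- The derivative of `H` is unipotent triangular, so its inverse is obtained by changing the sign
  -- of `T`.
  let e : ((ℝ × E) × W) ≃L[ℝ] ((ℝ × E) × W) :=
    ContinuousLinearEquiv.equivOfInverse
      ((ContinuousLinearMap.fst ℝ (ℝ × E) W).prod (ContinuousLinearMap.snd ℝ (ℝ × E) W -
        T ∘L ContinuousLinearMap.fst ℝ (ℝ × E) W))
      ((ContinuousLinearMap.fst ℝ (ℝ × E) W).prod (ContinuousLinearMap.snd ℝ (ℝ × E) W +
        T ∘L ContinuousLinearMap.fst ℝ (ℝ × E) W))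
      (fun v => by ext <;> simp) (fun v => by ext <;> simp)
  have hHd : HasFDerivAt H (e : ((ℝ × E) × W) →L[ℝ] ((ℝ × E) × W)) u := hasFDerivAt_fst.prodMk hGd
  obtain ⟨g, V, hVo, huV, hg, hgl, hgr⟩ := exists_contDiffOn_local_inverse isOpen_univ
    hH.contDiffOn (mem_univ u) e hHd
  have hHu : H u = ((0, x₀), 0) := Prod.ext rfl hGu
  rw [hHu] at huV
  have hfst : ∀ p : ℝ × E, (p, (0 : W)) ∈ V → (g (p, 0)).1 = p := fun p hp =>
    congrArg Prod.fst (hgr _ hp)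
  refine ⟨fun p => (g (p, 0)).2, (fun p => (p, (0 : W))) ⁻¹' V, hVo.preimage (by fun_prop), huV,
    ?_, fun p hp => ?_, ?_, ?_⟩
  · exact contDiff_snd.comp_contDiffOn (hg.comp (by fun_prop) fun p hp => hp)
  · have h := congrArg Prod.snd (hgr _ hp)
    change (g (p, 0)).2 - c (g (p, 0)).1.2 - (g (p, 0)).1.1 • N (g (p, 0)).2 = 0 at h
    rw [hfst p hp, sub_sub, sub_eq_zero] at h
    exact h
  · have h := hgl.self_of_nhds
    rw [hHu] at h
    exact congrArg Prod.snd h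
  · filter_upwards [hgl] with v hv hv2
    have : H v = (v.1, 0) := by
      refine Prod.ext rfl ?_
      change v.2 - c v.1.2 - v.1.1 • N v.2 = 0
      rw [sub_sub, sub_eq_zero]
      exact hv2
    have hv' : g (H v) = v := hv
    rw [this] at hv'
    exact congrArg Prod.snd hv'

/-- The local flow of a smooth vector field on a Banach space is smooth. -/
lemma exists_smooth_local_flow {f : E → E} (hf : ContDiff ℝ ∞ f) (x₀ : E) :
    ∃ (φ : ℝ × E → E) (ε : ℝ) (U : Set E), 0 < ε ∧ IsOpen U ∧ x₀ ∈ U ∧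
      ContDiffOn ℝ ∞ φ (Ioo (-ε) ε ×ˢ U) ∧ (∀ x ∈ U, φ (0, x) = x) ∧
      ∀ x ∈ U, ∀ t ∈ Ioo (-ε) ε, HasDerivAt (fun t => φ (t, x)) (f (φ (t, x))) t := by
  obtain ⟨Γ, U, hU, h0U, hΓ, hsol, hΓ0, huniq⟩ := exists_smooth_solution_path hf x₀
  obtain ⟨r, hr, huniq⟩ := Metric.eventually_nhds_iff.1 huniq
  have hcont : ContinuousAt Γ (0, x₀) := (hΓ.continuousOn).continuousAt (hU.mem_nhds h0U)
  have hev : ∀ᶠ p in 𝓝 ((0 : ℝ), x₀), p ∈ U ∧ dist (Γ p) (ContinuousMap.const _ x₀) < r ∧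
      dist p (0, x₀) < r := by
    rw [← hΓ0]
    filter_upwards [hU.mem_nhds h0U, hcont (Metric.ball_mem_nhds _ hr),
      Metric.ball_mem_nhds _ hr] with p h1 h2 h3 using ⟨h1, h2, h3⟩
  obtain ⟨ε, hε, hev⟩ := Metric.eventually_nhds_iff.1 hev
  have hmem : ∀ t x, |t| < ε → dist x x₀ < ε → dist ((t, x) : ℝ × E) (0, x₀) < ε := by
    intro t x ht hx
    rw [Prod.dist_eq, max_lt_iff]
    exact ⟨by simpa using ht, hx⟩
  let one : Icc (-1 : ℝ) 1 := ⟨1, by norm_num, le_rfl⟩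
  -- The path `s ↦ Γ (t, x) (l * s)` solves the equation for length `l * t` and stays near the
  -- constant path, so local uniqueness identifies it with `Γ (l * t, x)`. Varying the length
  -- parameter thereby becomes moving along one solution.
  have hscale : ∀ t x, |t| < ε → dist x x₀ < ε → ∀ l : Icc (-1 : ℝ) 1,
      Γ (l * t, x) one = Γ (t, x) l := by
    intro t x ht hx l
    obtain ⟨h1, h2, h3⟩ := hev (hmem t x ht hx)
    have hm : ∀ s : Icc (-1 : ℝ) 1, (l : ℝ) * s ∈ Icc (-1 : ℝ) 1 := fun s => by
      rw [mem_Icc, ← abs_le, abs_mul]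
      exact mul_le_one₀ (abs_le.2 l.2) (abs_nonneg _) (abs_le.2 s.2)
    let m : C(Icc (-1 : ℝ) 1, Icc (-1 : ℝ) 1) := ⟨fun s => ⟨l * s, hm s⟩, by fun_prop⟩
    let γ' : C(Icc (-1 : ℝ) 1, E) := (Γ (t, x)).comp m
    have hd1 : dist γ' (ContinuousMap.const _ x₀) < r := by
      refine lt_of_le_of_lt ((ContinuousMap.dist_le dist_nonneg).2 fun s => ?_) h2
      exact ContinuousMap.dist_apply_le_dist (f := Γ (t, x))
        (g := ContinuousMap.const _ x₀) (m s)
    have hlt : |l * t| ≤ |t| := by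
      rw [abs_mul]
      exact mul_le_of_le_one_left (abs_nonneg _) (abs_le.2 l.2)
    have hd2 : dist (((l : ℝ) * t, x) : ℝ × E) (0, x₀) < r := by
      refine lt_of_le_of_lt ?_ h3
      rw [Prod.dist_eq, Prod.dist_eq]
      exact max_le_max (by simpa using hlt) le_rfl
    have key := @huniq (((l : ℝ) * t, x), γ') (by
      rw [Prod.dist_eq]; exact max_lt hd2 hd1) ?_
    · have h4 := congrArg (fun γ : C(Icc (-1 : ℝ) 1, E) => γ one) key
      refine h4.trans ?_
      change Γ (t, x) (m one) = _
      congr 1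
      exact Subtype.ext (mul_one _)
    · ext s
      have h5 := congrArg (fun γ : C(Icc (-1 : ℝ) 1, E) => γ (m s)) (hsol _ h1)
      refine h5.trans ?_
      simp only [ContinuousMap.add_apply, ContinuousMap.const_apply, ContinuousMap.smul_apply]
      congr 1
      rw [mul_comm, mul_smul, primitiveCLM_scale _ _ l _ s (m s) rfl]
      intro s r hsr
      have : m s = r := Subtype.ext hsr.symm
      change f (Γ (t, x) (m s)) = f (Γ (t, x) r)
      rw [this]
  refine ⟨fun p => Γ p one, ε / 2, Metric.ball x₀ ε, by positivity, Metric.isOpen_ball,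
    Metric.mem_ball_self hε, ?_, fun x hx => ?_, fun x hx t ht => ?_⟩
  · refine (ContinuousMap.evalCLM ℝ one).contDiff.comp_contDiffOn (hΓ.mono ?_)
    rintro ⟨t, x⟩ ⟨ht, hx⟩
    exact (hev (hmem t x (by rw [abs_lt]; constructor <;> linarith [ht.1, ht.2]) hx)).1
  · have h := hsol _ (hev (hmem 0 x (by simpa using hε) hx)).1
    change Γ (0, x) one = x
    rw [h]
    simp
  · have hε2 : |ε / 2| < ε := by rw [abs_of_pos (by positivity)]; linarith
    have h := hsol _ (hev (hmem (ε / 2) x hε2 hx)).1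
    have hs : t / (ε / 2) ∈ Ioo (-1 : ℝ) 1 := by
      rw [mem_Ioo, lt_div_iff₀ (by positivity), div_lt_iff₀ (by positivity)]
      constructor <;> linarith [ht.1, ht.2]
    -- All values of the flow line are read off from the single path of length `ε / 2`, where the
    -- fundamental theorem of calculus gives the derivative.
    have hφ : ∀ s ∈ Ioo (-(ε / 2)) (ε / 2), Γ (s, x) one = x + (ε / 2) •
        IccExtend (show (-1 : ℝ) ≤ 1 by norm_num) (primitiveCLM E
          ((⟨f, hf.continuous⟩ : C(E, E)).comp (Γ (ε / 2, x)))) (s / (ε / 2)) := by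
      intro s hs
      have hs' : s / (ε / 2) ∈ Icc (-1 : ℝ) 1 := by
        rw [mem_Icc, le_div_iff₀ (by positivity), div_le_iff₀ (by positivity)]
        constructor <;> linarith [hs.1, hs.2]
      have h6 := hscale (ε / 2) x hε2 hx ⟨_, hs'⟩
      rw [show s / (ε / 2) * (ε / 2) = s by field_simp] at h6
      rw [h6, IccExtend_of_mem _ _ hs', h]
      simp only [ContinuousMap.add_apply, ContinuousMap.const_apply, ContinuousMap.smul_apply]
      rw [← h]
    have h7 := (hasDerivAt_primitiveCLM
      ((⟨f, hf.continuous⟩ : C(E, E)).comp (Γ (ε / 2, x))) hs).scomp t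
        ((hasDerivAt_id t).div_const (ε / 2))
    have h8 := (h7.const_smul (ε / 2)).const_add x
    refine (h8.congr_of_eventuallyEq ?_).congr_deriv ?_
    · filter_upwards [Ioo_mem_nhds ht.1 ht.2] with s hs using hφ s hs
    · have h6 := hscale (ε / 2) x hε2 hx ⟨_, Ioo_subset_Icc_self hs⟩
      rw [show t / (ε / 2) * (ε / 2) = t by field_simp] at h6
      change _ = f (Γ (t, x) one)
      rw [h6, smul_smul]
      rw [show ε / 2 * (1 / (ε / 2)) = 1 by field_simp, one_smul]
      rfl

end Flow

/-! ### Alternating forms of degree one and two, and their exterior derivatives -/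

section AlternatingMaps

variable {E F : Type*} [NormedAddCommGroup E] [NormedSpace ℝ E]
  [NormedAddCommGroup F] [NormedSpace ℝ F]

/-- Alternating `1`-forms as linear forms. -/
noncomputable def altOne (E : Type*) [NormedAddCommGroup E] [NormedSpace ℝ E] :
    (E [⋀^Fin 1]→L[ℝ] ℝ) →L[ℝ] (E →L[ℝ] ℝ) :=
  ((ContinuousAlternatingMap.ofSubsingletonLIE (𝕜 := ℝ) (E := E) (F := ℝ) (0 : Fin 1)).symm
    : (E [⋀^Fin 1]→L[ℝ] ℝ) →L[ℝ] (E →L[ℝ] ℝ))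

lemma altOne_apply (f : E [⋀^Fin 1]→L[ℝ] ℝ) (u : E) : altOne E f u = f (fun _ => u) := rfl

/-- Contraction of alternating `2`-forms with a vector. -/
noncomputable def contractTwo (E : Type*) [NormedAddCommGroup E] [NormedSpace ℝ E] :
    (E [⋀^Fin 2]→L[ℝ] ℝ) →ₗᵢ[ℝ] (E →L[ℝ] E [⋀^Fin 1]→L[ℝ] ℝ) :=
  ContinuousAlternatingMap.curryLeftLI

lemma contractTwo_apply (f : E [⋀^Fin 2]→L[ℝ] ℝ) (u v : E) :
    contractTwo E f u (fun _ => v) = f ![u, v] := by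
  change f (Matrix.vecCons u fun _ => v) = _
  congr 1
  ext i
  fin_cases i <;> rfl

lemma alt_two_self (f : E [⋀^Fin 2]→L[ℝ] ℝ) (u : E) : f ![u, u] = 0 :=
  f.map_eq_zero_of_eq _ (i := 0) (j := 1) rfl (by decide)

lemma alt_two_swap (f : E [⋀^Fin 2]→L[ℝ] ℝ) (u v : E) : f ![u, v] = -f ![v, u] := by
  have h : ∀ u v w, f ![u + v, w] = f ![u, w] + f ![v, w] := fun u v w => by
    simp only [← contractTwo_apply, map_add, ContinuousAlternatingMap.add_apply]
  have h' : ∀ u v w, f ![w, u + v] = f ![w, u] + f ![w, v] := fun u v w => by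
    simp only [← contractTwo_apply, ← altOne_apply, map_add]
  have h1 := alt_two_self f (u + v)
  rw [h, h', h', alt_two_self, alt_two_self] at h1
  linarith

/-- The vectors are constant fields, so the invariant formula for the exterior derivative has no
bracket term. -/
lemma extDeriv_one_apply {w : E → E [⋀^Fin 1]→L[ℝ] ℝ} {x : E} (h : DifferentiableAt ℝ w x)
    (a b : E) : extDeriv w x ![a, b] =
      fderiv ℝ (fun y => w y (fun _ => b)) x a - fderiv ℝ (fun y => w y (fun _ => a)) x b := by
  rw [extDeriv_apply h]
  have h0 : (Fin.removeNth 0 ![a, b]) = fun _ : Fin 1 => b := by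
    ext i; fin_cases i; rfl
  have h1 : (Fin.removeNth 1 ![a, b]) = fun _ : Fin 1 => a := by
    ext i; fin_cases i; rfl
  simp [Fin.sum_univ_succ, h0, h1, sub_eq_add_neg]

lemma extDeriv_two_apply {w : E → E [⋀^Fin 2]→L[ℝ] ℝ} {x : E} (h : DifferentiableAt ℝ w x)
    (a b c : E) : extDeriv w x ![a, b, c] =
      fderiv ℝ (fun y => w y ![b, c]) x a - fderiv ℝ (fun y => w y ![a, c]) x b +
        fderiv ℝ (fun y => w y ![a, b]) x c := by
  rw [extDeriv_apply h]
  have h0 : (Fin.removeNth 0 ![a, b, c]) = ![b, c] := by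
    ext i; fin_cases i <;> rfl
  have h1 : (Fin.removeNth 1 ![a, b, c]) = ![a, c] := by
    ext i; fin_cases i <;> rfl
  have h2 : (Fin.removeNth 2 ![a, b, c]) = ![a, b] := by
    ext i; fin_cases i <;> rfl
  simp [Fin.sum_univ_succ, h0, h1, h2, sub_eq_add_neg, add_assoc]

lemma ContDiffAt.alt_one_apply {w : F → E [⋀^Fin 1]→L[ℝ] ℝ} {a : F → E} {p : F}
    (hw : ContDiffAt ℝ ∞ w p) (ha : ContDiffAt ℝ ∞ a p) :
    ContDiffAt ℝ ∞ (fun q => w q (fun _ => a q)) p :=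
  ((altOne E).contDiff.contDiffAt.comp p hw).clm_apply ha

/-- Contraction is a bounded bilinear map. This gives joint smoothness in the form and the vector,
needed where both vary with a parameter. -/
lemma contDiff_curryLeft : ContDiff ℝ ∞
    (fun p : (E [⋀^Fin 2]→L[ℝ] ℝ) × E => ContinuousAlternatingMap.curryLeft p.1 p.2) := by
  refine IsBoundedBilinearMap.contDiff (𝕜 := ℝ) ⟨fun _ _ _ => rfl, fun _ _ _ => rfl,
    fun f u v => ?_, fun c f u => ?_, 1, one_pos, fun f u => ?_⟩
  · exact map_add (ContinuousAlternatingMap.curryLeft f) u v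
  · exact map_smul (ContinuousAlternatingMap.curryLeft f) c u
  · rw [one_mul]
    refine ContinuousAlternatingMap.opNorm_le_bound _ (by positivity) fun m => ?_
    exact f.toContinuousMultilinearMap.norm_map_cons_le u m

lemma ContDiffAt.alt_two_apply {w : F → E [⋀^Fin 2]→L[ℝ] ℝ} {a b : F → E} {p : F}
    (hw : ContDiffAt ℝ ∞ w p) (ha : ContDiffAt ℝ ∞ a p) (hb : ContDiffAt ℝ ∞ b p) :
    ContDiffAt ℝ ∞ (fun q => w q ![a q, b q]) p := by
  simp only [← contractTwo_apply]
  exact ContDiffAt.alt_one_apply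
    (contDiff_curryLeft.contDiffAt.comp p (hw.prodMk ha)) hb

end AlternatingMaps

/-! ### Pullback of forms along maps from normed spaces -/

section Pullback

variable {d : ℕ} {M : Type*} [TopologicalSpace M] [ChartedSpace (EuclideanSpace ℝ (Fin d)) M]
  [IsManifold (𝓡 d) ∞ M] {k : ℕ}

instance isManifold_one : IsManifold (𝓡 d) 1 M := IsManifold.of_le (n := ∞) (by simp)

lemma mfderiv_extChartAt_symm_mfderiv {x₀ q : M} (hq : q ∈ (extChartAt (𝓡 d) x₀).source)
    (v : TangentSpace (𝓡 d) q) :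
    mfderiv (𝓡 d) (𝓡 d) (extChartAt (𝓡 d) x₀).symm (extChartAt (𝓡 d) x₀ q)
      (mfderiv (𝓡 d) (𝓡 d) (extChartAt (𝓡 d) x₀) q v) = v := by
  have h := mfderivWithin_extChartAt_symm_comp_mfderiv_extChartAt' (I := 𝓡 d) hq
  rw [modelWithCornersSelf_coe, range_id, mfderivWithin_univ] at h
  exact DFunLike.congr_fun h v

lemma mfderiv_extChartAt_mfderiv_symm {x₀ : M} {y : EuclideanSpace ℝ (Fin d)}
    (hy : y ∈ (extChartAt (𝓡 d) x₀).target) (v : EuclideanSpace ℝ (Fin d)) :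
    mfderiv (𝓡 d) (𝓡 d) (extChartAt (𝓡 d) x₀) ((extChartAt (𝓡 d) x₀).symm y)
      (mfderiv (𝓡 d) (𝓡 d) (extChartAt (𝓡 d) x₀).symm y v) = v := by
  have h := mfderiv_extChartAt_comp_mfderivWithin_extChartAt_symm (I := 𝓡 d) hy
  rw [modelWithCornersSelf_coe, range_id, mfderivWithin_univ] at h
  exact DFunLike.congr_fun h v

lemma DForm.apply_eq_inChart (α : DForm d M k) {x₀ q : M}
    (hq : q ∈ (extChartAt (𝓡 d) x₀).source) (v : Fin k → TangentSpace (𝓡 d) q) :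
    α q v = α.inChart x₀ (extChartAt (𝓡 d) x₀ q)
      (fun i => mfderiv (𝓡 d) (𝓡 d) (extChartAt (𝓡 d) x₀) q (v i)) := by
  -- The point `κ.symm (κ q)` equals `q` only propositionally. Every tangent space unfolds to the
  -- model space, so vectors there can be kept fixed while the base point is rewritten.
  have key : ∀ q' : M, q = q' → ∀ w : Fin k → EuclideanSpace ℝ (Fin d),
      α q w = α q' w := by rintro _ rfl _; rfl
  have h : ∀ i, mfderiv (𝓡 d) (𝓡 d) (extChartAt (𝓡 d) x₀).symm (extChartAt (𝓡 d) x₀ q)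
      (mfderiv (𝓡 d) (𝓡 d) (extChartAt (𝓡 d) x₀) q (v i)) = v i := fun i =>
    mfderiv_extChartAt_symm_mfderiv hq (v i)
  refine (key _ ((extChartAt (𝓡 d) x₀).left_inv hq).symm v).trans ?_
  change _ = α _ (fun i => mfderiv (𝓡 d) (𝓡 d) (extChartAt (𝓡 d) x₀).symm
    (extChartAt (𝓡 d) x₀ q) (mfderiv (𝓡 d) (𝓡 d) (extChartAt (𝓡 d) x₀) q (v i)))
  congr 1
  exact funext fun i => (h i).symm

variable {V : Type*} [NormedAddCommGroup V] [NormedSpace ℝ V] {F : V → M} {W : Set V}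

lemma contDiffAt_extChartAt_comp {p : V} (hF : ContMDiffAt 𝓘(ℝ, V) (𝓡 d) ∞ F p) {x₀ : M}
    (hp : F p ∈ (extChartAt (𝓡 d) x₀).source) :
    ContDiffAt ℝ ∞ (fun p => extChartAt (𝓡 d) x₀ (F p)) p := by
  rw [extChartAt_source] at hp
  exact ((contMDiffAt_extChartAt' hp).comp p hF).contDiffAt

lemma fderiv_extChartAt_comp {p : V} (hF : MDifferentiableAt 𝓘(ℝ, V) (𝓡 d) F p) {x₀ : M}
    (hp : F p ∈ (extChartAt (𝓡 d) x₀).source) (v : V) :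
    fderiv ℝ (fun p => extChartAt (𝓡 d) x₀ (F p)) p v =
      mfderiv (𝓡 d) (𝓡 d) (extChartAt (𝓡 d) x₀) (F p) (mfderiv 𝓘(ℝ, V) (𝓡 d) F p v) := by
  rw [extChartAt_source] at hp
  rw [← mfderiv_eq_fderiv]
  exact mfderiv_comp_apply p (mdifferentiableAt_extChartAt hp) hF v

lemma DForm.apply_mfderiv_eq (α : DForm d M k) {p : V}
    (hF : MDifferentiableAt 𝓘(ℝ, V) (𝓡 d) F p) {x₀ : M}
    (hp : F p ∈ (extChartAt (𝓡 d) x₀).source) (v : Fin k → V) :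
    α (F p) (fun i => mfderiv 𝓘(ℝ, V) (𝓡 d) F p (v i)) =
      (α.inChart x₀ (extChartAt (𝓡 d) x₀ (F p))).compContinuousLinearMap
        (fderiv ℝ (fun p => extChartAt (𝓡 d) x₀ (F p)) p) v := by
  rw [α.apply_eq_inChart hp]
  change _ = α.inChart x₀ _ (fun i => fderiv ℝ (fun p => extChartAt (𝓡 d) x₀ (F p)) p (v i))
  congr 1
  exact funext fun i => (fderiv_extChartAt_comp hF hp (v i)).symm

lemma DForm.eventually_apply_mfderiv_eq (α : DForm d M k) (hW : IsOpen W)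
    (hF : ContMDiffOn 𝓘(ℝ, V) (𝓡 d) ∞ F W) {p : V} (hp : p ∈ W) (v : Fin k → V) :
    ∀ᶠ q in 𝓝 p, α (F q) (fun i => mfderiv 𝓘(ℝ, V) (𝓡 d) F q (v i)) =
      (α.inChart (F p) (extChartAt (𝓡 d) (F p) (F q))).compContinuousLinearMap
        (fderiv ℝ (fun q => extChartAt (𝓡 d) (F p) (F q)) q) v := by
  have hFp : ContinuousAt F p := (hF.contMDiffAt (hW.mem_nhds hp)).continuousAt
  filter_upwards [hW.mem_nhds hp, hFp (extChartAt_source_mem_nhds (I := 𝓡 d) (F p))] with q hq hq'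
  exact α.apply_mfderiv_eq ((hF.contMDiffAt (hW.mem_nhds hq)).mdifferentiableAt (by simp)) hq' v

lemma DForm.contDiffAt_inChart_comp {α : DForm d M k} (hα : α.IsSmooth) (hW : IsOpen W)
    (hF : ContMDiffOn 𝓘(ℝ, V) (𝓡 d) ∞ F W) {p : V} (hp : p ∈ W) :
    ContDiffAt ℝ ∞ (fun q => α.inChart (F p) (extChartAt (𝓡 d) (F p) (F q))) p := by
  have h1 := contDiffAt_extChartAt_comp (hF.contMDiffAt (hW.mem_nhds hp))
    (mem_extChartAt_source (I := 𝓡 d) (F p))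
  have h2 : ContDiffAt ℝ ∞ (α.inChart (F p)) (extChartAt (𝓡 d) (F p) (F p)) :=
    (hα (F p)).contDiffAt (extChartAt_target_mem_nhds (F p))
  exact h2.comp p h1

lemma DForm.IsSmooth.contDiffOn_two {α : DForm d M 2} (hα : α.IsSmooth) (hW : IsOpen W)
    (hF : ContMDiffOn 𝓘(ℝ, V) (𝓡 d) ∞ F W) (a b : V) :
    ContDiffOn ℝ ∞ (fun p => α (F p) ![mfderiv 𝓘(ℝ, V) (𝓡 d) F p a,
      mfderiv 𝓘(ℝ, V) (𝓡 d) F p b]) W := by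
  intro p hp
  have h1 := contDiffAt_extChartAt_comp (hF.contMDiffAt (hW.mem_nhds hp))
    (mem_extChartAt_source (I := 𝓡 d) (F p))
  have hd : ∀ c : V, ContDiffAt ℝ ∞
      (fun q => fderiv ℝ (fun p' => extChartAt (𝓡 d) (F p) (F p')) q c) p := fun c =>
    (h1.fderiv_right (m := ∞) (by simp)).clm_apply contDiffAt_const
  have h2 := ContDiffAt.alt_two_apply (α.contDiffAt_inChart_comp hα hW hF hp) (hd a) (hd b)
  refine (h2.congr_of_eventuallyEq ?_).contDiffWithinAt
  filter_upwards [α.eventually_apply_mfderiv_eq hW hF hp ![a, b]] with q hq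
  refine Eq.trans ?_ (hq.trans ?_)
  · congr 1
    ext i : 1
    fin_cases i <;> rfl
  · change α.inChart (F p) _ _ = _
    congr 1
    ext i : 1
    fin_cases i <;> rfl

/-- Exterior differentiation commutes with pullback along the coordinate expression of `F`. The
chart is centred at `F p` and held fixed near `p`, so that one smooth form on an open set is being
differentiated. -/
lemma DForm.extDeriv_pullback_eq_zero {α : DForm d M k} (hα : α.IsSmooth)
    (hc : α.ExtDerivEqZero) (hW : IsOpen W)
    (hF : ContMDiffOn 𝓘(ℝ, V) (𝓡 d) ∞ F W) {p : V} (hp : p ∈ W) :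
    DifferentiableAt ℝ (fun q => (α.inChart (F p)
      (extChartAt (𝓡 d) (F p) (F q))).compContinuousLinearMap
        (fderiv ℝ (fun q => extChartAt (𝓡 d) (F p) (F q)) q)) p ∧
    extDeriv (fun q => (α.inChart (F p) (extChartAt (𝓡 d) (F p) (F q))).compContinuousLinearMap
        (fderiv ℝ (fun q => extChartAt (𝓡 d) (F p) (F q)) q)) p = 0 := by
  have h1 := contDiffAt_extChartAt_comp (hF.contMDiffAt (hW.mem_nhds hp))
    (mem_extChartAt_source (I := 𝓡 d) (F p))
  constructor
  · exact ((α.contDiffAt_inChart_comp hα hW hF hp).differentiableAt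
      (by simp)).continuousAlternatingMapCompContinuousLinearMap
      ((h1.fderiv_right (m := ∞) (by simp)).differentiableAt (by simp))
  · have h2 := extDeriv_pullback (f := fun q => extChartAt (𝓡 d) (F p) (F q))
      (hα.differentiableAt (F p) (mem_extChartAt_target (I := 𝓡 d) (F p)))
      h1 (by
        rw [minSmoothness_of_isRCLikeNormedField]
        exact WithTop.coe_le_coe.2 le_top)
    rw [hc (F p) _ (mem_extChartAt_target (F p))] at h2
    rw [h2]
    rfl

/-- The pullback of a closed `2`-form is closed. -/
lemma DForm.fderiv_two_cyclic {α : DForm d M 2} (hα : α.IsSmooth)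
    (hc : α.ExtDerivEqZero) (hW : IsOpen W)
    (hF : ContMDiffOn 𝓘(ℝ, V) (𝓡 d) ∞ F W) {p : V} (hp : p ∈ W) (a b c : V) :
    fderiv ℝ (fun q => α (F q) ![mfderiv 𝓘(ℝ, V) (𝓡 d) F q b, mfderiv 𝓘(ℝ, V) (𝓡 d) F q c]) p a -
    fderiv ℝ (fun q => α (F q) ![mfderiv 𝓘(ℝ, V) (𝓡 d) F q a, mfderiv 𝓘(ℝ, V) (𝓡 d) F q c]) p b +
    fderiv ℝ (fun q => α (F q) ![mfderiv 𝓘(ℝ, V) (𝓡 d) F q a, mfderiv 𝓘(ℝ, V) (𝓡 d) F q b]) p c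
      = 0 := by
  obtain ⟨h1, h2⟩ := α.extDeriv_pullback_eq_zero hα hc hW hF hp
  have h3 := extDeriv_two_apply h1 a b c
  rw [h2] at h3
  have h4 : ∀ b c : V, fderiv ℝ (fun q => α (F q) ![mfderiv 𝓘(ℝ, V) (𝓡 d) F q b,
      mfderiv 𝓘(ℝ, V) (𝓡 d) F q c]) p =
      fderiv ℝ (fun q => (α.inChart (F p) (extChartAt (𝓡 d) (F p) (F q))).compContinuousLinearMap
        (fderiv ℝ (fun q => extChartAt (𝓡 d) (F p) (F q)) q) ![b, c]) p := fun b c => by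
    refine Filter.EventuallyEq.fderiv_eq ?_
    filter_upwards [α.eventually_apply_mfderiv_eq hW hF hp ![b, c]] with q hq
    refine Eq.trans ?_ hq
    congr 1
    ext i : 1
    fin_cases i <;> rfl
  rw [h4, h4, h4]
  exact h3.symm

end Pullback

/-! ### Smoothness and closedness of one-forms in coordinates -/

section OneForms

variable {E : Type*} [NormedAddCommGroup E] [NormedSpace ℝ E]
  {F : Type*} [NormedAddCommGroup F] [NormedSpace ℝ F]

lemma alt_two_cons (f : E [⋀^Fin 2]→L[ℝ] ℝ) (v : Fin 2 → E) : f v = f ![v 0, v 1] := by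
  congr 1
  ext i
  fin_cases i <;> rfl

lemma contDiffOn_alt_one [FiniteDimensional ℝ E] {w : F → E [⋀^Fin 1]→L[ℝ] ℝ} {U : Set F}
    (h : ∀ u : E, ContDiffOn ℝ ∞ (fun y => w y (fun _ => u)) U) : ContDiffOn ℝ ∞ w U := by
  have h1 : ContDiffOn ℝ ∞ (fun y => altOne E (w y)) U := contDiffOn_clm_apply.2 h
  refine ((ContinuousAlternatingMap.ofSubsingletonLIE (𝕜 := ℝ) (E := E) (F := ℝ)
    (0 : Fin 1)).contDiff.comp_contDiffOn h1).congr fun y _ => ?_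
  exact ((ContinuousAlternatingMap.ofSubsingletonLIE (𝕜 := ℝ) (E := E) (F := ℝ)
    (0 : Fin 1)).apply_symm_apply (w y)).symm

lemma extDeriv_one_eq_zero {w : E → E [⋀^Fin 1]→L[ℝ] ℝ} {x : E} (h : DifferentiableAt ℝ w x)
    (hs : ∀ a b : E, fderiv ℝ (fun y => w y (fun _ => b)) x a =
      fderiv ℝ (fun y => w y (fun _ => a)) x b) : extDeriv w x = 0 := by
  ext v
  rw [alt_two_cons, extDeriv_one_apply h, hs, sub_self]
  rfl

end OneForms

/-! ### Partial derivatives of families of maps -/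

section Families

variable {m n : ℕ} {X : Type*} [TopologicalSpace X]
  [ChartedSpace (EuclideanSpace ℝ (Fin m)) X]
  {Λ : Type*} [TopologicalSpace Λ] [ChartedSpace (EuclideanSpace ℝ (Fin n)) Λ]
  [IsManifold (𝓡 n) ∞ Λ]

/-- A family of maps on `Λ`, with the manifold variable read in the chart around `x₀`. -/
noncomputable def chartFamily (Φ : ℝ → Λ → X) (x₀ : Λ) : ℝ × EuclideanSpace ℝ (Fin n) → X :=
  fun q => Φ q.1 ((extChartAt (𝓡 n) x₀).symm q.2)

lemma contMDiffOn_chartFamily {Φ : ℝ → Λ → X} {I : Set ℝ}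
    (hΦ : ContMDiffOn (𝓘(ℝ, ℝ).prod (𝓡 n)) (𝓡 m) ∞ (fun p : ℝ × Λ => Φ p.1 p.2) (I ×ˢ univ))
    (x₀ : Λ) : ContMDiffOn 𝓘(ℝ, ℝ × EuclideanSpace ℝ (Fin n)) (𝓡 m) ∞ (chartFamily Φ x₀)
      (I ×ˢ (extChartAt (𝓡 n) x₀).target) := by
  have h1 : ContMDiffOn 𝓘(ℝ, ℝ × EuclideanSpace ℝ (Fin n)) (𝓘(ℝ, ℝ).prod (𝓡 n)) ∞
      (fun q : ℝ × EuclideanSpace ℝ (Fin n) => (q.1, (extChartAt (𝓡 n) x₀).symm q.2))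
      (I ×ˢ (extChartAt (𝓡 n) x₀).target) :=
    contDiff_fst.contMDiff.contMDiffOn.prodMk
      ((contMDiffOn_extChartAt_symm x₀).comp contDiff_snd.contMDiff.contMDiffOn
        fun q hq => hq.2)
  exact hΦ.comp h1 fun q hq => ⟨hq.1, mem_univ _⟩

variable {V V' : Type*} [NormedAddCommGroup V] [NormedSpace ℝ V]
  [NormedAddCommGroup V'] [NormedSpace ℝ V']

lemma mfderiv_comp_of_hasFDerivAt {F : V → X} {g : V' → V} {g' : V' →L[ℝ] V} {x : V'}
    (hF : MDifferentiableAt 𝓘(ℝ, V) (𝓡 m) F (g x)) (hg : HasFDerivAt g g' x) (v : V') :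
    mfderiv 𝓘(ℝ, V') (𝓡 m) (fun y => F (g y)) x v = mfderiv 𝓘(ℝ, V) (𝓡 m) F (g x) (g' v) := by
  have h := mfderiv_comp_apply x hF hg.differentiableAt.mdifferentiableAt v
  rw [mfderiv_eq_fderiv, hg.fderiv] at h
  exact h

variable {E : Type*} [NormedAddCommGroup E] [NormedSpace ℝ E]

lemma mfderiv_left {F : ℝ × E → X} {p : ℝ × E}
    (hF : MDifferentiableAt 𝓘(ℝ, ℝ × E) (𝓡 m) F p) :
    mfderiv 𝓘(ℝ, ℝ) (𝓡 m) (fun t => F (t, p.2)) p.1 (1 : ℝ) =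
      mfderiv 𝓘(ℝ, ℝ × E) (𝓡 m) F p ((1 : ℝ), (0 : E)) := by
  have h : HasFDerivAt (fun t : ℝ => (t, p.2)) (ContinuousLinearMap.inl ℝ ℝ E) p.1 :=
    hasFDerivAt_prodMk_left p.1 p.2
  exact mfderiv_comp_of_hasFDerivAt (x := p.1) (g := fun t : ℝ => (t, p.2)) hF h (1 : ℝ)

lemma mfderiv_right {F : ℝ × E → X} {p : ℝ × E}
    (hF : MDifferentiableAt 𝓘(ℝ, ℝ × E) (𝓡 m) F p) (u : E) :
    mfderiv 𝓘(ℝ, E) (𝓡 m) (fun y => F (p.1, y)) p.2 u =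
      mfderiv 𝓘(ℝ, ℝ × E) (𝓡 m) F p ((0 : ℝ), u) := by
  have h : HasFDerivAt (fun y : E => (p.1, y)) (ContinuousLinearMap.inr ℝ ℝ E) p.2 :=
    hasFDerivAt_prodMk_right p.1 p.2
  exact mfderiv_comp_of_hasFDerivAt (x := p.2) (g := fun y : E => (p.1, y)) hF h u

lemma mfderiv_chartFamily_right {Φ : ℝ → Λ → X} {x₀ : Λ} {t : ℝ}
    {y : EuclideanSpace ℝ (Fin n)} (hy : y ∈ (extChartAt (𝓡 n) x₀).target)
    (hΦ : MDifferentiableAt (𝓡 n) (𝓡 m) (Φ t) ((extChartAt (𝓡 n) x₀).symm y))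
    (hF : MDifferentiableAt 𝓘(ℝ, ℝ × EuclideanSpace ℝ (Fin n)) (𝓡 m) (chartFamily Φ x₀) (t, y))
    (u : EuclideanSpace ℝ (Fin n)) :
    mfderiv 𝓘(ℝ, ℝ × EuclideanSpace ℝ (Fin n)) (𝓡 m) (chartFamily Φ x₀) (t, y) ((0 : ℝ), u) =
      mfderiv (𝓡 n) (𝓡 m) (Φ t) ((extChartAt (𝓡 n) x₀).symm y)
        (mfderiv (𝓡 n) (𝓡 n) (extChartAt (𝓡 n) x₀).symm y u) := by
  rw [← mfderiv_right (p := (t, y)) hF u]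
  have hs : MDifferentiableAt (𝓡 n) (𝓡 n) (extChartAt (𝓡 n) x₀).symm y :=
    ((contMDiffOn_extChartAt_symm (n := ∞) x₀).contMDiffAt
      ((isOpen_extChartAt_target x₀).mem_nhds hy)).mdifferentiableAt (by simp)
  exact mfderiv_comp_apply (f := (extChartAt (𝓡 n) x₀).symm) y hΦ hs u

end Families

/-! ### Velocities of Lagrangian paths are closed -/

section Closed

variable {n : ℕ} {X : Type*} [TopologicalSpace X]
  [ChartedSpace (EuclideanSpace ℝ (Fin (2 * n))) X] [IsManifold (𝓡 (2 * n)) ∞ X]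
  {Λ : Type*} [TopologicalSpace Λ] [ChartedSpace (EuclideanSpace ℝ (Fin n)) Λ]
  [IsManifold (𝓡 n) ∞ Λ]

/-- With F(t, y) = Φ_t(y) in a chart, α is F^*Ω(∂_t, ·) at t = 0. Closedness of F^*Ω on ∂_t, u, v
expresses dα(u, v) as ∂_t F^*Ω(u, v), and the latter vanishes since all slices are isotropic. -/
theorem tangentVectors_lagrangianCycles_subset {Ω : DForm (2 * n) X 2} (hs : Ω.IsSmooth)
    (hc : Ω.ExtDerivEqZero) (ι : Λ → X) :
    tangentVectors Ω (lagrangianCycles Λ Ω) ι ⊆ closedForms n Λ 1 := by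
  rintro α ⟨Φ, hΦ, hL, -, -, hα⟩
  set E := EuclideanSpace ℝ (Fin n)
  have hF : ∀ x₀ : Λ, ContMDiffOn 𝓘(ℝ, ℝ × E) (𝓡 (2 * n)) ∞ (chartFamily Φ x₀)
      (univ ×ˢ (extChartAt (𝓡 n) x₀).target) := fun x₀ =>
    contMDiffOn_chartFamily hΦ.contMDiffOn x₀
  have hW : ∀ x₀ : Λ, IsOpen ((univ : Set ℝ) ×ˢ (extChartAt (𝓡 n) x₀).target) := fun x₀ =>
    isOpen_univ.prod (isOpen_extChartAt_target x₀)
  have hd : ∀ x₀ : Λ, ∀ y ∈ (extChartAt (𝓡 n) x₀).target, ∀ t : ℝ,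
      MDifferentiableAt 𝓘(ℝ, ℝ × E) (𝓡 (2 * n)) (chartFamily Φ x₀) (t, y) := fun x₀ y hy t =>
    ((hF x₀).contMDiffAt ((hW x₀).mem_nhds ⟨mem_univ _, hy⟩)).mdifferentiableAt (by simp)
  let B : Λ → ℝ × E → ℝ × E → ℝ × E → ℝ := fun x₀ v w q =>
    Ω (chartFamily Φ x₀ q) ![mfderiv 𝓘(ℝ, ℝ × E) (𝓡 (2 * n)) (chartFamily Φ x₀) q v,
      mfderiv 𝓘(ℝ, ℝ × E) (𝓡 (2 * n)) (chartFamily Φ x₀) q w]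
  have hB : ∀ x₀ v w, ContDiffOn ℝ ∞ (B x₀ v w) (univ ×ˢ (extChartAt (𝓡 n) x₀).target) :=
    fun x₀ v w => hs.contDiffOn_two (hW x₀) (hF x₀) v w
  have hαB : ∀ x₀, ∀ y ∈ (extChartAt (𝓡 n) x₀).target, ∀ u : E,
      α.inChart x₀ y (fun _ => u) = B x₀ (1, 0) (0, u) (0, y) := by
    intro x₀ y hy u
    change _ = Ω _ ![_, _]
    rw [mfderiv_chartFamily_right hy ((hL 0).smooth.mdifferentiableAt (by simp)) (hd x₀ y hy 0),
      ← mfderiv_left (hd x₀ y hy 0)]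
    exact hα _ _
  have hαs : ∀ x₀, ContDiffOn ℝ ∞ (α.inChart x₀) (extChartAt (𝓡 n) x₀).target := by
    intro x₀
    refine contDiffOn_alt_one fun u => ?_
    have h1 : ContDiffOn ℝ ∞ (fun y : E => B x₀ (1, 0) (0, u) (0, y))
        (extChartAt (𝓡 n) x₀).target :=
      (hB x₀ (1, 0) (0, u)).comp (contDiff_prodMk_right (0 : ℝ)).contDiffOn
        fun y hy => ⟨mem_univ _, hy⟩
    exact h1.congr fun y hy => hαB x₀ y hy u
  refine ⟨hαs, fun x₀ y hy => ?_⟩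
  have hnh := (isOpen_extChartAt_target x₀).mem_nhds hy
  refine extDeriv_one_eq_zero (((hαs x₀).contDiffAt hnh).differentiableAt (by simp))
    fun u v => ?_
  have hcy := DForm.fderiv_two_cyclic hs hc (hW x₀) (hF x₀)
    (p := ((0 : ℝ), y)) ⟨mem_univ _, hy⟩ (1, 0) (0, u) (0, v)
  -- Isotropy is used for all times near 0, not only at t = 0: the function vanishes on an open set
  -- of (t, z), so its t-derivative vanishes too.
  have hz : fderiv ℝ (B x₀ (0, u) (0, v)) (0, y) = 0 := by
    have : B x₀ (0, u) (0, v) =ᶠ[𝓝 ((0 : ℝ), y)] fun _ => 0 := by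
      filter_upwards [(hW x₀).mem_nhds (x := ((0 : ℝ), y)) ⟨mem_univ _, hy⟩] with q hq
      obtain ⟨t, z⟩ := q
      have hz := hq.2
      change Ω _ ![_, _] = 0
      rw [mfderiv_chartFamily_right hz ((hL t).smooth.mdifferentiableAt (by simp))
        (hd x₀ z hz t), mfderiv_chartFamily_right hz ((hL t).smooth.mdifferentiableAt (by simp))
        (hd x₀ z hz t)]
      exact (hL t).isotropic _ _ _
    rw [this.fderiv_eq]
    simp
  have hval : ∀ a b : E, fderiv ℝ (fun z => α.inChart x₀ z (fun _ => b)) y a =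
      fderiv ℝ (B x₀ (1, 0) (0, b)) (0, y) (0, a) := by
    intro a b
    have h1 : (fun z => α.inChart x₀ z (fun _ => b)) =ᶠ[𝓝 y]
        fun z => B x₀ (1, 0) (0, b) (0, z) := by
      filter_upwards [hnh] with z hz using hαB x₀ z hz b
    rw [h1.fderiv_eq]
    have h2 : HasFDerivAt (B x₀ (1, 0) (0, b)) _ ((0 : ℝ), y) :=
      (((hB x₀ (1, 0) (0, b)).contDiffAt ((hW x₀).mem_nhds ⟨mem_univ _, hy⟩)).differentiableAt
        (by simp)).hasFDerivAt
    have h3 := (h2.comp y (hasFDerivAt_prodMk_right (𝕜 := ℝ) (0 : ℝ) y)).fderiv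
    exact DFunLike.congr_fun h3 a
  rw [hval, hval]
  have hz' := DFunLike.congr_fun hz ((1 : ℝ), (0 : E))
  have hz2 : fderiv ℝ (B x₀ (0, u) (0, v)) (0, y) (1, 0) = 0 := hz'
  change fderiv ℝ (B x₀ (0, u) (0, v)) (0, y) (1, 0) - fderiv ℝ (B x₀ (1, 0) (0, v)) (0, y) (0, u)
    + fderiv ℝ (B x₀ (1, 0) (0, u)) (0, y) (0, v) = 0 at hcy
  linarith

end Closed

/-! ### Vector fields in charts and their local flows -/

section Fields

variable {m : ℕ} {X : Type*} [TopologicalSpace X]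
  [ChartedSpace (EuclideanSpace ℝ (Fin m)) X] [IsManifold (𝓡 m) ∞ X]

/-- The components of a vector field in the chart around `x₀`. -/
noncomputable def fieldComponents (x₀ : X) (Y : ∀ x : X, TangentSpace (𝓡 m) x) (x : X) :
    EuclideanSpace ℝ (Fin m) :=
  mfderiv (𝓡 m) (𝓡 m) (extChartAt (𝓡 m) x₀) x (Y x)

/-- The fibre coordinate in the standard trivialization of the tangent bundle is the derivative of
the chart, so smoothness of the section is smoothness of its components. -/
lemma contMDiffAt_field_iff {Y : ∀ x : X, TangentSpace (𝓡 m) x} {x₀ x : X}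
    (hx : x ∈ (extChartAt (𝓡 m) x₀).source) :
    ContMDiffAt (𝓡 m) (𝓡 m).tangent ∞ (fun x => (⟨x, Y x⟩ : TangentBundle (𝓡 m) X)) x ↔
      ContMDiffAt (𝓡 m) (𝓡 m) ∞ (fieldComponents x₀ Y) x := by
  have hb : x ∈ (trivializationAt (EuclideanSpace ℝ (Fin m)) (TangentSpace (𝓡 m)) x₀).baseSet := by
    rwa [TangentBundle.trivializationAt_baseSet, ← extChartAt_source (𝓡 m)]
  have h := Bundle.Trivialization.contMDiffAt_section_iff (IB := 𝓡 m) (n := ∞) (s := Y)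
    (trivializationAt (EuclideanSpace ℝ (Fin m)) (TangentSpace (𝓡 m)) x₀) hb
  refine h.trans ?_
  refine Filter.EventuallyEq.contMDiffAt_iff ?_
  rw [extChartAt_source] at hx
  filter_upwards [(chartAt (EuclideanSpace ℝ (Fin m)) x₀).open_source.mem_nhds hx] with q hq
  have h1 := TangentBundle.continuousLinearMapAt_trivializationAt (I := 𝓡 m) hq
  have h2 := DFunLike.congr_fun h1 (Y q)
  refine Eq.trans ?_ h2
  rw [Bundle.Trivialization.continuousLinearMapAt_apply,
    Bundle.Trivialization.linearMapAt_apply, if_pos]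
  rwa [TangentBundle.trivializationAt_baseSet]

lemma IsSmoothField.contDiffOn {Y : ∀ x : X, TangentSpace (𝓡 m) x} (hY : IsSmoothField Y)
    (x₀ : X) : ContDiffOn ℝ ∞ (fun y => fieldComponents x₀ Y ((extChartAt (𝓡 m) x₀).symm y))
      (extChartAt (𝓡 m) x₀).target := by
  rw [← contMDiffOn_iff_contDiffOn]
  intro y hy
  refine ContMDiffAt.contMDiffWithinAt ?_
  have hs : ContMDiffAt (𝓡 m) (𝓡 m) ∞ (extChartAt (𝓡 m) x₀).symm y :=
    (contMDiffOn_extChartAt_symm x₀).contMDiffAt ((isOpen_extChartAt_target x₀).mem_nhds hy)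
  exact ((contMDiffAt_field_iff ((extChartAt (𝓡 m) x₀).map_target hy)).1
    (hY ((extChartAt (𝓡 m) x₀).symm y))).comp y hs

lemma mfderiv_symm_fieldComponents {Y : ∀ x : X, TangentSpace (𝓡 m) x} {x₀ : X}
    {y : EuclideanSpace ℝ (Fin m)} (hy : y ∈ (extChartAt (𝓡 m) x₀).target) :
    mfderiv (𝓡 m) (𝓡 m) (extChartAt (𝓡 m) x₀).symm y
      (fieldComponents x₀ Y ((extChartAt (𝓡 m) x₀).symm y)) =
        Y ((extChartAt (𝓡 m) x₀).symm y) := by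
  have h := mfderiv_extChartAt_symm_mfderiv ((extChartAt (𝓡 m) x₀).map_target hy)
    (Y ((extChartAt (𝓡 m) x₀).symm y))
  rw [(extChartAt (𝓡 m) x₀).right_inv hy] at h
  exact h

/-- Cutting off a smooth function near a point. -/
lemma exists_contDiff_eventuallyEq {E F : Type*} [NormedAddCommGroup E] [NormedSpace ℝ E]
    [FiniteDimensional ℝ E] [NormedAddCommGroup F] [NormedSpace ℝ F] {f : E → F} {U : Set E}
    (hU : IsOpen U) (hf : ContDiffOn ℝ ∞ f U) {x : E} (hx : x ∈ U) :
    ∃ g : E → F, ContDiff ℝ ∞ g ∧ ∀ᶠ y in 𝓝 x, g y = f y := by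
  obtain ⟨r, hr, hrU⟩ := Metric.isOpen_iff.1 hU x hx
  let b : ContDiffBump x := ⟨r / 4, r / 2, by positivity, by linarith⟩
  refine ⟨fun y => b y • f y, ?_, ?_⟩
  · rw [contDiff_iff_contDiffAt]
    intro y
    by_cases hy : y ∈ U
    · exact b.contDiff.contDiffAt.smul (hf.contDiffAt (hU.mem_nhds hy))
    · have : (fun y => b y • f y) =ᶠ[𝓝 y] fun _ => 0 := by
        have h1 : y ∉ tsupport b := fun h => by
          rw [b.tsupport_eq] at h
          exact hy (hrU (Metric.closedBall_subset_ball (by change r / 2 < r; linarith) h))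
        filter_upwards [(isClosed_tsupport b).isOpen_compl.mem_nhds h1] with z hz
        rw [image_eq_zero_of_notMem_tsupport hz, zero_smul]
      exact contDiffAt_const.congr_of_eventuallyEq this
  · filter_upwards [b.eventuallyEq_one] with y hy
    simp [hy]

/-- The local flow of a smooth vector field on a manifold. -/
theorem exists_local_flow {Y : ∀ x : X, TangentSpace (𝓡 m) x} (hY : IsSmoothField Y) (p : X) :
    ∃ φ : ℝ × X → X, ∃ ε > 0, ∃ U ∈ 𝓝 p,
      ContMDiffOn (𝓘(ℝ, ℝ).prod (𝓡 m)) (𝓡 m) ∞ φ (Ioo (-ε) ε ×ˢ U) ∧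
      (∀ x ∈ U, φ (0, x) = x) ∧
      ∀ x ∈ U, IsMIntegralCurveOn (fun t => φ (t, x)) Y (Ioo (-ε) ε) := by
  set κ := extChartAt (𝓡 m) p with hκ
  have hT : IsOpen κ.target := isOpen_extChartAt_target p
  have hp : κ p ∈ κ.target := mem_extChartAt_target p
  -- The flow theorem in Banach spaces concerns globally smooth fields, so the coordinate field is
  -- cut off; near `κ p` nothing changes.
  obtain ⟨f, hf, hfe⟩ := exists_contDiff_eventuallyEq hT (hY.contDiffOn p) hp
  obtain ⟨φ, ε, U, hε, hU, hpU, hφ, hφ0, hφd⟩ := exists_smooth_local_flow hf (κ p)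
  obtain ⟨V, hVs, hV, hpV⟩ := mem_nhds_iff.1 (hfe.and (hT.mem_nhds hp))
  have hcont : ContinuousAt φ (0, κ p) :=
    (hφ.contDiffAt ((isOpen_Ioo.prod hU).mem_nhds ⟨⟨by linarith, hε⟩, hpU⟩)).continuousAt
  -- Time and initial values are restricted so that the flow remains where the cut-off field is the
  -- original one and the inverse chart is defined.
  have hnh : φ ⁻¹' V ∩ (Ioo (-ε) ε ×ˢ U) ∈ 𝓝 ((0 : ℝ), κ p) := by
    refine Filter.inter_mem (hcont ?_) ((isOpen_Ioo.prod hU).mem_nhds ⟨⟨by linarith, hε⟩, hpU⟩)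
    rw [hφ0 _ hpU]
    exact hV.mem_nhds hpV
  rw [nhds_prod_eq, Filter.mem_prod_iff] at hnh
  obtain ⟨A, hA, B, hB, hAB⟩ := hnh
  obtain ⟨δ, hδ, hδA⟩ := Metric.mem_nhds_iff.1 hA
  rw [Real.ball_eq_Ioo, zero_sub, zero_add] at hδA
  have hin : ∀ t ∈ Ioo (-δ) δ, ∀ x ∈ κ ⁻¹' B, φ (t, κ x) ∈ V ∧ t ∈ Ioo (-ε) ε ∧ κ x ∈ U :=
    fun t ht x hx => hAB ⟨hδA ht, hx⟩
  refine ⟨fun q => κ.symm (φ (q.1, κ q.2)), δ, hδ, κ ⁻¹' B ∩ κ.source,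
    Filter.inter_mem (continuousAt_extChartAt p hB) (extChartAt_source_mem_nhds p), ?_, ?_, ?_⟩
  · have h1 : ContMDiffOn (𝓘(ℝ, ℝ).prod (𝓡 m)) (𝓘(ℝ, ℝ × EuclideanSpace ℝ (Fin m))) ∞
        (fun q : ℝ × X => (q.1, κ q.2)) (Ioo (-δ) δ ×ˢ (κ ⁻¹' B ∩ κ.source)) := by
      refine contMDiffOn_fst.prodMk_space ((contMDiffOn_extChartAt (x := p)).comp
        contMDiffOn_snd fun q hq => ?_)
      have := hq.2.2
      rwa [hκ, extChartAt_source] at this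
    refine (contMDiffOn_extChartAt_symm p).comp (hφ.contMDiffOn.comp h1 fun q hq => ?_)
      fun q hq => ?_
    · exact (hin q.1 hq.1 q.2 hq.2.1).2
    · exact (hVs (hin q.1 hq.1 q.2 hq.2.1).1).2
  · intro x hx
    have := (hin 0 ⟨by linarith, hδ⟩ x hx.1).2.2
    simp only [hφ0 _ this]
    exact κ.left_inv hx.2
  · intro x hx t ht
    obtain ⟨h1, h2, h3⟩ := hin t ht x hx.1
    obtain ⟨h4, h5⟩ := hVs h1
    have h6 : HasMFDerivAt 𝓘(ℝ, ℝ) (𝓡 m) (fun t => φ (t, κ x)) t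
        (ContinuousLinearMap.smulRight (1 : ℝ →L[ℝ] ℝ) (f (φ (t, κ x)))) :=
      (hφd _ h3 t h2).hasFDerivAt.hasMFDerivAt
    have h7 : MDifferentiableAt (𝓡 m) (𝓡 m) κ.symm (φ (t, κ x)) :=
      ((contMDiffOn_extChartAt_symm (n := ∞) p).contMDiffAt (hT.mem_nhds h5)).mdifferentiableAt
        (by simp)
    refine (HasMFDerivAt.hasMFDerivWithinAt ?_)
    refine (h7.hasMFDerivAt.comp t h6).congr_mfderiv (ContinuousLinearMap.ext_ring ?_)
    symm
    change (1 : ℝ) • Y _ = mfderiv (𝓡 m) (𝓡 m) κ.symm (φ (t, κ x)) ((1 : ℝ) • f (φ (t, κ x)))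
    rw [h4, one_smul, one_smul]
    exact (mfderiv_symm_fieldComponents h5).symm

end Fields

/-! ### Uniform constants over compact spaces -/

section Compact

/-- Compactness induction on sets with a common ε: for a union take the smaller of the two
constants, which `anti` allows. -/
lemma exists_pos_forall_of_compact {K : Type*} [TopologicalSpace K] [CompactSpace K]
    {Q : ℝ → K → Prop} (anti : ∀ ε ε' x, ε' ≤ ε → Q ε x → Q ε' x)
    (h : ∀ x, ∃ ε > 0, ∀ᶠ x' in 𝓝 x, Q ε x') : ∃ ε > 0, ∀ x, Q ε x := by
  have := isCompact_univ.induction_on (X := K) (p := fun s => ∃ ε > 0, ∀ x ∈ s, Q ε x)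
    ⟨1, one_pos, fun _ hx => hx.elim⟩
    (fun s t hst ⟨ε, hε, ht⟩ => ⟨ε, hε, fun x hx => ht x (hst hx)⟩)
    (fun s t ⟨ε, hε, hs⟩ ⟨ε', hε', ht⟩ => ⟨min ε ε', lt_min hε hε', fun x hx =>
      hx.elim (fun hx => anti _ _ _ (min_le_left _ _) (hs x hx))
        fun hx => anti _ _ _ (min_le_right _ _) (ht x hx)⟩)
    (fun x _ => by
      obtain ⟨ε, hε, hx⟩ := h x
      exact ⟨_, mem_nhdsWithin_of_mem_nhds hx, ε, hε, fun x hx => hx⟩)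
  obtain ⟨ε, hε, h⟩ := this
  exact ⟨ε, hε, fun x => h x (mem_univ x)⟩

lemma exists_pos_forall_of_compact_of_nhds {K : Type*} [TopologicalSpace K] [CompactSpace K]
    {P : ℝ × K → Prop} (h : ∀ x, ∀ᶠ p in 𝓝 ((0 : ℝ), x), P p) :
    ∃ ε > 0, ∀ t ∈ Ioo (-ε) ε, ∀ x, P (t, x) := by
  have := exists_pos_forall_of_compact (K := K) (Q := fun ε x => ∀ t ∈ Ioo (-ε) ε, P (t, x))
    (fun ε ε' x hε hx t ht => hx t ⟨by linarith [ht.1], by linarith [ht.2]⟩) fun x => by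
      have hx := h x
      rw [nhds_prod_eq] at hx
      obtain ⟨A, hA, B, hB, hAB⟩ := Filter.mem_prod_iff.1 hx
      obtain ⟨δ, hδ, hδA⟩ := Metric.mem_nhds_iff.1 hA
      rw [Real.ball_eq_Ioo, zero_sub, zero_add] at hδA
      exact ⟨δ, hδ, Filter.mem_of_superset hB fun y hy t ht => hAB ⟨hδA ht, hy⟩⟩
  obtain ⟨ε, hε, h⟩ := this
  exact ⟨ε, hε, fun t ht x => h x t ht⟩

end Compact

/-! ### Moving a compact submanifold along a field -/

section CompactFlow

variable {m n : ℕ} {X : Type*} [TopologicalSpace X]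
  [ChartedSpace (EuclideanSpace ℝ (Fin m)) X] [IsManifold (𝓡 m) ∞ X]
  {Λ : Type*} [TopologicalSpace Λ] [ChartedSpace (EuclideanSpace ℝ (Fin n)) Λ]

/-- The flow of a smooth vector field, starting at a compact manifold. -/
theorem exists_flow_of_compact [T2Space X] [CompactSpace Λ]
    {Y : ∀ x : X, TangentSpace (𝓡 m) x} (hY : IsSmoothField Y) {ι : Λ → X}
    (hι : ContMDiff (𝓡 n) (𝓡 m) ∞ ι) :
    ∃ Φ : ℝ → Λ → X, ∃ ε > 0,
      ContMDiffOn (𝓘(ℝ, ℝ).prod (𝓡 n)) (𝓡 m) ∞ (fun p : ℝ × Λ => Φ p.1 p.2)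
        (Ioo (-ε) ε ×ˢ univ) ∧ Φ 0 = ι ∧
      ∀ x, IsMIntegralCurveOn (fun t => Φ t x) Y (Ioo (-ε) ε) := by
  obtain ⟨ε, hε, h⟩ := exists_pos_forall_of_compact (K := Λ)
    (Q := fun ε x => ∃ φ : ℝ → Λ → X, ∃ U ∈ 𝓝 x,
      ContMDiffOn (𝓘(ℝ, ℝ).prod (𝓡 n)) (𝓡 m) ∞ (fun p : ℝ × Λ => φ p.1 p.2)
        (Ioo (-ε) ε ×ˢ U) ∧ ∀ y ∈ U, φ 0 y = ι y ∧
          IsMIntegralCurveOn (fun t => φ t y) Y (Ioo (-ε) ε))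
    (by
      rintro ε ε' x hle ⟨φ, U, hU, hφ, h⟩
      have hsub : Ioo (-ε') ε' ⊆ Ioo (-ε) ε := Ioo_subset_Ioo (by linarith) hle
      exact ⟨φ, U, hU, hφ.mono (Set.prod_mono hsub le_rfl), fun y hy =>
        ⟨(h y hy).1, (h y hy).2.mono hsub⟩⟩)
    (fun x => by
      obtain ⟨φ, ε, hε, U, hU, hφ, hφ0, hφi⟩ := exists_local_flow hY (ι x)
      obtain ⟨V, hVU, hV, hxV⟩ := mem_nhds_iff.1 (hι.continuous.continuousAt hU)
      refine ⟨ε, hε, Filter.mem_of_superset (hV.mem_nhds hxV) fun y hy =>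
        ⟨fun t z => φ (t, ι z), V, hV.mem_nhds hy, ?_, fun z hz => ⟨hφ0 _ (hVU hz),
          hφi _ (hVU hz)⟩⟩⟩
      exact hφ.comp (contMDiffOn_fst.prodMk (hι.comp_contMDiffOn contMDiffOn_snd))
        fun q hq => ⟨hq.1, hVU hq.2⟩)
  choose φ U hU hφ hφ' using h
  have h0 : (0 : ℝ) ∈ Ioo (-ε) ε := ⟨by linarith, hε⟩
  refine ⟨fun t x => φ x t x, ε, hε, ?_, ?_, fun x => (hφ' x x (mem_of_mem_nhds (hU x))).2⟩
  · rintro ⟨t, x⟩ ⟨ht, -⟩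
    refine ContMDiffAt.contMDiffWithinAt ?_
    have h1 := (hφ x).contMDiffAt (x := (t, x)) (prod_mem_nhds (isOpen_Ioo.mem_nhds ht) (hU x))
    refine h1.congr_of_eventuallyEq ?_
    -- The family uses at `y` the local flow chosen for `y`. By uniqueness of integral curves it
    -- agrees near `x` with the one chosen for `x`, which is jointly smooth.
    filter_upwards [prod_mem_nhds (isOpen_Ioo.mem_nhds ht) (hU x)] with ⟨s, y⟩ hq
    refine isMIntegralCurveOn_Ioo_eqOn_of_contMDiff_boundaryless (I := 𝓡 m) h0
      (hY.of_le (by simp)) (hφ' y y (mem_of_mem_nhds (hU y))).2 (hφ' x y hq.2).2 ?_ hq.1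
    rw [(hφ' y y (mem_of_mem_nhds (hU y))).1, (hφ' x y hq.2).1]
  · exact funext fun x => (hφ' x x (mem_of_mem_nhds (hU x))).1

lemma contMDiff_slice {Φ : ℝ → Λ → X} {I : Set ℝ} (hI : IsOpen I)
    (hΦ : ContMDiffOn (𝓘(ℝ, ℝ).prod (𝓡 n)) (𝓡 m) ∞ (fun p : ℝ × Λ => Φ p.1 p.2) (I ×ˢ univ))
    {t : ℝ} (ht : t ∈ I) : ContMDiff (𝓡 n) (𝓡 m) ∞ (Φ t) := fun x =>
  (hΦ.contMDiffAt ((hI.prod isOpen_univ).mem_nhds (x := (t, x)) ⟨ht, mem_univ _⟩)).comp x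
    (contMDiffAt_const.prodMk contMDiffAt_id)

/-- Being an immersion is stable in compact families. -/
theorem exists_pos_forall_immersion [CompactSpace Λ] [IsManifold (𝓡 n) ∞ Λ]
    {Φ : ℝ → Λ → X} {I : Set ℝ} (hI : IsOpen I) (h0 : 0 ∈ I)
    (hΦ : ContMDiffOn (𝓘(ℝ, ℝ).prod (𝓡 n)) (𝓡 m) ∞ (fun p : ℝ × Λ => Φ p.1 p.2) (I ×ˢ univ))
    (him : ∀ x, Function.Injective (mfderiv (𝓡 n) (𝓡 m) (Φ 0) x)) :
    ∃ ε > 0, ∀ t ∈ Ioo (-ε) ε, ∀ x, Function.Injective (mfderiv (𝓡 n) (𝓡 m) (Φ t) x) := by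
  refine exists_pos_forall_of_compact_of_nhds
    (P := fun p : ℝ × Λ => Function.Injective (mfderiv (𝓡 n) (𝓡 m) (Φ p.1) p.2)) fun x₀ => ?_
  set E := EuclideanSpace ℝ (Fin n)
  set κ := extChartAt (𝓡 n) x₀ with hκ
  set p₀ : ℝ × E := (0, κ x₀) with hp₀
  have hT : IsOpen κ.target := isOpen_extChartAt_target x₀
  have hF := contMDiffOn_chartFamily hΦ x₀
  have hW : IsOpen (I ×ˢ κ.target) := hI.prod hT
  have hp₀W : p₀ ∈ I ×ˢ κ.target := ⟨h0, mem_extChartAt_target x₀⟩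
  have hFp : chartFamily Φ x₀ p₀ = Φ 0 x₀ := by
    simp [chartFamily, hp₀, hκ]
  set χ := extChartAt (𝓡 m) (Φ 0 x₀) with hχ
  let g : ℝ × E → EuclideanSpace ℝ (Fin m) := fun q => χ (chartFamily Φ x₀ q)
  have hsrc : χ.source ∈ 𝓝 (chartFamily Φ x₀ p₀) := by
    rw [hFp]
    exact extChartAt_source_mem_nhds _
  have hg : ContDiffAt ℝ ∞ g p₀ := contDiffAt_extChartAt_comp (hF.contMDiffAt (hW.mem_nhds hp₀W))
    (mem_of_mem_nhds hsrc)
  -- In fixed charts on both sides the spatial derivatives become operators between two fixed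
  -- spaces, depending continuously on (t, y); injectivity of such operators is an open condition.
  let T : ℝ × E → E →L[ℝ] EuclideanSpace ℝ (Fin m) := fun q =>
    (fderiv ℝ g q).comp (ContinuousLinearMap.inr ℝ ℝ E)
  have hT' : ContinuousAt T p₀ :=
    ((hg.fderiv_right (m := ∞) (by simp)).continuousAt).clm_comp continuousAt_const
  have hval : ∀ q ∈ I ×ˢ κ.target, chartFamily Φ x₀ q ∈ χ.source → ∀ u : E,
      T q u = mfderiv (𝓡 m) (𝓡 m) χ (chartFamily Φ x₀ q)
        (mfderiv (𝓡 n) (𝓡 m) (Φ q.1) (κ.symm q.2) (mfderiv (𝓡 n) (𝓡 n) κ.symm q.2 u)) := by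
    intro q hq hqs u
    have hFq : MDifferentiableAt 𝓘(ℝ, ℝ × E) (𝓡 m) (chartFamily Φ x₀) q :=
      (hF.contMDiffAt (hW.mem_nhds hq)).mdifferentiableAt (by simp)
    have h1 := fderiv_extChartAt_comp hFq hqs ((0 : ℝ), u)
    refine h1.trans ?_
    rw [mfderiv_chartFamily_right (t := q.1) (y := q.2) hq.2
      ((contMDiff_slice hI hΦ hq.1).mdifferentiableAt (by simp)) hFq u]
  have hinj : Function.Injective (T p₀) := by
    refine (injective_iff_map_eq_zero _).2 fun u hu => ?_
    replace hu := (hval p₀ hp₀W (mem_of_mem_nhds hsrc) u).symm.trans hu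
    have h1 := mfderiv_extChartAt_symm_mfderiv (mem_of_mem_nhds hsrc)
      (mfderiv (𝓡 n) (𝓡 m) (Φ p₀.1) (κ.symm p₀.2) (mfderiv (𝓡 n) (𝓡 n) κ.symm p₀.2 u))
    have h2 : mfderiv (𝓡 n) (𝓡 m) (Φ p₀.1) (κ.symm p₀.2)
        (mfderiv (𝓡 n) (𝓡 n) κ.symm p₀.2 u) = 0 := by
      refine h1.symm.trans ?_
      refine (congrArg _ hu).trans ?_
      exact map_zero _
    have h3 := him _ (h2.trans (map_zero _).symm)
    have h4 := mfderiv_extChartAt_mfderiv_symm hp₀W.2 u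
    refine h4.symm.trans ?_
    refine (congrArg _ h3).trans ?_
    exact map_zero _
  have hev : ∀ᶠ q in 𝓝 p₀, Function.Injective (T q) :=
    hT' (ContinuousLinearMap.isOpen_injective.mem_nhds hinj)
  have hcont : ContinuousAt (fun p : ℝ × Λ => ((p.1, κ p.2) : ℝ × E)) (0, x₀) :=
    continuousAt_fst.prodMk (ContinuousAt.comp (f := Prod.snd) (x := ((0 : ℝ), x₀))
      (continuousAt_extChartAt x₀) continuousAt_snd)
  have hFc : ContinuousAt (chartFamily Φ x₀) p₀ :=
    (hF.contMDiffAt (hW.mem_nhds hp₀W)).continuousAt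
  have hev2 := hcont (Filter.inter_mem hev (Filter.inter_mem (hW.mem_nhds hp₀W) (hFc hsrc)))
  filter_upwards [hev2, (continuousAt_snd (p := ((0 : ℝ), x₀))) (extChartAt_source_mem_nhds
    (I := 𝓡 n) x₀)] with ⟨t, x⟩ hq hx
  obtain ⟨hq1, hq2, hq3⟩ := hq
  have hx' : x ∈ κ.source := hx
  refine (injective_iff_map_eq_zero _).2 fun w hw => ?_
  have h1 := mfderiv_extChartAt_symm_mfderiv hx' w
  have h2 := hval (t, κ x) hq2 hq3 (mfderiv (𝓡 n) (𝓡 n) κ x w)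
  have h3 : mfderiv (𝓡 n) (𝓡 m) (Φ t) (κ.symm (κ x)) (mfderiv (𝓡 n) (𝓡 n) κ.symm (κ x)
      (mfderiv (𝓡 n) (𝓡 n) κ x w)) = 0 := by
    have : ∀ z : Λ, z = x → ∀ w' : E, w' = w → mfderiv (𝓡 n) (𝓡 m) (Φ t) z w' = 0 := by
      rintro z rfl w' rfl
      exact hw
    exact this _ (κ.left_inv hx') _ h1
  have h4 : T (t, κ x) (mfderiv (𝓡 n) (𝓡 n) κ x w) = 0 := by
    refine h2.trans ?_
    refine (congrArg _ h3).trans ?_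
    exact map_zero _
  have h5 : mfderiv (𝓡 n) (𝓡 n) κ x w = 0 := hq1 (h4.trans (map_zero _).symm)
  refine h1.symm.trans ?_
  refine (congrArg _ h5).trans ?_
  exact map_zero _

/-- A compact injective immersed manifold moves along a smooth vector field, staying in a given
neighbourhood. -/
theorem exists_family_of_field [T2Space X] [CompactSpace Λ] [IsManifold (𝓡 n) ∞ Λ]
    {Y : ∀ x : X, TangentSpace (𝓡 m) x} (hY : IsSmoothField Y) {ι : Λ → X}
    (hι : ContMDiff (𝓡 n) (𝓡 m) ∞ ι) (hinj : Function.Injective ι)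
    (him : ∀ x, Function.Injective (mfderiv (𝓡 n) (𝓡 m) ι x))
    {N : Set X} (hN : IsOpen N) (hιN : ∀ x, ι x ∈ N) :
    ∃ (Φ : ℝ → Λ → X) (κ : ℝ → ℝ), ContDiff ℝ ∞ κ ∧ κ 0 = 1 ∧
      ContMDiff (𝓘(ℝ, ℝ).prod (𝓡 n)) (𝓡 m) ∞ (fun p : ℝ × Λ => Φ p.1 p.2) ∧ Φ 0 = ι ∧
      (∀ t x, mfderiv 𝓘(ℝ, ℝ) (𝓡 m) (fun t => Φ t x) t (1 : ℝ) = κ t • Y (Φ t x)) ∧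
      (∀ t, Function.Injective (Φ t)) ∧
      (∀ t x, Function.Injective (mfderiv (𝓡 n) (𝓡 m) (Φ t) x)) ∧ ∀ t x, Φ t x ∈ N := by
  obtain ⟨φ, ε, hε, hφ, hφ0, hφi⟩ := exists_flow_of_compact hY hι
  have h0 : (0 : ℝ) ∈ Ioo (-ε) ε := ⟨by linarith, hε⟩
  obtain ⟨ε₁, hε₁, h1⟩ := exists_pos_forall_immersion isOpen_Ioo h0 hφ (by rwa [hφ0])
  obtain ⟨ε₂, hε₂, h2⟩ := exists_pos_forall_of_compact_of_nhds (K := Λ)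
    (P := fun p => φ p.1 p.2 ∈ N) fun x => by
      have hc : ContinuousAt (fun p : ℝ × Λ => φ p.1 p.2) (0, x) := (hφ.contMDiffAt
        ((isOpen_Ioo.prod isOpen_univ).mem_nhds (x := (0, x)) ⟨h0, mem_univ _⟩)).continuousAt
      refine hc (hN.mem_nhds ?_)
      simp only [hφ0]
      exact hιN x
  let r := min ε (min ε₁ ε₂)
  have hr : 0 < r := lt_min hε (lt_min hε₁ hε₂)
  -- A path is required for all real t, while the flow is under control only for times in (-r, r).
  -- This change of time has values in [-r/2, r/2] and derivative 1 at 0, so the initial velocity is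
  -- kept; its derivative is the factor `κ`.
  let τ : ℝ → ℝ := fun t => r / 2 * Real.sin (2 / r * t)
  have hτr : ∀ t, |τ t| ≤ r / 2 := fun t => by
    rw [abs_mul, abs_of_pos (half_pos hr)]
    exact mul_le_of_le_one_right (half_pos hr).le (Real.abs_sin_le_one _)
  have hτ : ∀ δ, r ≤ δ → ∀ t, τ t ∈ Ioo (-δ) δ := fun δ hδ t => by
    refine abs_lt.1 ?_
    exact lt_of_le_of_lt (hτr t) (by linarith)
  have hτε := hτ ε (min_le_left _ _)
  have hτd : ContDiff ℝ ∞ τ := contDiff_const.mul (Real.contDiff_sin.comp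
    (contDiff_const.mul contDiff_id))
  have hτ' : ∀ t, HasDerivAt τ (Real.cos (2 / r * t)) t := fun t => by
    have := ((((hasDerivAt_id t).const_mul (2 / r)).sin).const_mul (r / 2))
    refine this.congr_deriv ?_
    simp only [id, mul_one]
    field_simp
  refine ⟨fun t x => φ (τ t) x, fun t => Real.cos (2 / r * t), Real.contDiff_cos.comp
    (contDiff_const.mul contDiff_id), by simp, ?_, ?_, ?_, ?_, fun t x => h1 _ (hτ _
      ((min_le_right _ _).trans (min_le_left _ _)) t) x,
    fun t x => h2 _ (hτ _ ((min_le_right _ _).trans (min_le_right _ _)) t) x⟩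
  · have h3 : ContMDiff (𝓘(ℝ, ℝ).prod (𝓡 n)) (𝓘(ℝ, ℝ).prod (𝓡 n)) ∞
        (fun p : ℝ × Λ => (τ p.1, p.2)) := (hτd.contMDiff.comp contMDiff_fst).prodMk contMDiff_snd
    intro p
    exact (hφ.contMDiffAt ((isOpen_Ioo.prod isOpen_univ).mem_nhds (x := (τ p.1, p.2))
      ⟨hτε _, mem_univ _⟩)).comp p (h3 p)
  · simp [τ, hφ0]
  · intro t x
    have h3 := ((hφi x (τ t) (hτε t)).hasMFDerivAt (isOpen_Ioo.mem_nhds (hτε t))).comp t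
      (hτ' t).hasFDerivAt.hasMFDerivAt
    have h4 := DFunLike.congr_fun h3.mfderiv (1 : ℝ)
    refine h4.trans ?_
    change (((1 : ℝ) • Real.cos (2 / r * t))) • Y (φ (τ t) x) = _
    rw [one_smul]
  · intro t x y hxy
    -- Two flow lines that meet at time `τ t` agree throughout, in particular at time 0, where `ι`
    -- separates points.
    have h3 := isMIntegralCurveOn_Ioo_eqOn_of_contMDiff_boundaryless (I := 𝓡 m) (hτε t)
      (hY.of_le (by simp)) (hφi x) (hφi y) hxy h0
    simp only [hφ0] at h3
    exact hinj h3

end CompactFlow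

/-! ### Inverting a nondegenerate two-form smoothly -/

section LinearAlgebra

variable {d : ℕ}

local notation "𝔼" => EuclideanSpace ℝ (Fin d)

/-- The gradient type vector `(l e_i)_i` of a linear form. -/
noncomputable def gradient (l : 𝔼 →ₗ[ℝ] ℝ) : 𝔼 :=
  WithLp.toLp 2 fun i => l (EuclideanSpace.single i 1)

lemma inner_gradient (l : 𝔼 →ₗ[ℝ] ℝ) (v : 𝔼) : inner ℝ (gradient l) v = l v := by
  conv_rhs => rw [← (EuclideanSpace.basisFun (Fin d) ℝ).sum_repr v]
  rw [map_sum, PiLp.inner_apply]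
  refine Finset.sum_congr rfl fun _ _ => ?_
  simp [gradient]

lemma contDiffOn_gradient {F : Type*} [NormedAddCommGroup F] [NormedSpace ℝ F]
    {l : F → 𝔼 →ₗ[ℝ] ℝ} {U : Set F} (h : ∀ v, ContDiffOn ℝ ∞ (fun y => l y v) U) :
    ContDiffOn ℝ ∞ (fun y => gradient (l y)) U :=
  contDiffOn_euclidean.2 fun _ => h _

/-- Contraction of a two-form with a vector, as a linear form. -/
noncomputable def contractLin (w : 𝔼 [⋀^Fin 2]→L[ℝ] ℝ) (u : 𝔼) : 𝔼 →ₗ[ℝ] ℝ where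
  toFun v := w ![u, v]
  map_add' v v' := by simp only [← contractTwo_apply, ← altOne_apply, map_add]
  map_smul' c v := by simp only [← contractTwo_apply, ← altOne_apply, map_smul, RingHom.id_apply]

/-- The linear map attached to a two-form by the scalar product. -/
noncomputable def twoFormMap (w : 𝔼 [⋀^Fin 2]→L[ℝ] ℝ) : 𝔼 →L[ℝ] 𝔼 :=
  LinearMap.toContinuousLinearMap
    { toFun := fun u => gradient (contractLin w u)
      map_add' := fun u v => by
        refine ext_inner_right ℝ fun z => ?_
        rw [inner_add_left]
        simp only [inner_gradient]
        change w ![u + v, z] = w ![u, z] + w ![v, z]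
        simp only [← contractTwo_apply, map_add, ContinuousAlternatingMap.add_apply]
      map_smul' := fun c u => by
        refine ext_inner_right ℝ fun z => ?_
        rw [RingHom.id_apply, real_inner_smul_left]
        simp only [inner_gradient]
        change w ![c • u, z] = c * w ![u, z]
        simp only [← contractTwo_apply, map_smul, ContinuousAlternatingMap.smul_apply,
          smul_eq_mul] }

lemma inner_twoFormMap (w : 𝔼 [⋀^Fin 2]→L[ℝ] ℝ) (u v : 𝔼) :
    inner ℝ (twoFormMap w u) v = w ![u, v] := inner_gradient _ _

/-- The equation `w(v, ·) = θ` has a smooth solution for a smooth nondegenerate `w`. -/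
lemma exists_contDiffOn_contract_eq {w : 𝔼 → 𝔼 [⋀^Fin 2]→L[ℝ] ℝ} {θ : 𝔼 → 𝔼 →L[ℝ] ℝ} {U : Set 𝔼}
    (hw : ContDiffOn ℝ ∞ w U) (hθ : ContDiffOn ℝ ∞ θ U) (hU : IsOpen U)
    (hn : ∀ y ∈ U, ∀ u, (∀ v, w y ![u, v] = 0) → u = 0) :
    ∃ Y : 𝔼 → 𝔼, ContDiffOn ℝ ∞ Y U ∧ ∀ y ∈ U, ∀ z, w y ![Y y, z] = θ y z := by
  -- Nondegeneracy gives injectivity, and in finite dimension bijectivity. The solution is the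
  -- inverse operator applied to the gradient of θ, and inversion of operators is smooth.
  have hinv : ∀ y ∈ U, ∃ e : 𝔼 ≃L[ℝ] 𝔼, (e : 𝔼 →L[ℝ] 𝔼) = twoFormMap (w y) := by
    intro y hy
    have hinj : Function.Injective (twoFormMap (w y) : 𝔼 →ₗ[ℝ] 𝔼) := by
      refine (injective_iff_map_eq_zero _).2 fun u hu => hn y hy u fun v => ?_
      rw [← inner_twoFormMap]
      change inner ℝ ((twoFormMap (w y) : 𝔼 →ₗ[ℝ] 𝔼) u) v = 0
      rw [hu, inner_zero_left]
    refine ⟨(LinearEquiv.ofInjectiveEndo _ hinj).toContinuousLinearEquiv, ?_⟩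
    ext1 u
    rfl
  have hJ : ContDiffOn ℝ ∞ (fun y => twoFormMap (w y)) U :=
    contDiffOn_clm_apply.2 fun u => contDiffOn_gradient fun v y hy =>
      (ContDiffAt.alt_two_apply (hw.contDiffAt (hU.mem_nhds hy)) contDiffAt_const
        contDiffAt_const).contDiffWithinAt
  refine ⟨fun y => (twoFormMap (w y)).inverse (gradient (θ y)), fun y hy => ?_, fun y hy z => ?_⟩
  · obtain ⟨e, he⟩ := hinv y hy
    have h1 : ContDiffAt ℝ ∞ (fun y => (twoFormMap (w y)).inverse) y := by
      have h2 : ContDiffAt ℝ ∞ (ContinuousLinearMap.inverse : (𝔼 →L[ℝ] 𝔼) → 𝔼 →L[ℝ] 𝔼)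
          (twoFormMap (w y)) := by
        rw [← he]
        exact contDiffAt_map_inverse e
      exact h2.comp y (hJ.contDiffAt (hU.mem_nhds hy))
    have h3 : ContDiffOn ℝ ∞ (fun y => gradient (θ y : 𝔼 →ₗ[ℝ] ℝ)) U :=
      contDiffOn_gradient fun v => hθ.clm_apply contDiffOn_const
    exact (h1.clm_apply (h3.contDiffAt (hU.mem_nhds hy))).contDiffWithinAt
  · obtain ⟨e, he⟩ := hinv y hy
    have h : ∀ v, twoFormMap (w y) ((twoFormMap (w y)).inverse v) = v := fun v => by
      rw [← he, ContinuousLinearMap.inverse_equiv]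
      exact e.apply_symm_apply v
    rw [← inner_twoFormMap, h, inner_gradient]
    rfl

end LinearAlgebra

/-! ### Local Hamiltonian fields -/

section Symplectic

variable {m : ℕ} {X : Type*} [TopologicalSpace X]
  [ChartedSpace (EuclideanSpace ℝ (Fin m)) X] [IsManifold (𝓡 m) ∞ X]

lemma DForm.inChart_two (α : DForm m X 2) (x₀ : X) (y u v : EuclideanSpace ℝ (Fin m)) :
    α.inChart x₀ y ![u, v] = α ((extChartAt (𝓡 m) x₀).symm y)
      ![mfderiv (𝓡 m) (𝓡 m) (extChartAt (𝓡 m) x₀).symm y u,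
        mfderiv (𝓡 m) (𝓡 m) (extChartAt (𝓡 m) x₀).symm y v] := by
  refine congrArg (α _) ?_
  ext i : 1
  fin_cases i <;> rfl

lemma DForm.apply_two_eq_inChart (α : DForm m X 2) {x₀ q : X}
    (hq : q ∈ (extChartAt (𝓡 m) x₀).source) (v w : TangentSpace (𝓡 m) q) :
    α q ![v, w] = α.inChart x₀ (extChartAt (𝓡 m) x₀ q)
      ![mfderiv (𝓡 m) (𝓡 m) (extChartAt (𝓡 m) x₀) q v,
        mfderiv (𝓡 m) (𝓡 m) (extChartAt (𝓡 m) x₀) q w] := by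
  rw [α.apply_eq_inChart hq]
  refine congrArg (α.inChart x₀ _) ?_
  ext i : 1
  fin_cases i <;> rfl

lemma IsSymplectic.inChart_nondegenerate {Ω : DForm m X 2} (hΩ : IsSymplectic Ω) {x₀ : X}
    {y : EuclideanSpace ℝ (Fin m)} (hy : y ∈ (extChartAt (𝓡 m) x₀).target)
    (u : EuclideanSpace ℝ (Fin m)) (hu : ∀ v, Ω.inChart x₀ y ![u, v] = 0) : u = 0 := by
  have h1 : mfderiv (𝓡 m) (𝓡 m) (extChartAt (𝓡 m) x₀).symm y u = 0 := by
    refine hΩ.nondegenerate _ _ fun v => ?_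
    have h2 := hu (mfderiv (𝓡 m) (𝓡 m) (extChartAt (𝓡 m) x₀) ((extChartAt (𝓡 m) x₀).symm y) v)
    replace h2 := (Ω.inChart_two _ _ _ _).symm.trans h2
    have h3 := mfderiv_extChartAt_symm_mfderiv ((extChartAt (𝓡 m) x₀).map_target hy) v
    rw [(extChartAt (𝓡 m) x₀).right_inv hy] at h3
    refine Eq.trans ?_ h2
    exact congrArg (fun z => Ω _ ![_, z]) h3.symm
  refine (mfderiv_extChartAt_mfderiv_symm hy u).symm.trans ?_
  exact (congrArg _ h1).trans (map_zero _)

/-- A smooth function has locally a smooth Hamiltonian field. -/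
lemma IsSymplectic.exists_local_hamiltonian_field {Ω : DForm m X 2} (hΩ : IsSymplectic Ω)
    {V : Set X} (hV : IsOpen V) {g : X → ℝ} (hg : ContMDiffOn (𝓡 m) 𝓘(ℝ, ℝ) ∞ g V) {x₀ : X}
    (hx₀ : x₀ ∈ V) :
    ∃ W ∈ 𝓝 x₀, ∃ Y : ∀ x : X, TangentSpace (𝓡 m) x,
      ContMDiffOn (𝓡 m) (𝓡 m).tangent ∞ (fun x => (⟨x, Y x⟩ : TangentBundle (𝓡 m) X)) W ∧
      ∀ x ∈ W, x ∈ V ∧ ∀ w, Ω x ![Y x, w] = mfderiv (𝓡 m) 𝓘(ℝ, ℝ) g x w := by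
  set κ := extChartAt (𝓡 m) x₀ with hκ
  have hT : IsOpen κ.target := isOpen_extChartAt_target x₀
  have hU : IsOpen (κ.target ∩ κ.symm ⁻¹' V) :=
    (continuousOn_extChartAt_symm x₀).isOpen_inter_preimage hT hV
  have hgκ : ContDiffOn ℝ ∞ (fun y => g (κ.symm y)) (κ.target ∩ κ.symm ⁻¹' V) := by
    rw [← contMDiffOn_iff_contDiffOn]
    exact hg.comp ((contMDiffOn_extChartAt_symm x₀).mono inter_subset_left) fun y hy => hy.2
  -- The field is found in coordinates, from the form and the differential of `g` in the chart; `Z`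
  -- below carries it back to the manifold.
  obtain ⟨Y, hY, hYw⟩ := exists_contDiffOn_contract_eq ((hΩ.smooth x₀).mono inter_subset_left)
    (hgκ.fderiv_of_isOpen (m := ∞) hU (by simp)) hU
    fun y hy u hu => hΩ.inChart_nondegenerate hy.1 u hu
  have hW : IsOpen (κ.source ∩ V) := (isOpen_extChartAt_source x₀).inter hV
  have hmem : ∀ x ∈ κ.source ∩ V, κ x ∈ κ.target ∩ κ.symm ⁻¹' V := fun x hx =>
    ⟨κ.map_source hx.1, by rw [mem_preimage, κ.left_inv hx.1]; exact hx.2⟩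
  let Z : ∀ x : X, TangentSpace (𝓡 m) x := fun x => mfderiv (𝓡 m) (𝓡 m) κ.symm (κ x) (Y (κ x))
  have hZ : ∀ x ∈ κ.source, fieldComponents x₀ Z x = Y (κ x) := fun x hx => by
    have h1 := mfderiv_extChartAt_mfderiv_symm (κ.map_source hx) (Y (κ x))
    have h2 : ∀ z, z = x → mfderiv (𝓡 m) (𝓡 m) κ x (Z x) = mfderiv (𝓡 m) (𝓡 m) κ z (Z x) := by
      rintro z rfl
      rfl
    exact (h2 _ (κ.left_inv hx)).trans h1
  refine ⟨κ.source ∩ V, hW.mem_nhds ⟨mem_extChartAt_source x₀, hx₀⟩, Z, fun x hx => ?_,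
    fun x hx => ⟨hx.2, fun w => ?_⟩⟩
  · refine ((contMDiffAt_field_iff hx.1).2 ?_).contMDiffWithinAt
    have h1 : ContMDiffAt (𝓡 m) (𝓡 m) ∞ (fun x => Y (κ x)) x := by
      have h2 : ContMDiffAt (𝓡 m) (𝓡 m) ∞ Y (κ x) :=
        (hY.contDiffAt (hU.mem_nhds (hmem x hx))).contMDiffAt
      refine h2.comp x (contMDiffAt_extChartAt' ?_)
      rw [← extChartAt_source (𝓡 m)]
      exact hx.1
    refine h1.congr_of_eventuallyEq ?_
    filter_upwards [hW.mem_nhds hx] with z hz using hZ z hz.1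
  · rw [Ω.apply_two_eq_inChart hx.1]
    refine Eq.trans (congrArg (fun z => Ω.inChart x₀ _ ![z, _]) (hZ x hx.1)) ?_
    refine (hYw _ (hmem x hx) _).trans ?_
    have h1 : MDifferentiableAt (𝓡 m) 𝓘(ℝ, ℝ) (fun y => g (κ.symm y)) (κ x) :=
      ((hgκ.contDiffAt (hU.mem_nhds (hmem x hx))).differentiableAt (by simp)).mdifferentiableAt
    have h2 : MDifferentiableAt (𝓡 m) (𝓡 m) κ x := by
      refine mdifferentiableAt_extChartAt ?_
      rw [← extChartAt_source (𝓡 m)]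
      exact hx.1
    have h3 := mfderiv_comp_apply x h1 h2 w
    have h4 : (fun y => g (κ.symm y)) ∘ κ =ᶠ[𝓝 x] g := by
      filter_upwards [hW.mem_nhds hx] with z hz
      simp only [Function.comp]
      rw [κ.left_inv hz.1]
    rw [h4.mfderiv_eq, mfderiv_eq_fderiv] at h3
    exact h3.symm

end Symplectic

/-! ### Hamiltonian fields of closed forms near a compact set -/

section Path

lemma fderiv_fderiv_apply_symm {V : Type*} [NormedAddCommGroup V] [NormedSpace ℝ V] {f : V → ℝ}
    {p : V} (hf : ContDiffAt ℝ ∞ f p) (a b : V) :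
    fderiv ℝ (fun q => fderiv ℝ f q b) p a = fderiv ℝ (fun q => fderiv ℝ f q a) p b := by
  have h1 : DifferentiableAt ℝ (fderiv ℝ f) p :=
    (hf.fderiv_right (m := ∞) (by simp)).differentiableAt (by simp)
  have h2 : ∀ c : V, fderiv ℝ (fun q => fderiv ℝ f q c) p = (fderiv ℝ (fderiv ℝ f) p).flip c :=
    fun c => by
      have := (h1.hasFDerivAt.clm_apply (hasFDerivAt_const c p)).fderiv
      rw [this]
      simp
  rw [h2, h2]
  exact (hf.isSymmSndFDerivAt (by
    rw [minSmoothness_of_isRCLikeNormedField]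
    exact WithTop.coe_le_coe.2 le_top)) a b

variable {m n : ℕ} {X : Type*} [TopologicalSpace X]
  [ChartedSpace (EuclideanSpace ℝ (Fin m)) X] [IsManifold (𝓡 m) ∞ X]
  {Λ : Type*} [TopologicalSpace Λ] [ChartedSpace (EuclideanSpace ℝ (Fin n)) Λ]
  [IsManifold (𝓡 n) ∞ Λ]

lemma mfderiv_chartFamily_right' {Φ : ℝ → Λ → X} {x₀ x : Λ} {t : ℝ}
    (hx : x ∈ (extChartAt (𝓡 n) x₀).source)
    (hΦ : MDifferentiableAt (𝓡 n) (𝓡 m) (Φ t) x)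
    (hF : MDifferentiableAt 𝓘(ℝ, ℝ × EuclideanSpace ℝ (Fin n)) (𝓡 m) (chartFamily Φ x₀)
      (t, extChartAt (𝓡 n) x₀ x)) (w : TangentSpace (𝓡 n) x) :
    (mfderiv 𝓘(ℝ, ℝ × EuclideanSpace ℝ (Fin n)) (𝓡 m) (chartFamily Φ x₀)
      (t, extChartAt (𝓡 n) x₀ x) ((0 : ℝ), mfderiv (𝓡 n) (𝓡 n) (extChartAt (𝓡 n) x₀) x w) :
        EuclideanSpace ℝ (Fin m)) = mfderiv (𝓡 n) (𝓡 m) (Φ t) x w := by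
  set κ := extChartAt (𝓡 n) x₀
  have key : ∀ z : Λ, z = x → ∀ w' : EuclideanSpace ℝ (Fin n), w' = w →
      (mfderiv (𝓡 n) (𝓡 m) (Φ t) z w' : EuclideanSpace ℝ (Fin m)) =
        mfderiv (𝓡 n) (𝓡 m) (Φ t) x w := by
    rintro z rfl w' rfl
    rfl
  refine Eq.trans ?_ (key _ (κ.left_inv hx) _ (mfderiv_extChartAt_symm_mfderiv hx w))
  exact mfderiv_chartFamily_right (κ.map_source hx) (by rwa [κ.left_inv hx]) hF _

/-- The derivative of a real function, as a real number. -/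
noncomputable abbrev realDeriv (g : X → ℝ) (x : X) (w : TangentSpace (𝓡 m) x) : ℝ :=
  mfderiv (𝓡 m) 𝓘(ℝ, ℝ) g x w

lemma mfderiv_sub_const_apply {g : X → ℝ} {x : X} (hg : MDifferentiableAt (𝓡 m) 𝓘(ℝ, ℝ) g x)
    (c : ℝ) (w : TangentSpace (𝓡 m) x) :
    (mfderiv (𝓡 m) 𝓘(ℝ, ℝ) (fun q => g q - c) x w : ℝ) = mfderiv (𝓡 m) 𝓘(ℝ, ℝ) g x w := by
  have h1 : HasFDerivAt (fun y : ℝ => y - c) (ContinuousLinearMap.id ℝ ℝ) (g x) :=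
    (hasFDerivAt_id _).sub_const c
  exact DFunLike.congr_fun (h1.hasMFDerivAt.comp x hg.hasMFDerivAt).mfderiv w

/-- A closed form with local primitives, encoded by the differences of their values, defines
locally near a compact set a smooth vector field, dual to it by the symplectic form. -/
lemma exists_hamiltonian_field [T2Space X] [SecondCountableTopology X] [CompactSpace Λ]
    {Ω : DForm m X 2} (hΩ : IsSymplectic Ω) {ι : Λ → X} (hι : Continuous ι) (G : X → X → ℝ)
    (hG : ∀ z : Λ, ∃ V, IsOpen V ∧ ι z ∈ V ∧ ∃ g : X → ℝ, ContMDiffOn (𝓡 m) 𝓘(ℝ, ℝ) ∞ g V ∧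
      ∀ p ∈ V, ∀ q ∈ V, G p q = g q - g p) :
    ∃ (N : Set X) (Y : ∀ x : X, TangentSpace (𝓡 m) x), IsOpen N ∧ (∀ z, ι z ∈ N) ∧
      IsSmoothField Y ∧ ∀ x ∈ N, (∀ w, Ω x ![Y x, w] = mfderiv (𝓡 m) 𝓘(ℝ, ℝ) (G x) x w) ∧
        ∃ V, IsOpen V ∧ x ∈ V ∧ ∃ g : X → ℝ, ContMDiffOn (𝓡 m) 𝓘(ℝ, ℝ) ∞ g V ∧
          ∀ p ∈ V, ∀ w, mfderiv (𝓡 m) 𝓘(ℝ, ℝ) (G p) p w = mfderiv (𝓡 m) 𝓘(ℝ, ℝ) g p w := by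
  have : LocallyCompactSpace X := Manifold.locallyCompact_of_finiteDimensional (𝓡 m)
  choose V hVo hzV g hg hGg using hG
  have hder : ∀ z, ∀ x ∈ V z, ∀ w, mfderiv (𝓡 m) 𝓘(ℝ, ℝ) (G x) x w =
      mfderiv (𝓡 m) 𝓘(ℝ, ℝ) (g z) x w := by
    intro z x hx w
    have h1 : G x =ᶠ[𝓝 x] fun q => g z q - g z x := by
      filter_upwards [(hVo z).mem_nhds hx] with q hq using hGg z x hx q hq
    have h2 : MDifferentiableAt (𝓡 m) 𝓘(ℝ, ℝ) (g z) x :=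
      ((hg z).contMDiffAt ((hVo z).mem_nhds hx)).mdifferentiableAt (by simp)
    rw [h1.mfderiv_eq]
    exact mfderiv_sub_const_apply h2 _ w
  have hK : IsCompact (range ι) := isCompact_range hι
  obtain ⟨C, hC, hKC, hCV⟩ := exists_compact_between hK (isOpen_iUnion hVo)
    (by rintro _ ⟨z, rfl⟩; exact mem_iUnion.2 ⟨z, hzV z⟩)
  -- Local fields may be averaged by a partition of unity, since being dual to a given covector is
  -- an affine condition. It is imposed only on `C`, a compact neighbourhood of the image inside the
  -- domains of the primitives; off `C` the zero field serves.
  obtain ⟨Y, hY⟩ := exists_contMDiffSection_forall_mem_convex_of_local (n := ⊤) (𝓡 m)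
    (F_fiber := EuclideanSpace ℝ (Fin m)) (fun x : X => TangentSpace (𝓡 m) x)
    (fun x => {v | x ∈ C → ∀ w, Ω x ![v, w] = mfderiv (𝓡 m) 𝓘(ℝ, ℝ) (G x) x w})
    (by
      intro x v hv v' hv' a b _ _ hab hx w
      have h1 : Ω x ![a • v + b • v', w] = a * Ω x ![v, w] + b * Ω x ![v', w] := by
        have h2 : ∀ (f : EuclideanSpace ℝ (Fin m) [⋀^Fin 2]→L[ℝ] ℝ)
            (v v' w : EuclideanSpace ℝ (Fin m)),
            f ![a • v + b • v', w] = a * f ![v, w] + b * f ![v', w] := fun f v v' w => by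
          simp only [← contractTwo_apply, map_add, map_smul, ContinuousAlternatingMap.add_apply,
            ContinuousAlternatingMap.smul_apply, smul_eq_mul]
        exact h2 (Ω x) v v' w
      rw [h1, hv hx w, hv' hx w]
      have h2 : ∀ r : ℝ, a * r + b * r = r := fun r => by rw [← add_mul, hab, one_mul]
      exact h2 _)
    (by
      intro x₀
      by_cases hx₀ : x₀ ∈ C
      · obtain ⟨z, hz⟩ := mem_iUnion.1 (hCV hx₀)
        obtain ⟨W, hW, Y, hY, hYW⟩ := hΩ.exists_local_hamiltonian_field (hVo z) (hg z) hz
        refine ⟨W, hW, Y, hY, fun y hy _ w => ?_⟩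
        rw [hder z y (hYW y hy).1, (hYW y hy).2 w]
      · refine ⟨Cᶜ, hC.isClosed.isOpen_compl.mem_nhds hx₀, fun _ => 0, ?_,
          fun y hy hy' => (hy hy').elim⟩
        exact (Bundle.contMDiff_zeroSection ℝ (TangentSpace (𝓡 m) : X → Type _)).contMDiffOn)
  refine ⟨interior C, Y, isOpen_interior, fun z => hKC ⟨z, rfl⟩, Y.contMDiff,
    fun x hx => ⟨hY x (interior_subset hx), ?_⟩⟩
  obtain ⟨z, hz⟩ := mem_iUnion.1 (hCV (interior_subset hx))
  exact ⟨V z, hVo z, hz, g z, hg z, hder z⟩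

end Path

/-! ### Closed forms generate Lagrangian families -/

section LagrangianPath

variable {n : ℕ} {X : Type*} [TopologicalSpace X]
  [ChartedSpace (EuclideanSpace ℝ (Fin (2 * n))) X] [IsManifold (𝓡 (2 * n)) ∞ X]
  {Λ : Type*} [TopologicalSpace Λ] [ChartedSpace (EuclideanSpace ℝ (Fin n)) Λ]
  [IsManifold (𝓡 n) ∞ Λ]

/-- A family with velocity dual to a closed form, starting at an isotropic map, is isotropic. -/
lemma isotropic_of_velocity {Ω : DForm (2 * n) X 2} (hs : Ω.IsSmooth)
    (hc : Ω.ExtDerivEqZero) {Φ : ℝ → Λ → X} {k : ℝ → ℝ} (hk : ContDiff ℝ ∞ k)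
    (hΦ : ContMDiff (𝓘(ℝ, ℝ).prod (𝓡 n)) (𝓡 (2 * n)) ∞ (fun p : ℝ × Λ => Φ p.1 p.2))
    (G : X → X → ℝ)
    (hv : ∀ t x w, Ω (Φ t x) ![mfderiv 𝓘(ℝ, ℝ) (𝓡 (2 * n)) (fun t => Φ t x) t (1 : ℝ), w] =
      k t * realDeriv (G (Φ t x)) (Φ t x) w)
    (hG : ∀ t x, ∃ V, IsOpen V ∧ Φ t x ∈ V ∧ ∃ g : X → ℝ,
      ContMDiffOn (𝓡 (2 * n)) 𝓘(ℝ, ℝ) ∞ g V ∧ ∀ p ∈ V, ∀ w,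
        mfderiv (𝓡 (2 * n)) 𝓘(ℝ, ℝ) (G p) p w = mfderiv (𝓡 (2 * n)) 𝓘(ℝ, ℝ) g p w)
    (h0 : ∀ (x : Λ) (u v : TangentSpace (𝓡 n) x),
      Ω (Φ 0 x) ![mfderiv (𝓡 n) (𝓡 (2 * n)) (Φ 0) x u, mfderiv (𝓡 n) (𝓡 (2 * n)) (Φ 0) x v] = 0)
    (t : ℝ) (x : Λ) (u v : TangentSpace (𝓡 n) x) :
    Ω (Φ t x) ![mfderiv (𝓡 n) (𝓡 (2 * n)) (Φ t) x u,
      mfderiv (𝓡 n) (𝓡 (2 * n)) (Φ t) x v] = 0 := by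
  set E := EuclideanSpace ℝ (Fin n)
  set κ := extChartAt (𝓡 n) x with hκ
  set F : ℝ × E → X := chartFamily Φ x with hFdef
  have hF : ContMDiffOn 𝓘(ℝ, ℝ × E) (𝓡 (2 * n)) ∞ F (univ ×ˢ κ.target) :=
    contMDiffOn_chartFamily hΦ.contMDiffOn x
  have hW : IsOpen ((univ : Set ℝ) ×ˢ κ.target) :=
    isOpen_univ.prod (isOpen_extChartAt_target x)
  have hFd : ∀ q ∈ (univ : Set ℝ) ×ˢ κ.target,
      MDifferentiableAt 𝓘(ℝ, ℝ × E) (𝓡 (2 * n)) F q := fun q hq =>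
    (hF.contMDiffAt (hW.mem_nhds hq)).mdifferentiableAt (by simp)
  have hΦd : ∀ t x, MDifferentiableAt (𝓡 n) (𝓡 (2 * n)) (Φ t) x := fun t x =>
    (contMDiff_slice isOpen_univ hΦ.contMDiffOn (mem_univ t)).mdifferentiableAt (by simp)
  let B : ℝ × E → ℝ × E → ℝ × E → ℝ := fun a b q =>
    Ω (F q) ![mfderiv 𝓘(ℝ, ℝ × E) (𝓡 (2 * n)) F q a, mfderiv 𝓘(ℝ, ℝ × E) (𝓡 (2 * n)) F q b]
  have hB : ∀ a b, ContDiffOn ℝ ∞ (B a b) (univ ×ˢ κ.target) :=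
    fun a b => hs.contDiffOn_two hW hF a b
  have hxκ : x ∈ κ.source := mem_extChartAt_source x
  have hmem : ∀ t, (t, κ x) ∈ (univ : Set ℝ) ×ˢ κ.target := fun t =>
    ⟨mem_univ t, κ.map_source hxκ⟩
  have key : ∀ s, B (0, mfderiv (𝓡 n) (𝓡 n) κ x u) (0, mfderiv (𝓡 n) (𝓡 n) κ x v) (s, κ x) =
      Ω (Φ s x) ![mfderiv (𝓡 n) (𝓡 (2 * n)) (Φ s) x u,
        mfderiv (𝓡 n) (𝓡 (2 * n)) (Φ s) x v] := by
    intro s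
    have h1 := mfderiv_chartFamily_right' hxκ (hΦd s x) (hFd _ (hmem s)) u
    have h2 := mfderiv_chartFamily_right' hxκ (hΦd s x) (hFd _ (hmem s)) v
    have h3 : ∀ p : X, p = Φ s x → ∀ a b a' b' : EuclideanSpace ℝ (Fin (2 * n)), a = a' → b = b' →
        Ω p ![a, b] = Ω (Φ s x) ![a', b'] := by
      rintro p rfl a b _ _ rfl rfl
      rfl
    refine h3 _ ?_ _ _ _ _ h1 h2
    change Φ s (κ.symm (κ x)) = _
    rw [κ.left_inv hxκ]
  -- Closedness of F^*Ω on ∂_t, a, b turns the t-derivative into a difference of spatial derivatives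
  -- of F^*Ω(∂_t, ·) = k(t) d(g ∘ F). The factor depends on t alone, so the difference vanishes by
  -- symmetry of the second derivative of g ∘ F.
  have hder : ∀ a b : E, ∀ q ∈ (univ : Set ℝ) ×ˢ κ.target,
      fderiv ℝ (B (0, a) (0, b)) q (1, 0) = 0 := by
    intro a b q hq
    obtain ⟨V, hVo, hqV, g, hg, hGg⟩ := hG q.1 (κ.symm q.2)
    have hgF : ContDiffAt ℝ ∞ (fun q => g (F q)) q := by
      rw [← contMDiffAt_iff_contDiffAt]
      exact (hg.contMDiffAt (hVo.mem_nhds hqV)).comp q (hF.contMDiffAt (hW.mem_nhds hq))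
    have hFc : ContinuousAt F q := (hF.contMDiffAt (hW.mem_nhds hq)).continuousAt
    have h1 : ∀ c : E, B (1, 0) (0, c) =ᶠ[𝓝 q]
        fun q => k q.1 * fderiv ℝ (fun q => g (F q)) q (0, c) := by
      intro c
      filter_upwards [hW.mem_nhds hq, hFc (hVo.mem_nhds hqV)] with r hr hrV
      have hrV' : F r ∈ V := hrV
      have h2 := mfderiv_left (hFd r hr)
      have h3 : B (1, 0) (0, c) r = Ω (F r) ![mfderiv 𝓘(ℝ, ℝ) (𝓡 (2 * n))
          (fun t => F (t, r.2)) r.1 (1 : ℝ), mfderiv 𝓘(ℝ, ℝ × E) (𝓡 (2 * n)) F r (0, c)] := by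
        exact congrArg (fun z => Ω (F r) ![z, _]) h2.symm
      refine h3.trans ((hv r.1 (κ.symm r.2) _).trans ?_)
      refine congrArg (k r.1 * ·) ?_
      refine (hGg _ hrV' _).trans ?_
      rw [← mfderiv_eq_fderiv]
      exact (mfderiv_comp_apply r ((hg.contMDiffAt (hVo.mem_nhds hrV')).mdifferentiableAt
        (by simp)) (hFd r hr) _).symm
    have h2 : ∀ c d : E, fderiv ℝ (B (1, 0) (0, c)) q (0, d) =
        k q.1 * fderiv ℝ (fun q => fderiv ℝ (fun q => g (F q)) q (0, c)) q (0, d) := by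
      intro c d
      rw [(h1 c).fderiv_eq]
      have hk1 : HasFDerivAt (fun q : ℝ × E => k q.1) _ q :=
        ((hk.differentiable (by simp) q.1).hasFDerivAt).comp q hasFDerivAt_fst
      have hk2 : DifferentiableAt ℝ (fun q => fderiv ℝ (fun q => g (F q)) q ((0 : ℝ), c)) q :=
        (((hgF.fderiv_right (m := ∞) (by simp)).clm_apply contDiffAt_const)).differentiableAt
          (by simp)
      have hk3 := hk1.mul hk2.hasFDerivAt
      refine (DFunLike.congr_fun hk3.fderiv _).trans ?_
      simp
    have hcy := DForm.fderiv_two_cyclic hs hc hW hF hq (1, 0) (0, a) (0, b)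
    change fderiv ℝ (B (0, a) (0, b)) q (1, 0) - fderiv ℝ (B (1, 0) (0, b)) q (0, a) +
      fderiv ℝ (B (1, 0) (0, a)) q (0, b) = 0 at hcy
    rw [h2, h2, fderiv_fderiv_apply_symm hgF (0, b) (0, a)] at hcy
    linarith
  rw [← key]
  set a := mfderiv (𝓡 n) (𝓡 n) κ x u
  set b := mfderiv (𝓡 n) (𝓡 n) κ x v
  have hd : ∀ s, HasDerivAt (fun s => B (0, a) (0, b) (s, κ x)) 0 s := by
    intro s
    have h1 : HasFDerivAt (B (0, a) (0, b)) _ (s, κ x) := (((hB (0, a) (0, b)).contDiffAt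
      (hW.mem_nhds (hmem s))).differentiableAt (by simp)).hasFDerivAt
    have h2 := h1.comp_hasDerivAt s ((hasDerivAt_id s).prodMk (hasDerivAt_const s (κ x)))
    refine h2.congr_deriv ?_
    exact hder a b _ (hmem s)
  have hconst := is_const_of_deriv_eq_zero (fun s => (hd s).differentiableAt)
    (fun s => (hd s).deriv) t 0
  refine hconst.trans ?_
  rw [key]
  exact h0 x u v

/-- A Lagrangian embedding of a compact manifold moves, by Lagrangian embeddings, in the direction
of a closed form that has primitives near its image. -/
theorem exists_lagrangian_family [T2Space X] [SecondCountableTopology X] [CompactSpace Λ]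
    {Ω : DForm (2 * n) X 2} (hΩ : IsSymplectic Ω) {ι : Λ → X} (hι : IsLagrangianEmbedding Ω ι)
    (G : X → X → ℝ)
    (hG : ∀ z : Λ, ∃ V, IsOpen V ∧ ι z ∈ V ∧ ∃ g : X → ℝ,
      ContMDiffOn (𝓡 (2 * n)) 𝓘(ℝ, ℝ) ∞ g V ∧ ∀ p ∈ V, ∀ q ∈ V, G p q = g q - g p) :
    ∃ (Φ : ℝ → Λ → X) (k : ℝ → ℝ), ContDiff ℝ ∞ k ∧ k 0 = 1 ∧
      ContMDiff (𝓘(ℝ, ℝ).prod (𝓡 n)) (𝓡 (2 * n)) ∞ (fun p : ℝ × Λ => Φ p.1 p.2) ∧ Φ 0 = ι ∧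
      (∀ t, IsLagrangianEmbedding Ω (Φ t)) ∧
      ∀ t x w, Ω (Φ t x) ![mfderiv 𝓘(ℝ, ℝ) (𝓡 (2 * n)) (fun t => Φ t x) t (1 : ℝ), w] =
        k t * realDeriv (G (Φ t x)) (Φ t x) w := by
  obtain ⟨N, Y, hN, hιN, hY, hYN⟩ := exists_hamiltonian_field hΩ hι.smooth.continuous G hG
  obtain ⟨Φ, k, hk, hk0, hΦ, hΦ0, hΦv, hinj, himm, hΦN⟩ :=
    exists_family_of_field hY hι.smooth hι.injective hι.immersion hN hιN
  have hv : ∀ t x w, Ω (Φ t x) ![mfderiv 𝓘(ℝ, ℝ) (𝓡 (2 * n)) (fun t => Φ t x) t (1 : ℝ), w] =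
      k t * realDeriv (G (Φ t x)) (Φ t x) w := by
    intro t x w
    rw [hΦv]
    have h2 : ∀ (f : EuclideanSpace ℝ (Fin (2 * n)) [⋀^Fin 2]→L[ℝ] ℝ) (c : ℝ)
        (v w : EuclideanSpace ℝ (Fin (2 * n))), f ![c • v, w] = c * f ![v, w] := fun f c v w => by
      simp only [← contractTwo_apply, map_smul, ContinuousAlternatingMap.smul_apply, smul_eq_mul]
    exact (h2 (Ω (Φ t x)) (k t) _ w).trans (congrArg (k t * ·) ((hYN _ (hΦN t x)).1 w))
  refine ⟨Φ, k, hk, hk0, hΦ, hΦ0, fun t => ⟨contMDiff_slice isOpen_univ hΦ.contMDiffOn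
    (mem_univ t), hinj t, himm t, fun x u v => ?_⟩, hv⟩
  exact isotropic_of_velocity hΩ.smooth hΩ.closed hk hΦ G hv (fun t x => (hYN _ (hΦN t x)).2)
    (by rw [hΦ0]; exact hι.isotropic) t x u v

end LagrangianPath

/-! ### Local primitives of closed one-forms -/

section Primitives

variable {n : ℕ} {Λ : Type*} [TopologicalSpace Λ] [ChartedSpace (EuclideanSpace ℝ (Fin n)) Λ]
  [IsManifold (𝓡 n) ∞ Λ]

/-- `f` is a smooth primitive of the `1`-form `α` on `W`. -/
def IsPrimitiveOn (α : DForm n Λ 1) (f : Λ → ℝ) (W : Set Λ) : Prop :=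
  ContMDiffOn (𝓡 n) 𝓘(ℝ, ℝ) ∞ f W ∧ ∀ x ∈ W, ∀ u, realDeriv f x u = α x (fun _ => u)

lemma IsPrimitiveOn.mono {α : DForm n Λ 1} {f : Λ → ℝ} {W W' : Set Λ} (h : IsPrimitiveOn α f W)
    (hW : W' ⊆ W) : IsPrimitiveOn α f W' :=
  ⟨h.1.mono hW, fun x hx => h.2 x (hW hx)⟩

lemma realDeriv_comp_extChartAt {φ : EuclideanSpace ℝ (Fin n) → ℝ} {z x : Λ}
    (hx : x ∈ (extChartAt (𝓡 n) z).source)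
    (hφ : DifferentiableAt ℝ φ (extChartAt (𝓡 n) z x)) (u : TangentSpace (𝓡 n) x) :
    realDeriv (fun x => φ (extChartAt (𝓡 n) z x)) x u =
      fderiv ℝ φ (extChartAt (𝓡 n) z x) (mfderiv (𝓡 n) (𝓡 n) (extChartAt (𝓡 n) z) x u) := by
  rw [extChartAt_source] at hx
  have h := mfderiv_comp_apply x hφ.mdifferentiableAt (mdifferentiableAt_extChartAt (I := 𝓡 n) hx) u
  rw [mfderiv_eq_fderiv] at h
  exact h

lemma fderiv_comp_extChartAt_symm {f : Λ → ℝ} {z : Λ} {y : EuclideanSpace ℝ (Fin n)}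
    (hy : y ∈ (extChartAt (𝓡 n) z).target)
    (hf : MDifferentiableAt (𝓡 n) 𝓘(ℝ, ℝ) f ((extChartAt (𝓡 n) z).symm y))
    (v : EuclideanSpace ℝ (Fin n)) :
    fderiv ℝ (fun y => f ((extChartAt (𝓡 n) z).symm y)) y v =
      realDeriv f ((extChartAt (𝓡 n) z).symm y)
        (mfderiv (𝓡 n) (𝓡 n) (extChartAt (𝓡 n) z).symm y v) := by
  have hs : MDifferentiableAt (𝓡 n) (𝓡 n) (extChartAt (𝓡 n) z).symm y :=
    ((contMDiffOn_extChartAt_symm (n := ∞) z).contMDiffAt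
      ((isOpen_extChartAt_target z).mem_nhds hy)).mdifferentiableAt (by simp)
  have h := mfderiv_comp_apply (f := (extChartAt (𝓡 n) z).symm) y hf hs v
  rw [← mfderiv_eq_fderiv]
  exact h

/-- A closed form has local primitives, and they are unique up to constants. -/
lemma exists_primitive_nhds {α : DForm n Λ 1} (hα : α ∈ closedForms n Λ 1) (z : Λ) {N : Set Λ}
    (hN : N ∈ 𝓝 z) : ∃ W, IsOpen W ∧ z ∈ W ∧ W ⊆ N ∧ (∃ f, IsPrimitiveOn α f W) ∧
      ∀ f₁ f₂, IsPrimitiveOn α f₁ W → IsPrimitiveOn α f₂ W → ∀ x ∈ W, ∀ y ∈ W,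
        f₁ y - f₁ x = f₂ y - f₂ x := by
  set E := EuclideanSpace ℝ (Fin n)
  set κ := extChartAt (𝓡 n) z with hκ
  have hT : IsOpen κ.target := isOpen_extChartAt_target z
  have h1 : κ.target ∩ κ.symm ⁻¹' N ∈ 𝓝 (κ z) := by
    refine Filter.inter_mem (extChartAt_target_mem_nhds z) ?_
    refine (continuousAt_extChartAt_symm z) ?_
    rwa [extChartAt_to_inv]
  obtain ⟨r, hr, hrs⟩ := Metric.mem_nhds_iff.1 h1
  have hbT : Metric.ball (κ z) r ⊆ κ.target := fun y hy => (hrs hy).1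
  have hb : IsOpen (Metric.ball (κ z) r) := Metric.isOpen_ball
  have hW : IsOpen (κ.source ∩ κ ⁻¹' Metric.ball (κ z) r) :=
    (continuousOn_extChartAt z).isOpen_inter_preimage (isOpen_extChartAt_source z) hb
  refine ⟨κ.source ∩ κ ⁻¹' Metric.ball (κ z) r, hW, ⟨mem_extChartAt_source z,
    Metric.mem_ball_self hr⟩, fun x hx => ?_, ?_, ?_⟩
  · have := (hrs hx.2).2
    rwa [mem_preimage, κ.left_inv hx.1] at this
  · have hw := (hα.1 z).mono hbT
    have hws : ContDiffOn ℝ ∞ (fun y => altOne E (α.inChart z y)) (Metric.ball (κ z) r) :=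
      (altOne E).contDiff.comp_contDiffOn hw
    -- The Poincaré lemma on a ball in the chart; symmetry of the derivative of the coordinate
    -- covector field is dα = 0.
    obtain ⟨φ, hφ⟩ := (convex_ball (κ z) r).exists_forall_hasFDerivAt_of_fderiv_symmetric hb
      (hws.differentiableOn (by simp)) (by
        intro a ha x y
        have hda := (hws.differentiableOn (by simp)).differentiableAt (hb.mem_nhds ha)
        have h2 : ∀ x y, fderiv ℝ (fun y => altOne E (α.inChart z y)) a x y =
            fderiv ℝ (fun b => α.inChart z b (fun _ => y)) a x := fun x y => by
          have h3 := (hda.hasFDerivAt.clm_apply (hasFDerivAt_const y a)).fderiv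
          have h4 := DFunLike.congr_fun h3 x
          simp only [altOne_apply] at h4
          refine Eq.trans ?_ h4.symm
          simp
        have h3 := extDeriv_one_apply (hα.1.differentiableAt z (hbT ha)) x y
        rw [hα.2 z a (hbT ha)] at h3
        rw [h2, h2]
        exact sub_eq_zero.1 h3.symm)
    have hφs : ContDiffOn ℝ ∞ φ (Metric.ball (κ z) r) := by
      rw [contDiffOn_infty_iff_fderiv_of_isOpen hb]
      exact ⟨fun y hy => (hφ y hy).differentiableAt.differentiableWithinAt,
        hws.congr fun y hy => (hφ y hy).fderiv⟩
    refine ⟨fun x => φ (κ x), ?_, fun x hx u => ?_⟩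
    · refine hφs.contMDiffOn.comp ((contMDiffOn_extChartAt (x := z)).mono fun x hx => ?_)
        fun x hx => hx.2
      rw [← extChartAt_source (𝓡 n)]
      exact hx.1
    · rw [realDeriv_comp_extChartAt hx.1 (hφ _ hx.2).differentiableAt, (hφ _ hx.2).fderiv]
      exact (α.apply_eq_inChart hx.1 (fun _ => u)).symm
  · intro f₁ f₂ hf₁ hf₂ x hx y hy
    have hmem : ∀ y ∈ Metric.ball (κ z) r, κ.symm y ∈ κ.source ∩ κ ⁻¹' Metric.ball (κ z) r :=
      fun y hy => ⟨κ.map_target (hbT hy), by rwa [mem_preimage, κ.right_inv (hbT hy)]⟩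
    have hdiff : ∀ f, IsPrimitiveOn α f (κ.source ∩ κ ⁻¹' Metric.ball (κ z) r) →
        DifferentiableOn ℝ (fun y => f (κ.symm y)) (Metric.ball (κ z) r) := by
      intro f hf
      have : ContDiffOn ℝ ∞ (fun y => f (κ.symm y)) (Metric.ball (κ z) r) := by
        rw [← contMDiffOn_iff_contDiffOn]
        exact hf.1.comp ((contMDiffOn_extChartAt_symm z).mono hbT) fun y hy => hmem y hy
      exact this.differentiableOn (by simp)
    have hder : ∀ f, IsPrimitiveOn α f (κ.source ∩ κ ⁻¹' Metric.ball (κ z) r) →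
        ∀ y ∈ Metric.ball (κ z) r, ∀ v, fderiv ℝ (fun y => f (κ.symm y)) y v =
          α (κ.symm y) (fun _ => mfderiv (𝓡 n) (𝓡 n) κ.symm y v) := by
      intro f hf y hy v
      rw [fderiv_comp_extChartAt_symm (hbT hy)
        ((hf.1.contMDiffAt (hW.mem_nhds (hmem y hy))).mdifferentiableAt (by simp))]
      exact hf.2 _ (hmem y hy) _
    obtain ⟨c, hc⟩ := hb.exists_eq_add_of_fderiv_eq (convex_ball _ _).isPreconnected
      (hdiff f₁ hf₁) (hdiff f₂ hf₂) fun y hy => by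
        ext1 v
        rw [hder f₁ hf₁ y hy, hder f₂ hf₂ y hy]
    have hx' := hc hx.2
    have hy' := hc hy.2
    simp only [κ.left_inv hx.1] at hx'
    simp only [κ.left_inv hy.1] at hy'
    rw [hx', hy']
    ring

/-- On a compact manifold, the local primitives of a closed form can be encoded by their
differences on a neighbourhood of the diagonal. -/
lemma exists_primitive_differences [T2Space Λ] [CompactSpace Λ] {α : DForm n Λ 1}
    (hα : α ∈ closedForms n Λ 1) :
    ∃ D : Λ → Λ → ℝ, ∀ z, ∃ W, IsOpen W ∧ z ∈ W ∧ ∃ f, IsPrimitiveOn α f W ∧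
      ∀ x ∈ W, ∀ y ∈ W, D x y = f y - f x := by
  let _ : UniformSpace Λ := uniformSpaceOfCompactR1
  choose W₀ hW₀ hzW₀ _ hf₀ _ using fun z => exists_primitive_nhds hα z univ_mem
  choose f₀ hf₀ using hf₀
  -- A uniform size is needed: the ball of size `V` around any `x` lies in one domain `W₀ (i x)`,
  -- and `D x` is computed with the primitive given there.
  obtain ⟨V, hV, hVW⟩ := lebesgue_number_lemma isCompact_univ hW₀
    (fun z _ => mem_iUnion.2 ⟨z, hzW₀ z⟩)
  choose i hi using fun x => hVW x (mem_univ x)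
  refine ⟨fun x y => f₀ (i x) y - f₀ (i x) x, fun z => ?_⟩
  -- With half the size, every `w` near `z` is within `V` of every `x` near `z`. Hence the small set
  -- `W` lies in `W₀ (i x)`, and uniqueness of differences on `W` replaces `f₀ (i x)` by `f₀ z`.
  obtain ⟨U, hU, hUs, hUV⟩ := comp_symm_mem_uniformity_sets hV
  obtain ⟨W, hWo, hzW, hWN, -, huniq⟩ := exists_primitive_nhds hα z
    (Filter.inter_mem ((hW₀ z).mem_nhds (hzW₀ z)) (UniformSpace.ball_mem_nhds z hU))
  refine ⟨W, hWo, hzW, f₀ z, (hf₀ z).mono fun x hx => (hWN hx).1, fun x hx y hy => ?_⟩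
  refine huniq _ _ ((hf₀ (i x)).mono fun w hw => hi x ?_)
    ((hf₀ z).mono fun x hx => (hWN hx).1) x hx y hy
  have h1 : (z, x) ∈ U := (hWN hx).2
  have h2 : (z, w) ∈ U := (hWN hw).2
  exact hUV ⟨z, hUs.symm _ _ h1, h2⟩

end Primitives

/-! ### Local retractions onto an embedded manifold -/

section LeftInverse

variable {m n : ℕ} {X : Type*} [TopologicalSpace X]
  [ChartedSpace (EuclideanSpace ℝ (Fin m)) X] [IsManifold (𝓡 m) ∞ X]
  {Λ : Type*} [TopologicalSpace Λ] [ChartedSpace (EuclideanSpace ℝ (Fin n)) Λ]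
  [IsManifold (𝓡 n) ∞ Λ]

/-- An embedding has local smooth left inverses. -/
lemma exists_local_left_inverse {ι : Λ → X} (hι : ContMDiff (𝓡 n) (𝓡 m) ∞ ι)
    (hind : IsInducing ι) {z : Λ}
    (himm : Function.Injective (mfderiv (𝓡 n) (𝓡 m) ι z)) :
    ∃ (U : Set X) (ret : X → Λ), IsOpen U ∧ ι z ∈ U ∧ ContMDiffOn (𝓡 m) (𝓡 n) ∞ ret U ∧
      ∀ y, ι y ∈ U → ret (ι y) = y := by
  set κ := extChartAt (𝓡 n) z with hκ
  set χ := extChartAt (𝓡 m) (ι z) with hχ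
  let O : Set Λ := κ.source ∩ ι ⁻¹' χ.source
  have hO : IsOpen O := (isOpen_extChartAt_source z).inter
    ((isOpen_extChartAt_source (ι z)).preimage hι.continuous)
  let O' : Set (EuclideanSpace ℝ (Fin n)) := κ.target ∩ κ.symm ⁻¹' (ι ⁻¹' χ.source)
  have hO' : IsOpen O' := (continuousOn_extChartAt_symm z).isOpen_inter_preimage
    (isOpen_extChartAt_target z) ((isOpen_extChartAt_source (ι z)).preimage hι.continuous)
  have hzO' : κ z ∈ O' := by
    refine ⟨mem_extChartAt_target z, ?_⟩
    rw [mem_preimage, mem_preimage, κ.left_inv (mem_extChartAt_source z)]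
    exact mem_extChartAt_source _
  let f : EuclideanSpace ℝ (Fin n) → EuclideanSpace ℝ (Fin m) := fun y => χ (ι (κ.symm y))
  have hf : ContDiffOn ℝ ∞ f O' := by
    rw [← contMDiffOn_iff_contDiffOn]
    refine (contMDiffOn_extChartAt (x := ι z)).comp (hι.comp_contMDiffOn
      ((contMDiffOn_extChartAt_symm z).mono inter_subset_left)) fun y hy => ?_
    have : ι (κ.symm y) ∈ χ.source := hy.2
    rwa [hχ, extChartAt_source] at this
  let A := fderiv ℝ f (κ z)
  have hA : Function.Injective A := by
    refine (injective_iff_map_eq_zero _).2 fun u hu => ?_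
    have hsm : MDifferentiableAt (𝓡 n) (𝓡 n) κ.symm (κ z) :=
      ((contMDiffOn_extChartAt_symm (n := ∞) z).contMDiffAt
        ((isOpen_extChartAt_target z).mem_nhds hzO'.1)).mdifferentiableAt (by simp)
    have hιd : MDifferentiableAt (𝓡 n) (𝓡 m) ι (κ.symm (κ z)) :=
      hι.mdifferentiableAt (by simp)
    have hsrc : (ι ∘ κ.symm) (κ z) ∈ χ.source := hzO'.2
    have h1 := fderiv_extChartAt_comp (hιd.comp (κ z) hsm) hsrc u
    have h2 : mfderiv (𝓡 m) (𝓡 m) χ ((ι ∘ κ.symm) (κ z))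
        (mfderiv (𝓡 n) (𝓡 m) (ι ∘ κ.symm) (κ z) u) = 0 := h1.symm.trans hu
    have h3 : mfderiv (𝓡 n) (𝓡 m) (ι ∘ κ.symm) (κ z) u = 0 := by
      refine (mfderiv_extChartAt_symm_mfderiv hsrc _).symm.trans ?_
      exact (congrArg _ h2).trans (map_zero _)
    replace h3 := (mfderiv_comp_apply (f := κ.symm) (κ z) hιd hsm u).symm.trans h3
    have h4 : Function.Injective (mfderiv (𝓡 n) (𝓡 m) ι (κ.symm (κ z))) := by
      rwa [κ.left_inv (mem_extChartAt_source z)]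
    have h5 := h4 (h3.trans (map_zero _).symm)
    refine (mfderiv_extChartAt_mfderiv_symm hzO'.1 u).symm.trans ?_
    exact (congrArg _ h5).trans (map_zero _)
  -- A linear left inverse of the derivative makes `B ∘ f` have identity derivative, hence a smooth
  -- local inverse `g`. The retraction is then `g ∘ B` between the charts.
  obtain ⟨B, hB⟩ := LinearMap.exists_leftInverse_of_injective
    (A : EuclideanSpace ℝ (Fin n) →ₗ[ℝ] EuclideanSpace ℝ (Fin m)) (LinearMap.ker_eq_bot.2 hA)
  let B' : EuclideanSpace ℝ (Fin m) →L[ℝ] EuclideanSpace ℝ (Fin n) := B.toContinuousLinearMap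
  have hBf : ContDiffOn ℝ ∞ (fun y => B' (f y)) O' := B'.contDiff.comp_contDiffOn hf
  have hBd : HasFDerivAt (fun y => B' (f y))
      ((ContinuousLinearEquiv.refl ℝ (EuclideanSpace ℝ (Fin n)) :
        EuclideanSpace ℝ (Fin n) ≃L[ℝ] EuclideanSpace ℝ (Fin n)) :
        EuclideanSpace ℝ (Fin n) →L[ℝ] EuclideanSpace ℝ (Fin n)) (κ z) := by
    have h1 : HasFDerivAt f A (κ z) := ((hf.contDiffAt (hO'.mem_nhds hzO')).differentiableAt
      (by simp)).hasFDerivAt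
    refine (B'.hasFDerivAt.comp (κ z) h1).congr_fderiv ?_
    ext1 u
    exact DFunLike.congr_fun hB u
  obtain ⟨g, V, hVo, hzV, hg, hgf, -⟩ :=
    exists_contDiffOn_local_inverse hO' hBf hzO' (ContinuousLinearEquiv.refl ℝ _) hBd
  have hgz : g (B' (f (κ z))) = κ z := hgf.self_of_nhds
  have hχo : IsOpen (χ.source ∩ χ ⁻¹' (B' ⁻¹' V)) :=
    (continuousOn_extChartAt (ι z)).isOpen_inter_preimage (isOpen_extChartAt_source _)
      (hVo.preimage B'.continuous)
  have hfz : f (κ z) = χ (ι z) := by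
    change χ (ι (κ.symm (κ z))) = _
    rw [κ.left_inv (mem_extChartAt_source z)]
  have hgc : ContinuousOn (fun p => g (B' (χ p))) (χ.source ∩ χ ⁻¹' (B' ⁻¹' V)) :=
    (hg.continuousOn.comp B'.continuous.continuousOn (fun _ h => h)).comp
      ((continuousOn_extChartAt (ι z)).mono inter_subset_left) fun p hp => hp.2
  let U₁ : Set X := (χ.source ∩ χ ⁻¹' (B' ⁻¹' V)) ∩ (fun p => g (B' (χ p))) ⁻¹' κ.target
  have hU₁ : IsOpen U₁ := hgc.isOpen_inter_preimage hχo (isOpen_extChartAt_target z)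
  have hzU₁ : ι z ∈ U₁ := by
    refine ⟨⟨mem_extChartAt_source _, ?_⟩, ?_⟩
    · rw [mem_preimage, mem_preimage, ← hfz]
      exact hzV
    · rw [mem_preimage, ← hfz, hgz]
      exact hzO'.1
  have hev : ∀ᶠ y in 𝓝 z, κ.symm (g (B' (χ (ι y)))) = y := by
    have h1 : ∀ᶠ y in 𝓝 z, g (B' (f (κ y))) = κ y :=
      (continuousAt_extChartAt z).eventually hgf
    filter_upwards [h1, extChartAt_source_mem_nhds (I := 𝓡 n) z] with y hy hys
    have h2 : f (κ y) = χ (ι y) := by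
      change χ (ι (κ.symm (κ y))) = _
      rw [κ.left_inv hys]
    rw [← h2, hy, κ.left_inv hys]
  -- The identity is known for `y` near `z` in `Λ`. Since `ι` is inducing, it holds whenever `ι y`
  -- is near `ι z` in `X`, which excludes distant sheets of the image.
  rw [hind.nhds_eq_comap] at hev
  obtain ⟨U₂, hU₂, hU₂s⟩ := Filter.mem_comap.1 hev
  obtain ⟨U₃, hU₃₂, hU₃, hzU₃⟩ := mem_nhds_iff.1 hU₂
  refine ⟨U₁ ∩ U₃, fun p => κ.symm (g (B' (χ p))), hU₁.inter hU₃, ⟨hzU₁, hzU₃⟩, ?_,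
    fun y hy => hU₂s (hU₃₂ hy.2)⟩
  refine (contMDiffOn_extChartAt_symm z).comp (hg.contMDiffOn.comp
    (B'.contDiff.contMDiff.comp_contMDiffOn ((contMDiffOn_extChartAt (x := ι z)).mono
      fun p hp => ?_)) fun p hp => hp.1.1.2) fun p hp => hp.1.2
  have := hp.1.1.1
  rwa [hχ, extChartAt_source] at this

end LeftInverse

/-! ### Extending closed forms and functions to the ambient manifold -/

section Extension

variable {m n : ℕ} {X : Type*} [TopologicalSpace X]
  [ChartedSpace (EuclideanSpace ℝ (Fin m)) X] [IsManifold (𝓡 m) ∞ X]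
  {Λ : Type*} [TopologicalSpace Λ] [ChartedSpace (EuclideanSpace ℝ (Fin n)) Λ]
  [IsManifold (𝓡 n) ∞ Λ]

lemma realDeriv_comp {g : X → ℝ} {ι : Λ → X} {z : Λ}
    (hg : MDifferentiableAt (𝓡 m) 𝓘(ℝ, ℝ) g (ι z))
    (hι : MDifferentiableAt (𝓡 n) (𝓡 m) ι z) (u : TangentSpace (𝓡 n) z) :
    realDeriv (fun y => g (ι y)) z u = realDeriv g (ι z) (mfderiv (𝓡 n) (𝓡 m) ι z u) :=
  mfderiv_comp_apply z hg hι u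

/-- A closed `1`-form on a compact embedded manifold extends to a closed form nearby. -/
theorem exists_differences_extension [T2Space X] [SecondCountableTopology X] [T2Space Λ]
    [CompactSpace Λ] {ι : Λ → X} (hι : ContMDiff (𝓡 n) (𝓡 m) ∞ ι) (hinj : Function.Injective ι)
    (himm : ∀ z, Function.Injective (mfderiv (𝓡 n) (𝓡 m) ι z)) {α : DForm n Λ 1}
    (hα : α ∈ closedForms n Λ 1) :
    ∃ G : X → X → ℝ, ∀ z : Λ, ∃ V, IsOpen V ∧ ι z ∈ V ∧ ∃ g : X → ℝ,
      ContMDiffOn (𝓡 m) 𝓘(ℝ, ℝ) ∞ g V ∧ (∀ p ∈ V, ∀ q ∈ V, G p q = g q - g p) ∧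
      ∀ u, realDeriv g (ι z) (mfderiv (𝓡 n) (𝓡 m) ι z u) = α z (fun _ => u) := by
  have : LocallyCompactSpace X := Manifold.locallyCompact_of_finiteDimensional (𝓡 m)
  have hemb : IsClosedEmbedding ι := hι.continuous.isClosedEmbedding hinj
  obtain ⟨D, hD⟩ := exists_primitive_differences hα
  choose U r hU hzU hr hrι using fun z =>
    exists_local_left_inverse hι hemb.isInducing (himm z)
  obtain ⟨T, hT⟩ := (isCompact_range hι.continuous).elim_finite_subcover U hU
    (by rintro _ ⟨z, rfl⟩; exact mem_iUnion.2 ⟨z, hzU z⟩)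
  replace hT : range ι ⊆ ⋃ i : T, U i := fun p hp => by
    obtain ⟨i, hi, h⟩ := mem_iUnion₂.1 (hT hp)
    exact mem_iUnion.2 ⟨⟨i, hi⟩, h⟩
  obtain ⟨C, hC, hKC, hCU⟩ := exists_compact_between (isCompact_range hι.continuous)
    (isOpen_iUnion fun i : T => hU i) hT
  obtain ⟨ρ, hρ⟩ := SmoothPartitionOfUnity.exists_isSubordinate (𝓡 m) hC.isClosed
    (fun i : T => U i) (fun i => hU i) hCU
  have hρ1 : ∀ p ∈ C, ∑ i, ρ i p = 1 := fun p hp => by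
    rw [← finsum_eq_sum_of_fintype]
    exact ρ.sum_eq_one hp
  -- The differences are averaged in both variables. Where `D` is a difference of values of `f` and
  -- the weights sum to 1, this separates into g q - g p with g = Σ ρ_i (f ∘ r_i).
  refine ⟨fun p q => ∑ i, ∑ j, ρ i p * ρ j q * D (r i p) (r j q), fun z => ?_⟩
  obtain ⟨W, hW, hzW, f, hf, hDf⟩ := hD z
  -- near `ι z`, the retractions used take their values in `W`
  have hloc : ∀ i : T, ∃ V, IsOpen V ∧ ι z ∈ V ∧
      ContMDiffOn (𝓡 m) 𝓘(ℝ, ℝ) ∞ (fun q => ρ i q * f (r i q)) V ∧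
      ∀ q ∈ V, ρ i q = 0 ∨ r i q ∈ W := by
    intro i
    by_cases hi : ι z ∈ U i
    · have hV : IsOpen (U i ∩ r i ⁻¹' W) :=
        (hr i).continuousOn.isOpen_inter_preimage (hU i) hW
      refine ⟨U i ∩ r i ⁻¹' W, hV, ⟨hi, ?_⟩, ?_, fun q hq => Or.inr hq.2⟩
      · rw [mem_preimage, hrι i z hi]
        exact hzW
      · exact (ρ i).contMDiff.contMDiffOn.mul
          (hf.1.comp ((hr i).mono inter_subset_left) fun q hq => hq.2)
    · refine ⟨(tsupport (ρ i))ᶜ, (isClosed_tsupport _).isOpen_compl, fun h => hi (hρ i h), ?_,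
        fun q hq => Or.inl (image_eq_zero_of_notMem_tsupport hq)⟩
      refine contMDiffOn_const (c := (0 : ℝ)) |>.congr fun q hq => ?_
      rw [image_eq_zero_of_notMem_tsupport hq, zero_mul]
  choose V hV hzV hVs hVW using hloc
  have hVo : IsOpen (interior C ∩ ⋂ i, V i) := isOpen_interior.inter (isOpen_iInter_of_finite hV)
  have hzV' : ι z ∈ interior C ∩ ⋂ i, V i := ⟨hKC ⟨z, rfl⟩, mem_iInter.2 hzV⟩
  have hgs : ContMDiffOn (𝓡 m) 𝓘(ℝ, ℝ) ∞ (fun q => ∑ i, ρ i q * f (r i q))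
      (interior C ∩ ⋂ i, V i) := by
    exact contMDiffOn_finsetSum fun i _ => (hVs i).mono fun q hq => mem_iInter.1 hq.2 i
  refine ⟨_, hVo, hzV', fun q => ∑ i, ρ i q * f (r i q), hgs, fun p hp q hq => ?_, fun u => ?_⟩
  · have h1 : ∀ i j, ρ i p * ρ j q * D (r i p) (r j q) =
        ρ i p * (ρ j q * f (r j q)) - ρ j q * (ρ i p * f (r i p)) := by
      intro i j
      rcases hVW i p (mem_iInter.1 hp.2 i) with h | h
      · rw [h]; ring
      rcases hVW j q (mem_iInter.1 hq.2 j) with h' | h'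
      · rw [h']; ring
      rw [hDf _ h _ h']
      ring
    simp only [h1, Finset.sum_sub_distrib, ← Finset.mul_sum]
    rw [← Finset.sum_mul, hρ1 p (interior_subset hp.1), one_mul]
    congr 1
    rw [← Finset.sum_comm' (s := Finset.univ) (t := fun _ => Finset.univ) (t' := Finset.univ)
      (s' := fun _ => Finset.univ) (by simp)]
    simp only [← Finset.mul_sum]
    rw [← Finset.sum_mul, hρ1 q (interior_subset hq.1), one_mul]
  · rw [← realDeriv_comp ((hgs.contMDiffAt (hVo.mem_nhds hzV')).mdifferentiableAt (by simp))
      (hι.mdifferentiableAt (by simp)), ← hf.2 z hzW]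
    -- Each `r i` inverts `ι` where its weight does not vanish, so on the image the average of the
    -- `f ∘ r i` is `f` itself.
    have h1 : (fun y => ∑ i, ρ i (ι y) * f (r i (ι y))) =ᶠ[𝓝 z] f := by
      filter_upwards [hι.continuous.continuousAt (hVo.mem_nhds hzV')] with y hy
      have h2 : ∀ i, ρ i (ι y) * f (r i (ι y)) = ρ i (ι y) * f y := fun i => by
        by_cases hi : ι y ∈ U i
        · rw [hrι i y hi]
        · rw [image_eq_zero_of_notMem_tsupport fun h => hi (hρ i h), zero_mul, zero_mul]
      simp only [h2]
      rw [← Finset.sum_mul, hρ1 _ (interior_subset hy.1), one_mul]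
    exact DFunLike.congr_fun h1.mfderiv_eq u

/-- A smooth function on a compact embedded manifold extends to the ambient manifold. -/
theorem exists_contMDiff_extension [T2Space X] [SecondCountableTopology X]
    [CompactSpace Λ] {ι : Λ → X} (hι : ContMDiff (𝓡 n) (𝓡 m) ∞ ι) (hinj : Function.Injective ι)
    (himm : ∀ z, Function.Injective (mfderiv (𝓡 n) (𝓡 m) ι z)) {f : Λ → ℝ}
    (hf : ContMDiff (𝓡 n) 𝓘(ℝ, ℝ) ∞ f) :
    ∃ h : X → ℝ, ContMDiff (𝓡 m) 𝓘(ℝ, ℝ) ∞ h ∧ ∀ z, h (ι z) = f z := by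
  have : LocallyCompactSpace X := Manifold.locallyCompact_of_finiteDimensional (𝓡 m)
  have hemb : IsClosedEmbedding ι := hι.continuous.isClosedEmbedding hinj
  obtain ⟨h, hh⟩ := exists_contMDiffMap_forall_mem_convex_of_local (n := ⊤) (𝓡 m) (F := ℝ)
    (t := fun x : X => {v | ∀ z, ι z = x → v = f z})
    (by
      intro x v hv v' hv' a b _ _ hab z hz
      change a • v + b • v' = _
      rw [hv z hz, hv' z hz, ← add_smul, hab, one_smul])
    (by
      intro x
      by_cases hx : x ∈ range ι
      · obtain ⟨z, rfl⟩ := hx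
        obtain ⟨U, r, hU, hzU, hr, hrι⟩ := exists_local_left_inverse hι hemb.isInducing (himm z)
        refine ⟨U, hU.mem_nhds hzU, fun p => f (r p), hf.comp_contMDiffOn hr, ?_⟩
        rintro y hy z' rfl
        change f (r (ι z')) = f z'
        rw [hrι z' hy]
      · exact ⟨(range ι)ᶜ, hemb.isClosed_range.isOpen_compl.mem_nhds hx, fun _ => 0,
          contMDiffOn_const, fun y hy z hz => (hy ⟨z, hz⟩).elim⟩)
  exact ⟨h, h.contMDiff, fun z => hh (ι z) z rfl⟩

end Extension

/-! ### Tangent vectors to all Lagrangian cycles -/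

section Lagrangian

variable {n : ℕ} {X : Type*} [TopologicalSpace X]
  [ChartedSpace (EuclideanSpace ℝ (Fin (2 * n))) X] [IsManifold (𝓡 (2 * n)) ∞ X]
  {Λ : Type*} [TopologicalSpace Λ] [ChartedSpace (EuclideanSpace ℝ (Fin n)) Λ]
  [IsManifold (𝓡 n) ∞ Λ]

/-- The tangent space of the space of Lagrangian cycles consists of the closed forms. -/
theorem tangentVectors_lagrangianCycles [T2Space X] [SecondCountableTopology X] [T2Space Λ]
    [CompactSpace Λ] {Ω : DForm (2 * n) X 2} (hΩ : IsSymplectic Ω) {ι : Λ → X}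
    (hι : IsLagrangianEmbedding Ω ι) :
    tangentVectors Ω (lagrangianCycles Λ Ω) ι = closedForms n Λ 1 := by
  refine Subset.antisymm (tangentVectors_lagrangianCycles_subset hΩ.smooth hΩ.closed ι)
    fun α hα => ?_
  obtain ⟨G, hG⟩ := exists_differences_extension hι.smooth hι.injective hι.immersion hα
  obtain ⟨Φ, k, -, hk0, hΦ, hΦ0, hL, hv⟩ := exists_lagrangian_family hΩ hι G fun z => by
    obtain ⟨V, hV, hzV, g, hg, hGg, -⟩ := hG z
    exact ⟨V, hV, hzV, g, hg, hGg⟩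
  refine ⟨Φ, hΦ, hL, fun t => ⟨Φ t, hL t, rfl⟩, hΦ0, fun x u => ?_⟩
  rw [hv, hk0, one_mul]
  subst hΦ0
  obtain ⟨V, hV, hzV, g, hg, hGg, hgα⟩ := hG x
  rw [← hgα u]
  have h1 : G (Φ 0 x) =ᶠ[𝓝 (Φ 0 x)] fun q => g q - g (Φ 0 x) := by
    filter_upwards [hV.mem_nhds hzV] with q hq using hGg _ hzV q hq
  refine (mfderiv_sub_const_apply ((hg.contMDiffAt (hV.mem_nhds hzV)).mdifferentiableAt
    (by simp)) (g (Φ 0 x)) _).symm.trans ?_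
  exact DFunLike.congr_fun h1.mfderiv_eq.symm _

end Lagrangian

/-! ### Frames of the line bundle and the complex Leibniz rule -/

section Frames

variable {m : ℕ} {X : Type*} [TopologicalSpace X] [ChartedSpace (EuclideanSpace ℝ (Fin m)) X]
  [IsManifold (𝓡 m) ∞ X]
  {L : X → Type*} [TopologicalSpace (Bundle.TotalSpace ℂ L)]
  [∀ x, AddCommGroup (L x)] [∀ x, Module ℂ (L x)] [∀ x, TopologicalSpace (L x)]
  [∀ x, IsTopologicalAddGroup (L x)] [∀ x, ContinuousSMul ℝ (L x)] [FiberBundle ℂ L]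
  [VectorBundle ℂ ℂ L] [VectorBundle ℝ ℂ L] [ContMDiffVectorBundle ∞ ℂ L (𝓡 m)]

/-- The coordinate of a vector of the line bundle in the trivialization around `x₀`. -/
noncomputable def fibreCoord (x₀ : X) {x : X} (l : L x) : ℂ :=
  (trivializationAt ℂ L x₀ ⟨x, l⟩).2

lemma fibreCoord_smul {x₀ x : X} (hx : x ∈ (trivializationAt ℂ L x₀).baseSet) (z : ℂ) (l : L x) :
    fibreCoord x₀ (z • l) = z * fibreCoord x₀ l :=
  ((trivializationAt ℂ L x₀).linear ℂ hx).map_smul z l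

lemma fibreCoord_injective {x₀ x : X} (hx : x ∈ (trivializationAt ℂ L x₀).baseSet) :
    Function.Injective (fibreCoord x₀ : L x → ℂ) := fun _ _ h =>
  ((trivializationAt ℂ L x₀).continuousLinearEquivAt ℂ x hx).injective h

lemma fibreCoord_zero {x₀ x : X} (hx : x ∈ (trivializationAt ℂ L x₀).baseSet) :
    fibreCoord x₀ (0 : L x) = 0 := by
  have := fibreCoord_smul hx 0 (0 : L x)
  rwa [zero_smul, zero_mul] at this

lemma fibreCoord_ne_zero {x₀ x : X} (hx : x ∈ (trivializationAt ℂ L x₀).baseSet) {l : L x}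
    (hl : l ≠ 0) : fibreCoord x₀ l ≠ 0 := fun h =>
  hl (fibreCoord_injective hx (h.trans (fibreCoord_zero hx).symm))

lemma eq_div_smul {x₀ x : X} (hx : x ∈ (trivializationAt ℂ L x₀).baseSet) {l : L x}
    (hl : fibreCoord x₀ l ≠ 0) (l' : L x) :
    l' = (fibreCoord x₀ l' / fibreCoord x₀ l) • l := by
  refine fibreCoord_injective hx ?_
  rw [fibreCoord_smul hx, div_mul_cancel₀ _ hl]

lemma exists_eq_smul {x : X} {l : L x} (hl : l ≠ 0) (l' : L x) : ∃ z : ℂ, l' = z • l :=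
  ⟨_, eq_div_smul (FiberBundle.mem_baseSet_trivializationAt' x)
    (fibreCoord_ne_zero (FiberBundle.mem_baseSet_trivializationAt' x) hl) l'⟩

lemma smul_left_injective_fibre {x : X} {l : L x} (hl : l ≠ 0) {z z' : ℂ}
    (h : z • l = z' • l) : z = z' := by
  have hx : x ∈ (trivializationAt ℂ L x).baseSet := FiberBundle.mem_baseSet_trivializationAt' x
  have h1 := congrArg (fibreCoord x) h
  rw [fibreCoord_smul hx, fibreCoord_smul hx] at h1
  exact mul_right_cancel₀ (fibreCoord_ne_zero hx hl) h1

lemma smul_fibre_eq_zero {x : X} {l : L x} (hl : l ≠ 0) {z : ℂ} (h : z • l = 0) : z = 0 :=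
  smul_left_injective_fibre hl (h.trans (zero_smul ℂ l).symm)

lemma contMDiffAt_section_iff_fibreCoord {σ : ∀ x : X, L x} {x₀ x : X}
    (hx : x ∈ (trivializationAt ℂ L x₀).baseSet) :
    ContMDiffAt (𝓡 m) ((𝓡 m).prod 𝓘(ℝ, ℂ)) ∞ (fun x => Bundle.TotalSpace.mk' ℂ x (σ x)) x ↔
      ContMDiffAt (𝓡 m) 𝓘(ℝ, ℂ) ∞ (fun x => fibreCoord x₀ (σ x)) x :=
  Bundle.Trivialization.contMDiffAt_section_iff (IB := 𝓡 m) (n := ∞) (s := σ)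
    (trivializationAt ℂ L x₀) hx

lemma contMDiffAt_smul_section {σ : ∀ x : X, L x} {g : X → ℂ} {x : X}
    (hσ : ContMDiffAt (𝓡 m) ((𝓡 m).prod 𝓘(ℝ, ℂ)) ∞ (fun x => Bundle.TotalSpace.mk' ℂ x (σ x)) x)
    (hg : ContMDiffAt (𝓡 m) 𝓘(ℝ, ℂ) ∞ g x) :
    ContMDiffAt (𝓡 m) ((𝓡 m).prod 𝓘(ℝ, ℂ)) ∞
      (fun x => Bundle.TotalSpace.mk' ℂ x (g x • σ x)) x := by
  have hx : x ∈ (trivializationAt ℂ L x).baseSet := FiberBundle.mem_baseSet_trivializationAt' x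
  refine (contMDiffAt_section_iff_fibreCoord hx).2 ?_
  have h1 : ContMDiffAt (𝓡 m) 𝓘(ℝ, ℂ) ∞ (fun y => g y * fibreCoord x (σ y)) x :=
    (contDiff_mul (𝕜 := ℝ) (𝔸 := ℂ)).contMDiff.contMDiffAt.comp x
      (hg.prodMk_space ((contMDiffAt_section_iff_fibreCoord hx).1 hσ))
  refine h1.congr_of_eventuallyEq ?_
  filter_upwards [(trivializationAt ℂ L x).open_baseSet.mem_nhds hx] with y hy
    using fibreCoord_smul hy _ _

/-- Around every point there is a smooth global section with constant coordinate `1`. -/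
lemma exists_frame [T2Space X] (x₀ : X) : ∃ σ : ∀ x : X, L x, IsSmoothSection m σ ∧
    ∀ᶠ x in 𝓝 x₀, x ∈ (trivializationAt ℂ L x₀).baseSet ∧ fibreCoord x₀ (σ x) = 1 := by
  set e := trivializationAt ℂ L x₀ with he
  have hx₀ : x₀ ∈ e.baseSet := FiberBundle.mem_baseSet_trivializationAt' x₀
  obtain ⟨b, -, hb⟩ := (SmoothBumpFunction.nhds_basis_tsupport (I := 𝓡 m) x₀).mem_iff.1
    (e.open_baseSet.mem_nhds hx₀)
  let τ : ∀ x : X, L x := fun x => e.symm x 1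
  have hτ1 : ∀ x ∈ e.baseSet, fibreCoord x₀ (τ x) = 1 := fun x hx => by
    have := e.apply_mk_symm hx (1 : ℂ)
    exact congrArg Prod.snd this
  have hτ : ContMDiffOn (𝓡 m) ((𝓡 m).prod 𝓘(ℝ, ℂ)) ∞
      (fun x => Bundle.TotalSpace.mk' ℂ x (τ x)) e.baseSet := fun x hx => by
    refine ((contMDiffAt_section_iff_fibreCoord (x₀ := x₀) hx).2 ?_).contMDiffWithinAt
    refine (contMDiffAt_const (c := (1 : ℂ))).congr_of_eventuallyEq ?_
    filter_upwards [e.open_baseSet.mem_nhds hx] with y hy using hτ1 y hy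
  refine ⟨(b : X → ℝ) • τ, ContMDiffOn.smul_section_of_tsupport b.contMDiff.contMDiffOn
    e.open_baseSet hb hτ, ?_⟩
  filter_upwards [e.open_baseSet.mem_nhds hx₀, b.eventuallyEq_one] with x hx hbx
  refine ⟨hx, ?_⟩
  rw [← hτ1 x hx]
  change fibreCoord x₀ (b x • τ x) = _
  rw [hbx]
  simp

variable (a : HermitianConnection m L)

lemma mdifferentiableAt_section {σ : ∀ x : X, L x} {x : X}
    (hσ : ContMDiffAt (𝓡 m) ((𝓡 m).prod 𝓘(ℝ, ℂ)) ∞ (fun x => Bundle.TotalSpace.mk' ℂ x (σ x)) x) :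
    MDifferentiableAt (𝓡 m) ((𝓡 m).prod 𝓘(ℝ, ℂ)) (fun x => Bundle.TotalSpace.mk' ℂ x (σ x)) x :=
  hσ.mdifferentiableAt (by simp)

/-- The derivative of a complex function, as a complex number. -/
noncomputable abbrev complexDeriv (g : X → ℂ) (x : X) (w : TangentSpace (𝓡 m) x) : ℂ :=
  mfderiv (𝓡 m) 𝓘(ℝ, ℂ) g x w

/-- The Leibniz rule for complex functions. -/
lemma cov_smul {σ : ∀ x : X, L x} (hσ : IsSmoothSection m σ) {g : X → ℂ} {x : X}
    (hg : ContMDiffAt (𝓡 m) 𝓘(ℝ, ℂ) ∞ g x) (v : TangentSpace (𝓡 m) x) :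
    a.cov (fun y => g y • σ y) x v = complexDeriv g x v • σ x + g x • a.cov σ x v := by
  let c := a.cov.isCovariantDerivativeOnUniv
  have hgd : MDifferentiableAt (𝓡 m) 𝓘(ℝ, ℂ) g x := hg.mdifferentiableAt (by simp)
  have hre : ContMDiffAt (𝓡 m) 𝓘(ℝ, ℝ) ∞ (fun y => (g y).re) x :=
    Complex.reCLM.contDiff.contMDiff.contMDiffAt.comp x hg
  have him : ContMDiffAt (𝓡 m) 𝓘(ℝ, ℝ) ∞ (fun y => (g y).im) x :=
    Complex.imCLM.contDiff.contMDiff.contMDiffAt.comp x hg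
  have hre' : ∀ v, realDeriv (fun y => (g y).re) x v = (complexDeriv g x v).re := fun v => by
    have h1 := mfderiv_comp_apply (g := Complex.reCLM) (I' := 𝓘(ℝ, ℂ)) (I'' := 𝓘(ℝ, ℝ)) x
      Complex.reCLM.differentiableAt.mdifferentiableAt hgd v
    rw [mfderiv_eq_fderiv, ContinuousLinearMap.fderiv] at h1
    exact h1
  have him' : ∀ v, realDeriv (fun y => (g y).im) x v = (complexDeriv g x v).im := fun v => by
    have h1 := mfderiv_comp_apply (g := Complex.imCLM) (I' := 𝓘(ℝ, ℂ)) (I'' := 𝓘(ℝ, ℝ)) x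
      Complex.imCLM.differentiableAt.mdifferentiableAt hgd v
    rw [mfderiv_eq_fderiv, ContinuousLinearMap.fderiv] at h1
    exact h1
  have hI : ContMDiffAt (𝓡 m) ((𝓡 m).prod 𝓘(ℝ, ℂ)) ∞
      (fun x => Bundle.TotalSpace.mk' ℂ x (Complex.I • σ x)) x :=
    contMDiffAt_smul_section (hσ x) contMDiffAt_const
  have hofReal : ∀ {f : X → ℝ}, ContMDiffAt (𝓡 m) 𝓘(ℝ, ℝ) ∞ f x →
      ContMDiffAt (𝓡 m) 𝓘(ℝ, ℂ) ∞ (fun y => (f y : ℂ)) x := fun hf =>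
    Complex.ofRealCLM.contDiff.contMDiff.contMDiffAt.comp x hf
  -- The connection satisfies the Leibniz rule for real functions only; splitting into real and
  -- imaginary parts and using `cov_complex` for the factor i yields the complex rule.
  have hsum : (fun y => g y • σ y) = (fun y => (g y).re) • σ +
      (fun y => (g y).im) • fun y => Complex.I • σ y := by
    funext y
    change g y • σ y = (g y).re • σ y + (g y).im • Complex.I • σ y
    conv_lhs => rw [← Complex.re_add_im (g y)]
    rw [add_smul, mul_smul]
    rfl
  have h1 : MDifferentiableAt (𝓡 m) ((𝓡 m).prod 𝓘(ℝ, ℂ)) (fun y => Bundle.TotalSpace.mk' ℂ y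
      (((fun y => (g y).re) • σ) y)) x :=
    mdifferentiableAt_section (contMDiffAt_smul_section (hσ x) (hofReal hre))
  have h2 : MDifferentiableAt (𝓡 m) ((𝓡 m).prod 𝓘(ℝ, ℂ)) (fun y => Bundle.TotalSpace.mk' ℂ y
      (((fun y => (g y).im) • fun y => Complex.I • σ y) y)) x :=
    mdifferentiableAt_section (contMDiffAt_smul_section hI (hofReal him))
  rw [hsum, c.add h1 h2, c.leibniz (mdifferentiableAt_section (hσ x))
    (hre.mdifferentiableAt (by simp)), c.leibniz (mdifferentiableAt_section hI)
    (him.mdifferentiableAt (by simp))]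
  change ((g x).re • a.cov σ x v + realDeriv (fun y => (g y).re) x v • σ x) +
    ((g x).im • a.cov (fun y => Complex.I • σ y) x v +
      realDeriv (fun y => (g y).im) x v • Complex.I • σ x) = _
  rw [a.cov_complex Complex.I σ hσ x v, hre', him']
  have hz : ∀ (z : ℂ) (l : L x), z.re • l + z.im • Complex.I • l = z • l := fun z l => by
    conv_rhs => rw [← Complex.re_add_im z]
    rw [add_smul, mul_smul]
    rfl
  rw [← hz (complexDeriv g x v), ← hz (g x)]
  abel

lemma cov_congr {σ σ' : ∀ x : X, L x} {x : X}
    (hσ : ContMDiffAt (𝓡 m) ((𝓡 m).prod 𝓘(ℝ, ℂ)) ∞ (fun x => Bundle.TotalSpace.mk' ℂ x (σ x)) x)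
    (hσ' : ContMDiffAt (𝓡 m) ((𝓡 m).prod 𝓘(ℝ, ℂ)) ∞ (fun x => Bundle.TotalSpace.mk' ℂ x (σ' x)) x)
    (h : ∀ᶠ y in 𝓝 x, σ y = σ' y) : a.cov σ x = a.cov σ' x :=
  a.cov.isCovariantDerivativeOnUniv.congr_of_eventuallyEq (mdifferentiableAt_section hσ)
    (mdifferentiableAt_section hσ') univ_mem h

/-- Two smooth sections differ by a smooth complex function where one of them does not vanish. -/
lemma exists_section_ratio {σ σ' : ∀ x : X, L x} (hσ : IsSmoothSection m σ)
    (hσ' : IsSmoothSection m σ') {x : X} (hx : σ x ≠ 0) :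
    ∃ g : X → ℂ, ContMDiffAt (𝓡 m) 𝓘(ℝ, ℂ) ∞ g x ∧ (∀ᶠ y in 𝓝 x, σ' y = g y • σ y) ∧
      ∀ v, a.cov σ' x v = complexDeriv g x v • σ x + g x • a.cov σ x v := by
  have hxb : x ∈ (trivializationAt ℂ L x).baseSet := FiberBundle.mem_baseSet_trivializationAt' x
  have h1 := (contMDiffAt_section_iff_fibreCoord (m := m) hxb).1 (hσ x)
  have h1' := (contMDiffAt_section_iff_fibreCoord (m := m) hxb).1 (hσ' x)
  have hne := fibreCoord_ne_zero hxb hx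
  have hg : ContMDiffAt (𝓡 m) 𝓘(ℝ, ℂ) ∞ (fun y => fibreCoord x (σ' y) / fibreCoord x (σ y)) x := by
    have h2 : ContDiffAt ℝ ∞ (fun p : ℂ × ℂ => p.1 / p.2)
        (fibreCoord x (σ' x), fibreCoord x (σ x)) := by
      simp only [div_eq_mul_inv]
      exact contDiffAt_fst.mul (contDiffAt_snd.inv hne)
    exact ContMDiffAt.comp (f := fun y => (fibreCoord x (σ' y), fibreCoord x (σ y))) x
      h2.contMDiffAt (h1'.prodMk_space h1)
  have hev : ∀ᶠ y in 𝓝 x, σ' y = (fibreCoord x (σ' y) / fibreCoord x (σ y)) • σ y := by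
    filter_upwards [(trivializationAt ℂ L x).open_baseSet.mem_nhds hxb,
      h1.continuousAt.eventually_ne hne] with y hy hy'
    exact eq_div_smul hy hy' _
  refine ⟨_, hg, hev, fun v => ?_⟩
  rw [cov_congr a (hσ' x) (contMDiffAt_smul_section (hσ x) hg) hev, cov_smul a hσ hg]

end Frames

/-! ### Sections along a map and the pulled back connection -/

section AlongMaps

variable {m : ℕ} {X : Type*} [TopologicalSpace X] [ChartedSpace (EuclideanSpace ℝ (Fin m)) X]
  [IsManifold (𝓡 m) ∞ X]
  {L : X → Type*} [TopologicalSpace (Bundle.TotalSpace ℂ L)]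
  [∀ x, AddCommGroup (L x)] [∀ x, Module ℂ (L x)] [∀ x, TopologicalSpace (L x)]
  [∀ x, IsTopologicalAddGroup (L x)] [∀ x, ContinuousSMul ℝ (L x)] [FiberBundle ℂ L]
  [VectorBundle ℂ ℂ L] [VectorBundle ℝ ℂ L] [ContMDiffVectorBundle ∞ ℂ L (𝓡 m)]
  (a : HermitianConnection m L)
  {V V' : Type*} [NormedAddCommGroup V] [NormedSpace ℝ V] [NormedAddCommGroup V']
  [NormedSpace ℝ V']

/-- The section `c` of the line bundle along the map `p ↦ (c p).1` is smooth near `p` and satisfies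
`∇_w c = β w • c` at `p`, for the pulled back connection. -/
def HasCov (c : V → Bundle.TotalSpace ℂ L) (p : V) (β : V → ℂ) : Prop :=
  ContMDiffAt 𝓘(ℝ, V) (𝓡 m) ∞ (fun q => (c q).1) p ∧
  ∃ (σ : ∀ x : X, L x) (z : V → ℂ), IsSmoothSection m σ ∧ σ (c p).1 ≠ 0 ∧ ContDiffAt ℝ ∞ z p ∧
    (∀ᶠ q in 𝓝 p, (c q).2 = z q • σ (c q).1) ∧
    ∀ w, fderiv ℝ z p w • σ (c p).1 + z p • a.cov σ (c p).1
      (mfderiv 𝓘(ℝ, V) (𝓡 m) (fun q => (c q).1) p w) = β w • (c p).2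

lemma IsSmoothSection.eventually_ne_zero {σ : ∀ x : X, L x} (hσ : IsSmoothSection m σ) {x : X}
    (hx : σ x ≠ 0) : ∀ᶠ y in 𝓝 x, σ y ≠ 0 := by
  have hxb : x ∈ (trivializationAt ℂ L x).baseSet := FiberBundle.mem_baseSet_trivializationAt' x
  have h1 := ((contMDiffAt_section_iff_fibreCoord (m := m) hxb).1 (hσ x)).continuousAt
  filter_upwards [(trivializationAt ℂ L x).open_baseSet.mem_nhds hxb,
    h1.eventually_ne (fibreCoord_ne_zero hxb hx)] with y hy hy' h
  exact hy' (by rw [h, fibreCoord_zero hy])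

lemma fderiv_comp_complexDeriv {g : X → ℂ} {F : V → X} {p : V}
    (hg : MDifferentiableAt (𝓡 m) 𝓘(ℝ, ℂ) g (F p)) (hF : MDifferentiableAt 𝓘(ℝ, V) (𝓡 m) F p)
    (w : V) : fderiv ℝ (fun q => g (F q)) p w =
      complexDeriv g (F p) (mfderiv 𝓘(ℝ, V) (𝓡 m) F p w) := by
  rw [← mfderiv_eq_fderiv]
  exact mfderiv_comp_apply p hg hF w

variable {a}

lemma HasCov.congr {c c' : V → Bundle.TotalSpace ℂ L} {p : V} {β : V → ℂ} (h : HasCov a c p β)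
    (hc : c =ᶠ[𝓝 p] c') : HasCov a c' p β := by
  obtain ⟨hF, σ, z, hσ, hne, hz, hcz, heq⟩ := h
  have hp := hc.self_of_nhds
  have hF' : (fun q => (c q).1) =ᶠ[𝓝 p] fun q => (c' q).1 := by
    filter_upwards [hc] with q hq
    rw [hq]
  refine ⟨hF.congr_of_eventuallyEq hF'.symm, σ, z, hσ, by rwa [← hp], hz, ?_, ?_⟩
  · filter_upwards [hc, hcz] with q hq hq'
    rwa [← hq]
  · rwa [← hF'.mfderiv_eq, ← hp]

/-- The covariant derivative does not depend on the way in which the section is written. -/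
lemma HasCov.cov_eq {c : V → Bundle.TotalSpace ℂ L} {p : V} {β : V → ℂ} (h : HasCov a c p β)
    {σ : ∀ x : X, L x} {z : V → ℂ} (hσ : IsSmoothSection m σ) (hz : DifferentiableAt ℝ z p)
    (hcz : ∀ᶠ q in 𝓝 p, (c q).2 = z q • σ (c q).1) (w : V) :
    fderiv ℝ z p w • σ (c p).1 + z p • a.cov σ (c p).1
      (mfderiv 𝓘(ℝ, V) (𝓡 m) (fun q => (c q).1) p w) = β w • (c p).2 := by
  obtain ⟨hF, τ, y, hτ, hne, hy, hcy, heq⟩ := h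
  obtain ⟨g, hg, hgσ, hgc⟩ := exists_section_ratio a hτ hσ hne
  have hFd : MDifferentiableAt 𝓘(ℝ, V) (𝓡 m) (fun q => (c q).1) p :=
    hF.mdifferentiableAt (by simp)
  have hgd : MDifferentiableAt (𝓡 m) 𝓘(ℝ, ℂ) g (c p).1 := hg.mdifferentiableAt (by simp)
  have hgF : DifferentiableAt ℝ (fun q => g (c q).1) p :=
    (hgd.comp p hFd).differentiableAt
  -- Change of frame: c = y τ = z σ = z g τ, and τ is nonzero. The derivative of g produced by the
  -- product rule is the one appearing in ∇σ.
  have hyz : y =ᶠ[𝓝 p] fun q => z q * g (c q).1 := by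
    filter_upwards [hcz, hcy, hF.continuousAt.eventually hgσ,
      hF.continuousAt.eventually (hτ.eventually_ne_zero hne)] with q h1 h2 h3 h4
    refine smul_left_injective_fibre h4 ?_
    rw [← h2, h1, h3, mul_smul]
  have hfy : fderiv ℝ y p w = fderiv ℝ z p w * g (c p).1 + z p * complexDeriv g (c p).1
      (mfderiv 𝓘(ℝ, V) (𝓡 m) (fun q => (c q).1) p w) := by
    rw [hyz.fderiv_eq, ← fderiv_comp_complexDeriv (F := fun q => (c q).1) hgd hFd]
    have h1 := DFunLike.congr_fun (hz.hasFDerivAt.mul hgF.hasFDerivAt).fderiv w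
    refine h1.trans ?_
    simp only [add_apply, smul_apply, smul_eq_mul]
    ring
  rw [← heq w, hfy, hyz.self_of_nhds, hgc, hgσ.self_of_nhds]
  simp only [smul_add, add_smul, mul_smul]
  abel

/-- The coordinate of a section along a map with respect to a frame. -/
lemma HasCov.exists_coord {c : V → Bundle.TotalSpace ℂ L} {p : V} {β : V → ℂ}
    (h : HasCov a c p β) {σ : ∀ x : X, L x} (hσ : IsSmoothSection m σ) (hne : σ (c p).1 ≠ 0) :
    ∃ z : V → ℂ, ContDiffAt ℝ ∞ z p ∧ ∀ᶠ q in 𝓝 p, (c q).2 = z q • σ (c q).1 := by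
  obtain ⟨hF, τ, y, hτ, -, hy, hcy, -⟩ := h
  obtain ⟨g, hg, hgτ, -⟩ := exists_section_ratio a hσ hτ hne
  refine ⟨fun q => y q * g (c q).1, hy.mul ?_, ?_⟩
  · rw [← contMDiffAt_iff_contDiffAt]
    exact ContMDiffAt.comp p hg hF
  · filter_upwards [hcy, hF.continuousAt.eventually hgτ] with q h1 h2
    rw [h1, h2, mul_smul]

/-- The logarithmic derivative of the ratio of two sections along the same map. -/
lemma HasCov.ratio {c c' : V → Bundle.TotalSpace ℂ L} {p : V} {β β' : V → ℂ}
    (h : HasCov a c p β) (h' : HasCov a c' p β') (hne : (c p).2 ≠ 0) {r : V → ℂ}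
    (hr : ∀ᶠ q in 𝓝 p, c' q = ⟨(c q).1, r q • (c q).2⟩) :
    DifferentiableAt ℝ r p ∧ ∀ w, fderiv ℝ r p w = (β' w - β w) * r p := by
  have h'' := h'.congr hr
  obtain ⟨hF, σ, z, hσ, hσne, hz, hcz, heq⟩ := h
  obtain ⟨y, hy, hcy⟩ := h''.exists_coord hσ hσne
  have hzp : z p ≠ 0 := fun h0 => hne (by rw [hcz.self_of_nhds, h0, zero_smul])
  have hrz : r =ᶠ[𝓝 p] fun q => y q * (z q)⁻¹ := by
    filter_upwards [hcz, hcy, hF.continuousAt.eventually (hσ.eventually_ne_zero hσne),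
      hz.continuousAt.eventually_ne hzp] with q h1 h2 h3 h4
    have h5 : r q • (c q).2 = y q • σ (c q).1 := h2
    rw [h1, ← mul_smul] at h5
    rw [← smul_left_injective_fibre h3 h5, mul_inv_cancel_right₀ h4]
  have hrd : DifferentiableAt ℝ r p := by
    have h1 : ContDiffAt ℝ ∞ (fun q => y q * (z q)⁻¹) p := hy.mul (hz.inv hzp)
    exact ((h1.congr_of_eventuallyEq hrz)).differentiableAt (by simp)
  refine ⟨hrd, fun w => ?_⟩
  have hzd : DifferentiableAt ℝ z p := hz.differentiableAt (by simp)
  have hcrz : ∀ᶠ q in 𝓝 p, r q • (c q).2 = (r q * z q) • σ (c q).1 := by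
    filter_upwards [hcz] with q hq
    rw [hq, mul_smul]
  have key := h''.cov_eq hσ (hrd.mul hzd) hcrz w
  have h1 : fderiv ℝ (r * z) p w = fderiv ℝ r p w * z p + r p * fderiv ℝ z p w := by
    have h1 := DFunLike.congr_fun (hrd.hasFDerivAt.mul hzd.hasFDerivAt).fderiv w
    refine h1.trans ?_
    simp only [add_apply, smul_apply, smul_eq_mul]
    ring
  rw [h1] at key
  have h2 : (fderiv ℝ r p w * z p + r p * fderiv ℝ z p w) • σ (c p).1 + (r p * z p) •
      a.cov σ (c p).1 (mfderiv 𝓘(ℝ, V) (𝓡 m) (fun q => (c q).1) p w) =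
      β' w • r p • (c p).2 := key
  have h3 := heq w
  have h4 : r p • (fderiv ℝ z p w • σ (c p).1 + z p • a.cov σ (c p).1
      (mfderiv 𝓘(ℝ, V) (𝓡 m) (fun q => (c q).1) p w)) = r p • β w • (c p).2 := by rw [h3]
  -- The equation for c, multiplied by r, is subtracted from the one for c' = r c; the terms with ∇σ
  -- cancel.
  have h5 : (fderiv ℝ r p w * z p) • σ (c p).1 = (β' w * r p - r p * β w) • (c p).2 := by
    rw [sub_smul, mul_smul (β' w), mul_smul (r p) (β w), ← h2, ← h4]
    simp only [smul_add, add_smul, mul_smul]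
    abel
  rw [hcz.self_of_nhds, smul_smul] at h5
  have h6 := smul_left_injective_fibre hσne h5
  refine mul_right_cancel₀ hzp ?_
  rw [h6]
  ring

lemma HasCov.const_smul {c : V → Bundle.TotalSpace ℂ L} {p : V} {β : V → ℂ}
    (h : HasCov a c p β) (r : ℂ) :
    HasCov a (fun q => (⟨(c q).1, r • (c q).2⟩ : Bundle.TotalSpace ℂ L)) p β := by
  obtain ⟨hF, σ, z, hσ, hσne, hz, hcz, heq⟩ := h
  refine ⟨hF, σ, fun q => r * z q, hσ, hσne, contDiffAt_const.mul hz, ?_, fun w => ?_⟩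
  · filter_upwards [hcz] with q hq
    rw [hq, mul_smul]
  · have h1 : fderiv ℝ (fun q => r * z q) p w = r * fderiv ℝ z p w := by
      rw [fderiv_const_mul (hz.differentiableAt (by simp))]
      rfl
    rw [h1, mul_smul, mul_smul, ← smul_add]
    refine (congrArg (r • ·) (heq w)).trans ?_
    exact smul_comm _ _ _

/-- Pullback of a section along a map. -/
lemma HasCov.comp {c : V → Bundle.TotalSpace ℂ L} {g : V' → V} {g' : V' →L[ℝ] V} {p : V'}
    {β : V → ℂ} (h : HasCov a c (g p) β) (hg : ContDiffAt ℝ ∞ g p) (hg' : HasFDerivAt g g' p) :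
    HasCov a (fun q => c (g q)) p (fun w => β (g' w)) := by
  obtain ⟨hF, σ, z, hσ, hσne, hz, hcz, heq⟩ := h
  refine ⟨ContMDiffAt.comp (g := fun q => (c q).1) (f := g) p hF hg.contMDiffAt, σ,
    fun q => z (g q), hσ, hσne, hz.comp p hg, hg.continuousAt.eventually hcz, fun w => ?_⟩
  have h1 : fderiv ℝ (fun q => z (g q)) p w = fderiv ℝ z (g p) (g' w) := by
    have := ((hz.differentiableAt (by simp)).hasFDerivAt.comp p hg').fderiv
    exact DFunLike.congr_fun this w
  have h2 := mfderiv_comp_of_hasFDerivAt (F := fun q => (c q).1)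
    (hF.mdifferentiableAt (by simp)) hg' w
  rw [h1]
  refine Eq.trans ?_ (heq (g' w))
  exact congrArg (fun v => _ + z (g p) • a.cov σ (c (g p)).1 v) h2

/-- Parallel curves are the solutions of `∇ c = 0`. -/
lemma isParallel_of_hasCov {c : ℝ → Bundle.TotalSpace ℂ L} (h : ∀ s, HasCov a c s 0) :
    a.IsParallel c := by
  refine ⟨fun s => ?_, fun s σ z hσ hz hcz => ?_⟩
  · obtain ⟨hF, σ, z, hσ, hσne, hz, hcz, -⟩ := h s
    refine Bundle.contMDiffAt_totalSpace.2 ⟨hF, ?_⟩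
    have hb : (c s).1 ∈ (trivializationAt ℂ L (c s).1).baseSet :=
      FiberBundle.mem_baseSet_trivializationAt' _
    have h1 : ContMDiffAt 𝓘(ℝ, ℝ) 𝓘(ℝ, ℂ) ∞ (fun q => fibreCoord (c s).1 (σ (c q).1)) s :=
      ContMDiffAt.comp (g := fun x => fibreCoord (c s).1 (σ x)) s
        ((contMDiffAt_section_iff_fibreCoord hb).1 (hσ _)) hF
    have h2 : ContMDiffAt 𝓘(ℝ, ℝ) 𝓘(ℝ, ℂ) ∞ (fun q => z q * fibreCoord (c s).1 (σ (c q).1)) s :=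
      (hz.mul h1.contDiffAt).contMDiffAt
    refine h2.congr_of_eventuallyEq ?_
    filter_upwards [hcz, hF.continuousAt.eventually
      ((trivializationAt ℂ L (c s).1).open_baseSet.mem_nhds hb)] with q h3 h4
    have h5 : fibreCoord (c s).1 (c q).2 = z q * fibreCoord (c s).1 (σ (c q).1) := by
      rw [h3, fibreCoord_smul h4]
    exact h5
  · have h1 := (h s).cov_eq hσ hz hcz 1
    rw [fderiv_apply_one_eq_deriv] at h1
    exact h1.trans (zero_smul ℂ _)

/-- Parallelism tests the curve only against given expressions z σ. A global smooth section nonzero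
near the base point supplies such an expression, with the fibre coordinate of the curve as z. -/
lemma hasCov_of_isParallel [T2Space X] {c : ℝ → Bundle.TotalSpace ℂ L} (h : a.IsParallel c)
    (s : ℝ) : HasCov a c s 0 := by
  obtain ⟨hc, heq⟩ := h
  obtain ⟨hF, hc2⟩ := Bundle.contMDiffAt_totalSpace.1 (hc s)
  obtain ⟨σ, hσ, hσ1⟩ := exists_frame (m := m) (L := L) (c s).1
  have hz : ContDiffAt ℝ ∞ (fun q => fibreCoord (c s).1 (c q).2) s :=
    ContMDiffAt.contDiffAt hc2
  have hcz : ∀ᶠ q in 𝓝 s, (c q).2 = fibreCoord (c s).1 (c q).2 • σ (c q).1 := by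
    filter_upwards [hF.continuousAt.eventually hσ1] with q hq
    obtain ⟨h1, h2⟩ := hq
    have h3 := eq_div_smul h1 (by rw [h2]; exact one_ne_zero) (c q).2
    rwa [h2, div_one] at h3
  have hne : σ (c s).1 ≠ 0 := fun h0 => by
    obtain ⟨h1, h2⟩ := hσ1.self_of_nhds
    rw [h0, fibreCoord_zero h1] at h2
    exact zero_ne_one h2
  refine ⟨hF, σ, _, hσ, hne, hz, hcz, fun w => ?_⟩
  have h1 := heq s σ _ hσ (hz.differentiableAt (by simp)) hcz
  rw [← fderiv_apply_one_eq_deriv] at h1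
  have h2 : w = w • (1 : ℝ) := by simp
  rw [h2]
  have h3 : mfderiv 𝓘(ℝ, ℝ) (𝓡 m) (fun q => (c q).1) s (w • (1 : ℝ)) =
      w • mfderiv 𝓘(ℝ, ℝ) (𝓡 m) (fun q => (c q).1) s (1 : ℝ) :=
    (mfderiv 𝓘(ℝ, ℝ) (𝓡 m) (fun q => (c q).1) s).map_smul w (1 : ℝ)
  have h4 := congrArg (w • ·) h1
  simp only [smul_add, smul_zero] at h4
  refine Eq.trans ?_ (h4.trans (zero_smul ℂ _).symm)
  refine congrArg₂ (· + ·) ?_ ?_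
  · rw [map_smul, smul_assoc]
  · refine (congrArg (fun v => _ • a.cov σ (c s).1 v) h3).trans ?_
    refine (congrArg (fun v => _ • v) (map_smul (a.cov σ (c s).1) w _)).trans ?_
    exact smul_comm _ _ _

end AlongMaps

/-! ### Coordinate vector fields and their brackets -/

section CoordinateFields

variable {m : ℕ} {X : Type*} [TopologicalSpace X] [ChartedSpace (EuclideanSpace ℝ (Fin m)) X]
  [IsManifold (𝓡 m) ∞ X]

/-- Around every point there are global smooth fields with prescribed constant components. -/
lemma exists_coordinate_fields [T2Space X] (x₀ : X) : ∃ W : Set X, IsOpen W ∧ x₀ ∈ W ∧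
    W ⊆ (extChartAt (𝓡 m) x₀).source ∧ ∀ u : EuclideanSpace ℝ (Fin m),
      ∃ Y : ∀ x : X, TangentSpace (𝓡 m) x, IsSmoothField Y ∧
        ∀ x ∈ W, fieldComponents x₀ Y x = u := by
  set κ := extChartAt (𝓡 m) x₀ with hκ
  have hs : IsOpen κ.source := isOpen_extChartAt_source x₀
  have hx₀ : x₀ ∈ κ.source := mem_extChartAt_source x₀
  obtain ⟨b, -, hb⟩ := (SmoothBumpFunction.nhds_basis_tsupport (I := 𝓡 m) x₀).mem_iff.1
    (hs.mem_nhds hx₀)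
  obtain ⟨W, hWs, hW, hxW⟩ := mem_nhds_iff.1 (b.eventuallyEq_one.and (hs.mem_nhds hx₀))
  refine ⟨W, hW, hxW, fun x hx => (hWs hx).2, fun u => ?_⟩
  let Z : ∀ x : X, TangentSpace (𝓡 m) x := fun x => mfderiv (𝓡 m) (𝓡 m) κ.symm (κ x) u
  have hZ : ∀ x ∈ κ.source, fieldComponents x₀ Z x = u := fun x hx => by
    have h := mfderiv_extChartAt_mfderiv_symm (κ.map_source hx) u
    rw [← hκ, κ.left_inv hx] at h
    exact h
  have hZs : ContMDiffOn (𝓡 m) (𝓡 m).tangent ∞ (fun x => (⟨x, Z x⟩ : TangentBundle (𝓡 m) X))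
      κ.source := fun x hx => by
    refine ((contMDiffAt_field_iff (x₀ := x₀) hx).2 ?_).contMDiffWithinAt
    refine (contMDiffAt_const (c := u)).congr_of_eventuallyEq ?_
    filter_upwards [hs.mem_nhds hx] with y hy using hZ y hy
  refine ⟨(b : X → ℝ) • Z, ContMDiffOn.smul_section_of_tsupport b.contMDiff.contMDiffOn
    hs hb hZs, fun x hx => ?_⟩
  refine Eq.trans ?_ (hZ x (hWs hx).2)
  have h1 : b x = 1 := (hWs hx).1
  have h2 : ((b : X → ℝ) • Z) x = Z x := by
    change b x • Z x = Z x
    rw [h1, one_smul]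
  exact congrArg (mfderiv (𝓡 m) (𝓡 m) κ x) h2

/-- The bracket of two fields with constant components vanishes. -/
lemma mlieBracket_eq_zero {x₀ x : X} (hx : x ∈ (extChartAt (𝓡 m) x₀).source)
    {Y Z : ∀ x : X, TangentSpace (𝓡 m) x} {u v : EuclideanSpace ℝ (Fin m)}
    (hY : ∀ᶠ y in 𝓝 x, fieldComponents x₀ Y y = u)
    (hZ : ∀ᶠ y in 𝓝 x, fieldComponents x₀ Z y = v) :
    VectorField.mlieBracket (𝓡 m) Y Z x = 0 := by
  set κ := extChartAt (𝓡 m) x₀ with hκ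
  have hs : IsOpen κ.source := isOpen_extChartAt_source x₀
  -- Constant components mean that the field is the pullback of a constant field by the chart;
  -- brackets commute with pullback, and constant fields have zero bracket.
  have key : ∀ {Y : ∀ x : X, TangentSpace (𝓡 m) x} {u : EuclideanSpace ℝ (Fin m)},
      (∀ᶠ y in 𝓝 x, fieldComponents x₀ Y y = u) →
      Y =ᶠ[𝓝 x] VectorField.mpullback (𝓡 m) 𝓘(ℝ, EuclideanSpace ℝ (Fin m)) κ (fun _ => u) := by
    intro Y u hY
    filter_upwards [hY, hs.mem_nhds hx] with y hy hys
    have hi := isInvertible_mfderiv_extChartAt (I := 𝓡 m) hys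
    exact ((hi.inverse_apply_eq).2 hy.symm).symm
  rw [(key hY).mlieBracket_vectorField_eq (key hZ)]
  have hc : ∀ u : EuclideanSpace ℝ (Fin m), MDifferentiableAt 𝓘(ℝ, EuclideanSpace ℝ (Fin m))
      (𝓘(ℝ, EuclideanSpace ℝ (Fin m))).tangent (fun y => (⟨y, u⟩ : TangentBundle
        𝓘(ℝ, EuclideanSpace ℝ (Fin m)) (EuclideanSpace ℝ (Fin m)))) (κ x) := fun u =>
    (contMDiffAt_vectorSpace_iff_contDiffAt.2 (contDiffAt_const (c := u))).mdifferentiableAt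
      (n := ∞) (by simp)
  have hκs : ContMDiffAt (𝓡 m) 𝓘(ℝ, EuclideanSpace ℝ (Fin m)) ∞ κ x := by
    refine contMDiffAt_extChartAt' ?_
    rwa [hκ, extChartAt_source] at hx
  have h2 : (2 : WithTop ℕ∞) ≤ ∞ := by
    change ((2 : ℕ∞) : WithTop ℕ∞) ≤ _
    exact_mod_cast le_top
  have : IsManifold (𝓡 m) (minSmoothness ℝ 2) X := by
    rw [minSmoothness_of_isRCLikeNormedField]
    exact IsManifold.of_le (n := ∞) h2
  refine (VectorField.mpullback_mlieBracket (hc u) (hc v) hκs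
    (by rw [minSmoothness_of_isRCLikeNormedField]; exact h2)).symm.trans ?_
  have h0 : VectorField.mlieBracket 𝓘(ℝ, EuclideanSpace ℝ (Fin m)) (fun _ => u) (fun _ => v)
      (κ x) = 0 :=
    (congrFun VectorField.mlieBracketWithin_univ.symm _).trans
      ((congrFun VectorField.mlieBracketWithin_eq_lieBracketWithin _).trans
        (by simp [VectorField.lieBracketWithin]; rfl))
  exact (congrArg (mfderiv (𝓡 m) 𝓘(ℝ, EuclideanSpace ℝ (Fin m)) κ x).inverse h0).trans
    (map_zero _)

end CoordinateFields

/-! ### Connection forms and curvature -/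

section ConnectionForm

variable {m : ℕ} {X : Type*} [TopologicalSpace X] [ChartedSpace (EuclideanSpace ℝ (Fin m)) X]
  [IsManifold (𝓡 m) ∞ X]
  {L : X → Type*} [TopologicalSpace (Bundle.TotalSpace ℂ L)]
  [∀ x, AddCommGroup (L x)] [∀ x, Module ℂ (L x)] [∀ x, TopologicalSpace (L x)]
  [∀ x, IsTopologicalAddGroup (L x)] [∀ x, ContinuousSMul ℝ (L x)] [FiberBundle ℂ L]
  [VectorBundle ℂ ℂ L] [VectorBundle ℝ ℂ L] [ContMDiffVectorBundle ∞ ℂ L (𝓡 m)]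
  {a : HermitianConnection m L}

/-- The curvature in terms of the connection form of a frame. -/
lemma HermitianConnection.HasCurvature.complexDeriv_sub {Ω : DForm m X 2} (ha : a.HasCurvature Ω)
    {σ : ∀ x : X, L x} (hσ : IsSmoothSection m σ) {Y Z : ∀ x : X, TangentSpace (𝓡 m) x}
    (hY : IsSmoothField Y) (hZ : IsSmoothField Z) {x : X} (hx : σ x ≠ 0)
    (hb : VectorField.mlieBracket (𝓡 m) Y Z x = 0) {g h : X → ℂ}
    (hg : ContMDiffAt (𝓡 m) 𝓘(ℝ, ℂ) ∞ g x) (hh : ContMDiffAt (𝓡 m) 𝓘(ℝ, ℂ) ∞ h x)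
    (hgY : ∀ᶠ y in 𝓝 x, a.cov σ y (Y y) = g y • σ y)
    (hhZ : ∀ᶠ y in 𝓝 x, a.cov σ y (Z y) = h y • σ y) :
    complexDeriv h x (Y x) - complexDeriv g x (Z x) =
      2 * Real.pi * Complex.I * (Ω x ![Y x, Z x] : ℝ) := by
  have h1 := ha σ Y Z hσ hY hZ x
  have key : ∀ {Y : ∀ x : X, TangentSpace (𝓡 m) x} {g : X → ℂ}, IsSmoothField Y →
      ContMDiffAt (𝓡 m) 𝓘(ℝ, ℂ) ∞ g x → (∀ᶠ y in 𝓝 x, a.cov σ y (Y y) = g y • σ y) →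
      ∀ v, a.cov (fun y => a.cov σ y (Y y)) x v = complexDeriv g x v • σ x + g x • a.cov σ x v := by
    intro Y g hY hg hgY v
    rw [cov_congr a (a.cov_smooth σ Y hσ hY x) (contMDiffAt_smul_section (hσ x) hg) hgY,
      cov_smul a hσ hg]
  rw [key hZ hh hhZ, key hY hg hgY, hb, map_zero, sub_zero, hgY.self_of_nhds,
    hhZ.self_of_nhds] at h1
  -- In rank one the quadratic terms g h and h g cancel, so the curvature is the exterior derivative
  -- of the connection form.
  refine smul_left_injective_fibre hx ?_
  rw [← h1, sub_smul, smul_smul, smul_smul, mul_comm (g x)]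
  abel

/-- The connection form of a local frame in a chart. -/
lemma exists_connection_form [T2Space X] {Ω : DForm m X 2} (ha : a.HasCurvature Ω) (x₀ : X) :
    ∃ (σ : ∀ x : X, L x) (W : Set X)
      (A : EuclideanSpace ℝ (Fin m) → EuclideanSpace ℝ (Fin m) →L[ℝ] ℂ),
      IsSmoothSection m σ ∧ IsOpen W ∧ x₀ ∈ W ∧ W ⊆ (extChartAt (𝓡 m) x₀).source ∧
      (∀ x ∈ W, σ x ≠ 0) ∧ (∀ x ∈ W, ContDiffAt ℝ ∞ A (extChartAt (𝓡 m) x₀ x)) ∧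
      (∀ x ∈ W, ∀ v : TangentSpace (𝓡 m) x, a.cov σ x v =
        A (extChartAt (𝓡 m) x₀ x) (mfderiv (𝓡 m) (𝓡 m) (extChartAt (𝓡 m) x₀) x v) • σ x) ∧
      ∀ x ∈ W, ∀ v w : TangentSpace (𝓡 m) x,
        fderiv ℝ A (extChartAt (𝓡 m) x₀ x) (mfderiv (𝓡 m) (𝓡 m) (extChartAt (𝓡 m) x₀) x v)
          (mfderiv (𝓡 m) (𝓡 m) (extChartAt (𝓡 m) x₀) x w) -
        fderiv ℝ A (extChartAt (𝓡 m) x₀ x) (mfderiv (𝓡 m) (𝓡 m) (extChartAt (𝓡 m) x₀) x w)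
          (mfderiv (𝓡 m) (𝓡 m) (extChartAt (𝓡 m) x₀) x v) =
        2 * Real.pi * Complex.I * (Ω x ![v, w] : ℝ) := by
  set κ := extChartAt (𝓡 m) x₀ with hκ
  obtain ⟨σ, hσ, hσ1⟩ := exists_frame (m := m) (L := L) x₀
  obtain ⟨W₁, hW₁, hxW₁, hW₁s, hfields⟩ := exists_coordinate_fields (m := m) x₀
  obtain ⟨W₂, hW₂s, hW₂, hxW₂⟩ := mem_nhds_iff.1 hσ1
  choose Y hY hYu using hfields
  set e := trivializationAt ℂ L x₀ with he
  -- The frame has fibre coordinate 1, so the fibre coordinate of ∇σ is the connection form.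
  -- Smoothness is checked on constant vectors, where `cov_smooth` applies to the coordinate fields
  -- `Y u`.
  let A : EuclideanSpace ℝ (Fin m) → EuclideanSpace ℝ (Fin m) →L[ℝ] ℂ := fun y =>
    (e.continuousLinearMapAt ℝ (κ.symm y)).comp ((a.cov σ (κ.symm y)).comp
      (mfderiv (𝓡 m) (𝓡 m) κ.symm y))
  set W := W₁ ∩ W₂ with hWdef
  have hW : IsOpen W := hW₁.inter hW₂
  have hYx : ∀ x ∈ W, ∀ u, Y u x = mfderiv (𝓡 m) (𝓡 m) κ.symm (κ x) u := fun x hx u => by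
    have h := mfderiv_extChartAt_symm_mfderiv (hW₁s hx.1) (Y u x)
    refine h.symm.trans (congrArg _ ?_)
    exact hYu u x hx.1
  have hYv : ∀ x ∈ W, ∀ v, Y (mfderiv (𝓡 m) (𝓡 m) κ x v) x = v := fun x hx v =>
    (hYx x hx _).trans (mfderiv_extChartAt_symm_mfderiv (hW₁s hx.1) v)
  let g : EuclideanSpace ℝ (Fin m) → X → ℂ := fun u x => fibreCoord x₀ (a.cov σ x (Y u x))
  have hg : ∀ u, ∀ x ∈ W, ContMDiffAt (𝓡 m) 𝓘(ℝ, ℂ) ∞ (g u) x := fun u x hx =>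
    (contMDiffAt_section_iff_fibreCoord (hW₂s hx.2).1).1 (a.cov_smooth σ _ hσ (hY u) x)
  have hcoord : ∀ x ∈ W, ∀ l : L x, l = fibreCoord x₀ l • σ x := fun x hx l => by
    have h := eq_div_smul (hW₂s hx.2).1 (l := σ x) (by rw [(hW₂s hx.2).2]; exact one_ne_zero) l
    rwa [(hW₂s hx.2).2, div_one] at h
  have hAg : ∀ x ∈ W, ∀ u, A (κ x) u = g u x := fun x hx u => by
    have h0 : ∀ q (h : q = x), e.continuousLinearMapAt ℝ q (a.cov σ q
        (mfderiv (𝓡 m) (𝓡 m) κ.symm (κ x) u : TangentSpace (𝓡 m) q)) =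
        e.continuousLinearMapAt ℝ x (a.cov σ x
        (mfderiv (𝓡 m) (𝓡 m) κ.symm (κ x) u : TangentSpace (𝓡 m) x)) := by
      rintro q rfl; rfl
    refine (h0 (κ.symm (κ x)) (κ.left_inv (hW₁s hx.1))).trans ?_
    rw [Bundle.Trivialization.continuousLinearMapAt_apply,
      Bundle.Trivialization.linearMapAt_apply, if_pos (hW₂s hx.2).1]
    exact congrArg (fun v => fibreCoord x₀ (a.cov σ x v)) (hYx x hx u).symm
  have hgk : ∀ x ∈ W, ∀ u, (fun y => A y u) =ᶠ[𝓝 (κ x)] fun y => g u (κ.symm y) := by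
    intro x hx u
    have hc : ContinuousAt κ.symm (κ x) := continuousAt_extChartAt_symm' (hW₁s hx.1)
    have hm : W ∈ 𝓝 (κ.symm (κ x)) := by
      rw [κ.left_inv (hW₁s hx.1)]
      exact hW.mem_nhds hx
    filter_upwards [hc hm, (isOpen_extChartAt_target x₀).mem_nhds (κ.map_source (hW₁s hx.1))]
      with y hy hyt
    have h := hAg _ hy u
    rwa [κ.right_inv hyt] at h
  have hsymm : ∀ x ∈ W, ContMDiffAt (𝓡 m) (𝓡 m) ∞ κ.symm (κ x) := fun x hx =>
    (contMDiffOn_extChartAt_symm x₀).contMDiffAt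
      ((isOpen_extChartAt_target x₀).mem_nhds (κ.map_source (hW₁s hx.1)))
  have hAu : ∀ x ∈ W, ∀ u, ContDiffAt ℝ ∞ (fun y => A y u) (κ x) := fun x hx u => by
    refine ContDiffAt.congr_of_eventuallyEq ?_ (hgk x hx u)
    rw [← contMDiffAt_iff_contDiffAt]
    refine ContMDiffAt.comp (g := g u) (κ x) ?_ (hsymm x hx)
    rw [κ.left_inv (hW₁s hx.1)]
    exact hg u x hx
  have hA : ∀ x ∈ W, ContDiffAt ℝ ∞ A (κ x) := fun x hx => by
    have ho : IsOpen (κ.target ∩ κ.symm ⁻¹' W) :=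
      (continuousOn_extChartAt_symm x₀).isOpen_inter_preimage (isOpen_extChartAt_target x₀) hW
    have hAo : ContDiffOn ℝ ∞ A (κ.target ∩ κ.symm ⁻¹' W) := by
      refine contDiffOn_clm_apply.2 fun u y hy => ?_
      have h := hAu (κ.symm y) hy.2 u
      rw [κ.right_inv hy.1] at h
      exact h.contDiffWithinAt
    refine hAo.contDiffAt (ho.mem_nhds ⟨κ.map_source (hW₁s hx.1), ?_⟩)
    rw [mem_preimage, κ.left_inv (hW₁s hx.1)]
    exact hx
  refine ⟨σ, W, A, hσ, hW, ⟨hxW₁, hxW₂⟩, fun x hx => hW₁s hx.1, fun x hx h0 => ?_, hA, ?_, ?_⟩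
  · have h2 := (hW₂s hx.2).2
    rw [h0, fibreCoord_zero (hW₂s hx.2).1] at h2
    exact zero_ne_one h2
  · intro x hx v
    refine Eq.trans ?_ (congrArg (· • σ x) (hAg x hx _).symm)
    refine (hcoord x hx _).trans ?_
    exact congrArg (fun w => fibreCoord x₀ (a.cov σ x w) • σ x) (hYv x hx v).symm
  · intro x hx v w
    set u := mfderiv (𝓡 m) (𝓡 m) κ x v with hu
    set u' := mfderiv (𝓡 m) (𝓡 m) κ x w with hu'
    have hd : ∀ (u : EuclideanSpace ℝ (Fin m)) (v : TangentSpace (𝓡 m) x),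
        fderiv ℝ A (κ x) (mfderiv (𝓡 m) (𝓡 m) κ x v) u = complexDeriv (g u) x v := fun u v => by
      have h1 : fderiv ℝ (fun y => A y u) (κ x) (mfderiv (𝓡 m) (𝓡 m) κ x v) =
          fderiv ℝ A (κ x) (mfderiv (𝓡 m) (𝓡 m) κ x v) u := by
        have := ((hA x hx).differentiableAt (by simp)).hasFDerivAt.clm_apply
          (hasFDerivAt_const u (κ x))
        refine (DFunLike.congr_fun this.fderiv _).trans ?_
        exact (congrArg (· + _) (map_zero (A (κ x)))).trans (zero_add _)
      refine h1.symm.trans ?_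
      have h2 : (fun y => A (κ y) u) =ᶠ[𝓝 x] g u := by
        filter_upwards [hW.mem_nhds hx] with y hy using hAg y hy u
      have h3 := mfderiv_comp_apply (I := 𝓡 m) (I' := 𝓡 m) (I'' := 𝓘(ℝ, ℂ)) x
        (g := fun y => A y u) (f := κ)
        (((hAu x hx u).differentiableAt (by simp)).mdifferentiableAt)
        ((contMDiffAt_extChartAt' (n := ∞)
          (by have := hW₁s hx.1; rwa [extChartAt_source] at this)).mdifferentiableAt (by simp)) v
      rw [mfderiv_eq_fderiv] at h3
      refine h3.symm.trans ?_
      exact DFunLike.congr_fun (h2.mfderiv_eq (I := 𝓡 m) (I' := 𝓘(ℝ, ℂ))) v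
    have hne : σ x ≠ 0 := fun h0 => by
      have h2 := (hW₂s hx.2).2
      rw [h0, fibreCoord_zero (hW₂s hx.2).1] at h2
      exact zero_ne_one h2
    have hev : ∀ u, ∀ᶠ y in 𝓝 x, fieldComponents x₀ (Y u) y = u := fun u => by
      filter_upwards [hW.mem_nhds hx] with y hy using hYu u y hy.1
    have hcg : ∀ u, ∀ᶠ y in 𝓝 x, a.cov σ y (Y u y) = g u y • σ y := fun u => by
      filter_upwards [hW.mem_nhds hx] with y hy using hcoord y hy _
    have h := ha.complexDeriv_sub hσ (hY u) (hY u') hne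
      (mlieBracket_eq_zero (hW₁s hx.1) (hev u) (hev u')) (hg u x hx) (hg u' x hx) (hcg u) (hcg u')
    rw [hYv x hx v, hYv x hx w] at h
    exact (congrArg₂ (· - ·) (hd u' v) (hd u w)).trans h

end ConnectionForm

/-- The exterior derivative of the pullback of a complex `1`-form. -/
lemma fderiv_pullback_oneForm_sub {E V : Type*} [NormedAddCommGroup E] [NormedSpace ℝ E]
    [NormedAddCommGroup V] [NormedSpace ℝ V] {A : E → E →L[ℝ] ℂ} {f : V → E} {q : V}
    (hA : DifferentiableAt ℝ A (f q)) (hf : ContDiffAt ℝ ∞ f q) (a b : V) :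
    fderiv ℝ (fun q => (A (f q)).comp (fderiv ℝ f q)) q a b -
      fderiv ℝ (fun q => (A (f q)).comp (fderiv ℝ f q)) q b a =
    fderiv ℝ A (f q) (fderiv ℝ f q a) (fderiv ℝ f q b) -
      fderiv ℝ A (f q) (fderiv ℝ f q b) (fderiv ℝ f q a) := by
  have hf' : DifferentiableAt ℝ (fderiv ℝ f) q :=
    (hf.fderiv_right (m := ∞) (by simp)).differentiableAt (by simp)
  have hAf := hA.hasFDerivAt.comp q (hf.differentiableAt (by simp)).hasFDerivAt
  have h := (hAf.clm_comp hf'.hasFDerivAt).fderiv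
  have h2 : (2 : WithTop ℕ∞) ≤ ∞ := by
    change ((2 : ℕ∞) : WithTop ℕ∞) ≤ _
    exact_mod_cast le_top
  -- The second derivatives of `f` enter symmetrically and drop out of the antisymmetrization,
  -- leaving the pullback of dA.
  have hs : IsSymmSndFDerivAt ℝ f q :=
    hf.isSymmSndFDerivAt (by rw [minSmoothness_of_isRCLikeNormedField]; exact h2)
  have hab : ∀ a b, fderiv ℝ (fun q => (A (f q)).comp (fderiv ℝ f q)) q a b =
      A (f q) (fderiv ℝ (fderiv ℝ f) q a b) +
        fderiv ℝ A (f q) (fderiv ℝ f q a) (fderiv ℝ f q b) := fun a b => by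
    refine (DFunLike.congr_fun (DFunLike.congr_fun h a) b).trans ?_
    simp
  rw [hab, hab, hs.eq a b]
  ring

/-! ### Local sections with prescribed covariant derivative -/

section LocalSections

variable {m : ℕ} {X : Type*} [TopologicalSpace X] [ChartedSpace (EuclideanSpace ℝ (Fin m)) X]
  [IsManifold (𝓡 m) ∞ X]
  {L : X → Type*} [TopologicalSpace (Bundle.TotalSpace ℂ L)]
  [∀ x, AddCommGroup (L x)] [∀ x, Module ℂ (L x)] [∀ x, TopologicalSpace (L x)]
  [∀ x, IsTopologicalAddGroup (L x)] [∀ x, ContinuousSMul ℝ (L x)] [FiberBundle ℂ L]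
  [VectorBundle ℂ ℂ L] [VectorBundle ℝ ℂ L] [ContMDiffVectorBundle ∞ ℂ L (𝓡 m)]
  {a : HermitianConnection m L}
  {V : Type*} [NormedAddCommGroup V] [NormedSpace ℝ V]

/-- Along a map `F`, there are local sections with prescribed covariant logarithmic derivative `θ`
as soon as `dθ` is the pullback of the curvature. -/
lemma exists_local_section [T2Space X] {Ω : DForm m X 2} (ha : a.HasCurvature Ω)
    {F : V → X} (hF : ContMDiff 𝓘(ℝ, V) (𝓡 m) ∞ F) {θ : V → V →L[ℝ] ℂ} (hθ : ContDiff ℝ ∞ θ)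
    (hdθ : ∀ q v w, fderiv ℝ θ q v w - fderiv ℝ θ q w v = 2 * Real.pi * Complex.I *
      (Ω (F q) ![mfderiv 𝓘(ℝ, V) (𝓡 m) F q v, mfderiv 𝓘(ℝ, V) (𝓡 m) F q w] : ℝ)) (p : V) :
    ∃ (U : Set V) (c : V → Bundle.TotalSpace ℂ L), IsOpen U ∧ p ∈ U ∧ (∀ q, (c q).1 = F q) ∧
      ∀ q ∈ U, (c q).2 ≠ 0 ∧ HasCov a c q (θ q) := by
  obtain ⟨σ, W, A, hσ, hW, hpW, hWs, hne, hA, hcov, hdA⟩ :=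
    exists_connection_form (L := L) ha (F p)
  set κ := extChartAt (𝓡 m) (F p) with hκ
  have hU : IsOpen (F ⁻¹' W) := hW.preimage hF.continuous
  set f : V → EuclideanSpace ℝ (Fin m) := fun q => κ (F q) with hf
  have hfs : ∀ q ∈ F ⁻¹' W, ContDiffAt ℝ ∞ f q := fun q hq =>
    contDiffAt_extChartAt_comp (hF q) (hWs hq)
  have hfd : ∀ q ∈ F ⁻¹' W, ∀ v, fderiv ℝ f q v =
      mfderiv (𝓡 m) (𝓡 m) κ (F q) (mfderiv 𝓘(ℝ, V) (𝓡 m) F q v) := fun q hq v =>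
    fderiv_extChartAt_comp ((hF q).mdifferentiableAt (by simp)) (hWs hq) v
  set B : V → V →L[ℝ] ℂ := fun q => (A (f q)).comp (fderiv ℝ f q) with hB
  have hBs : ∀ q ∈ F ⁻¹' W, ContDiffAt ℝ ∞ B q := fun q hq =>
    ((hA (F q) hq).comp q (hfs q hq)).clm_comp ((hfs q hq).fderiv_right (m := ∞) (by simp))
  have hηs : ∀ q ∈ F ⁻¹' W, ContDiffAt ℝ ∞ (fun q => θ q - B q) q := fun q hq =>
    hθ.contDiffAt.sub (hBs q hq)
  obtain ⟨r, hr, hrU⟩ := Metric.isOpen_iff.1 hU p hpW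
  have hηd : DifferentiableOn ℝ (fun q => θ q - B q) (Metric.ball p r) := fun q hq =>
    ((hηs q (hrU hq)).differentiableAt (by simp)).differentiableWithinAt
  -- Seek the section as e^u σ ∘ F: this requires du = θ - F^*A, where A is the connection form. The
  -- right-hand side is closed because dθ and d(F^*A) are both the pullback of the curvature.
  obtain ⟨u, hu⟩ := (convex_ball p r).exists_forall_hasFDerivAt_of_fderiv_symmetric
    Metric.isOpen_ball hηd (by
      intro q hq v w
      have hqW := hrU hq
      have h1 := hdθ q v w
      have h2 := fderiv_pullback_oneForm_sub (A := A) (f := f) (q := q)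
        ((hA (F q) hqW).differentiableAt (by simp)) (hfs q hqW) v w
      have h3 := hdA (F q) hqW (mfderiv 𝓘(ℝ, V) (𝓡 m) F q v) (mfderiv 𝓘(ℝ, V) (𝓡 m) F q w)
      rw [hfd q hqW, hfd q hqW] at h2
      have h4 := h2.trans h3
      rw [← h1] at h4
      have h5 : fderiv ℝ (fun q => θ q - B q) q = fderiv ℝ θ q - fderiv ℝ B q :=
        fderiv_fun_sub (hθ.contDiffAt.differentiableAt (by simp))
          ((hBs q hqW).differentiableAt (by simp))
      rw [h5]
      change fderiv ℝ θ q v w - fderiv ℝ B q v w = fderiv ℝ θ q w v - fderiv ℝ B q w v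
      change fderiv ℝ B q v w - fderiv ℝ B q w v = _ at h4
      linear_combination -h4)
  have hus : ContDiffOn ℝ ∞ u (Metric.ball p r) := by
    rw [contDiffOn_infty_iff_fderiv_of_isOpen Metric.isOpen_ball]
    exact ⟨fun y hy => (hu y hy).differentiableAt.differentiableWithinAt,
      ContDiffOn.congr (fun y hy => (hηs y (hrU hy)).contDiffWithinAt)
        fun y hy => (hu y hy).fderiv⟩
  refine ⟨Metric.ball p r, fun q => ⟨F q, Complex.exp (u q) • σ (F q)⟩, Metric.isOpen_ball,
    Metric.mem_ball_self hr, fun q => rfl, fun q hq => ⟨fun h0 => ?_, ?_⟩⟩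
  · exact Complex.exp_ne_zero _ (smul_fibre_eq_zero (hne _ (hrU hq)) h0)
  · refine ⟨hF q, σ, fun q => Complex.exp (u q), hσ, hne _ (hrU hq), ?_,
      Eventually.of_forall fun q => rfl, fun w => ?_⟩
    · exact (Complex.contDiff_exp (𝕜 := ℝ)).contDiffAt.comp q
        (hus.contDiffAt (Metric.isOpen_ball.mem_nhds hq))
    · have h1 : fderiv ℝ (fun q => Complex.exp (u q)) q w =
          Complex.exp (u q) * (θ q w - B q w) := by
        rw [(hu q hq).cexp.fderiv]
        rfl
      have h2 : a.cov σ (F q) (mfderiv 𝓘(ℝ, V) (𝓡 m) F q w) = B q w • σ (F q) := by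
        refine (hcov (F q) (hrU hq) _).trans ?_
        rw [hB]
        exact congrArg (fun v => A (f q) v • σ (F q)) (hfd q (hrU hq) w).symm
      refine (congrArg₂ (fun x l => x • σ (F q) + Complex.exp (u q) • l) h1 h2).trans ?_
      change _ = θ q w • Complex.exp (u q) • σ (F q)
      rw [smul_smul, smul_smul, ← add_smul]
      ring_nf

end LocalSections

lemma alt_two_linearCombination {E : Type*} [NormedAddCommGroup E] [NormedSpace ℝ E]
    (f : E [⋀^Fin 2]→L[ℝ] ℝ) (u v : E) (x y x' y' : ℝ) :
    f ![x • u + y • v, x' • u + y' • v] = (x * y' - y * x') * f ![u, v] := by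
  have h : ∀ (w : E) (s t : ℝ), f ![s • u + t • v, w] = s * f ![u, w] + t * f ![v, w] :=
    fun w s t => by
      simp only [← contractTwo_apply, map_add, map_smul, ContinuousAlternatingMap.add_apply,
        ContinuousAlternatingMap.smul_apply, smul_eq_mul]
  have h' : ∀ (w : E) (s t : ℝ), f ![w, s • u + t • v] = s * f ![w, u] + t * f ![w, v] :=
    fun w s t => by
      rw [alt_two_swap, h, alt_two_swap f u, alt_two_swap f v]
      ring
  rw [h, h', h', alt_two_self, alt_two_self, alt_two_swap f v u]
  ring

/-! ### Holonomy of a family of loops -/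

section Holonomy

variable {m : ℕ} {X : Type*} [TopologicalSpace X] [ChartedSpace (EuclideanSpace ℝ (Fin m)) X]
  [IsManifold (𝓡 m) ∞ X]
  {L : X → Type*} [TopologicalSpace (Bundle.TotalSpace ℂ L)]
  [∀ x, AddCommGroup (L x)] [∀ x, Module ℂ (L x)] [∀ x, TopologicalSpace (L x)]
  [∀ x, IsTopologicalAddGroup (L x)] [∀ x, ContinuousSMul ℝ (L x)] [FiberBundle ℂ L]
  [VectorBundle ℂ ℂ L] [VectorBundle ℝ ℂ L] [ContMDiffVectorBundle ∞ ℂ L (𝓡 m)]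
  {a : HermitianConnection m L}

lemma exists_eq_smul_totalSpace {l l' : Bundle.TotalSpace ℂ L} (h : l'.1 = l.1) (hl : l.2 ≠ 0) :
    ∃ r : ℂ, l' = ⟨l.1, r • l.2⟩ := by
  obtain ⟨x, v⟩ := l
  obtain ⟨y, v'⟩ := l'
  change y = x at h
  subst h
  obtain ⟨r, hr⟩ := exists_eq_smul hl v'
  exact ⟨r, congrArg _ hr⟩

/-- Sections with the same covariant logarithmic derivative are proportional. -/
lemma HasCov.exists_const_ratio {V : Type*} [NormedAddCommGroup V] [NormedSpace ℝ V]
    {U : Set V} (hU : IsOpen U) (hU' : IsPreconnected U) {c c' : V → Bundle.TotalSpace ℂ L}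
    {β : V → V → ℂ} (hc : ∀ q ∈ U, HasCov a c q (β q)) (hc' : ∀ q ∈ U, HasCov a c' q (β q))
    (hne : ∀ q ∈ U, (c q).2 ≠ 0) (hbase : ∀ q ∈ U, (c' q).1 = (c q).1) :
    ∃ r : ℂ, ∀ q ∈ U, c' q = ⟨(c q).1, r • (c q).2⟩ := by
  classical
  choose! r hr using fun q (hq : q ∈ U) => exists_eq_smul_totalSpace (hbase q hq) (hne q hq)
  have hd := fun q (hq : q ∈ U) => (hc q hq).ratio (hc' q hq) (hne q hq) (r := r) (by
    filter_upwards [hU.mem_nhds hq] with y hy using hr y hy)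
  obtain ⟨z, hz⟩ := hU.exists_is_const_of_fderiv_eq_zero hU'
    (fun q hq => (hd q hq).1.differentiableWithinAt) (fun q hq => by
      ext w
      rw [(hd q hq).2 w, sub_self, zero_mul]
      rfl)
  exact ⟨z, fun q hq => by rw [hr q hq, hz q hq]⟩

/-- Extending a section over a longer strip. -/
lemma exists_section_glue {T : Set ℝ} (hT : IsOpen T) (hTc : Convex ℝ T) {t₀ : ℝ} (ht₀ : t₀ ∈ T)
    {x x' y y' : ℝ} (hxx' : x ≤ x') (hx'y : x' < y) (hyy' : y ≤ y')
    {F : ℝ × ℝ → X} {c c' : ℝ × ℝ → Bundle.TotalSpace ℂ L} {β : ℝ × ℝ → ℝ × ℝ → ℂ}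
    (hb : ∀ q, (c q).1 = F q) (hb' : ∀ q, (c' q).1 = F q)
    (hc : ∀ q ∈ T ×ˢ Ioo x y, (c q).2 ≠ 0 ∧ HasCov a c q (β q))
    (hc' : ∀ q ∈ T ×ˢ Ioo x' y', (c' q).2 ≠ 0 ∧ HasCov a c' q (β q)) :
    ∃ C : ℝ × ℝ → Bundle.TotalSpace ℂ L, (∀ q, (C q).1 = F q) ∧
      ∀ q ∈ T ×ˢ Ioo x y', (C q).2 ≠ 0 ∧ HasCov a C q (β q) := by
  classical
  have hsub : T ×ˢ Ioo x' y ⊆ T ×ˢ Ioo x y := prod_mono subset_rfl (Ioo_subset_Ioo_left hxx')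
  have hsub' : T ×ˢ Ioo x' y ⊆ T ×ˢ Ioo x' y' :=
    prod_mono subset_rfl (Ioo_subset_Ioo_right hyy')
  -- On the connected overlap the two sections solve the same equation and differ by a nonzero
  -- constant; rescaling c' makes them agree, so the switch at the midpoint is invisible.
  obtain ⟨r, hr⟩ := HasCov.exists_const_ratio (hT.prod isOpen_Ioo)
    (hTc.prod (convex_Ioo x' y)).isPreconnected (fun q hq => (hc' q (hsub' hq)).2)
    (fun q hq => (hc q (hsub hq)).2) (fun q hq => (hc' q (hsub' hq)).1)
    (fun q hq => (hb q).trans (hb' q).symm)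
  have hr0 : r ≠ 0 := by
    rintro rfl
    have hq : (t₀, (x' + y) / 2) ∈ T ×ˢ Ioo x' y := ⟨ht₀, by constructor <;> linarith⟩
    refine (hc _ (hsub hq)).1 ?_
    rw [hr _ hq]
    exact zero_smul ℂ _
  let C : ℝ × ℝ → Bundle.TotalSpace ℂ L := fun q =>
    if q.2 < (x' + y) / 2 then c q else ⟨(c' q).1, r • (c' q).2⟩
  have hC : ∀ q ∈ T ×ˢ Ioo x y, C =ᶠ[𝓝 q] c := fun q hq => by
    filter_upwards [(hT.prod isOpen_Ioo).mem_nhds hq] with p hp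
    by_cases h : p.2 < (x' + y) / 2
    · exact if_pos h
    · refine (if_neg h).trans (hr p ⟨hp.1, ?_, hp.2.2⟩).symm
      push Not at h
      linarith
  have hC' : ∀ q ∈ T ×ˢ Ioo x' y', C =ᶠ[𝓝 q] fun q => ⟨(c' q).1, r • (c' q).2⟩ := fun q hq => by
    filter_upwards [(hT.prod isOpen_Ioo).mem_nhds hq] with p hp
    by_cases h : p.2 < (x' + y) / 2
    · exact (if_pos h).trans (hr p ⟨hp.1, hp.2.1, by linarith⟩)
    · exact if_neg h
  refine ⟨C, fun q => ?_, fun q hq => ?_⟩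
  · by_cases h : q.2 < (x' + y) / 2
    · exact (congrArg (fun l : Bundle.TotalSpace ℂ L => l.1) (if_pos h)).trans (hb q)
    · exact (congrArg (fun l : Bundle.TotalSpace ℂ L => l.1) (if_neg h)).trans (hb' q)
  · by_cases h : q.2 < y
    · have hm : q ∈ T ×ˢ Ioo x y := ⟨hq.1, hq.2.1, h⟩
      refine ⟨?_, (hc q hm).2.congr (hC q hm).symm⟩
      rw [(hC q hm).self_of_nhds]
      exact (hc q hm).1
    · have hm : q ∈ T ×ˢ Ioo x' y' := ⟨hq.1, by push Not at h; linarith, hq.2.2⟩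
      refine ⟨?_, ((hc' q hm).2.const_smul r).congr (hC' q hm).symm⟩
      rw [(hC' q hm).self_of_nhds]
      intro h0
      exact hr0 (smul_fibre_eq_zero (hc' q hm).1 h0)

variable [T2Space X] {Ω : DForm m X 2} {F : ℝ × ℝ → X} {ψ : ℝ × ℝ → ℝ}

/-- Local sections along a family of curves: `∇_s c = 0` and `∇_t c = iψ c`. -/
lemma exists_local_section_plane (ha : a.HasCurvature Ω)
    (hF : ContMDiff 𝓘(ℝ, ℝ × ℝ) (𝓡 m) ∞ F) (hψ : ContDiff ℝ ∞ ψ)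
    (hψ' : ∀ q, fderiv ℝ ψ q (0, 1) = -(2 * Real.pi * Ω (F q)
      ![mfderiv 𝓘(ℝ, ℝ × ℝ) (𝓡 m) F q ((1 : ℝ), (0 : ℝ)),
        mfderiv 𝓘(ℝ, ℝ × ℝ) (𝓡 m) F q ((0 : ℝ), (1 : ℝ))])) (p : ℝ × ℝ) :
    ∃ (U : Set (ℝ × ℝ)) (c : ℝ × ℝ → Bundle.TotalSpace ℂ L), IsOpen U ∧ p ∈ U ∧
      (∀ q, (c q).1 = F q) ∧ ∀ q ∈ U, (c q).2 ≠ 0 ∧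
        HasCov a c q (fun w => Complex.I * ψ q * w.1) := by
  -- The form θ = iψ dt has dθ = -i ∂_sψ dt ∧ ds, which is the pullback of 2πi Ω by the choice of ψ.
  let ℓ : ℝ × ℝ →L[ℝ] ℂ := Complex.I • Complex.ofRealCLM.comp (ContinuousLinearMap.fst ℝ ℝ ℝ)
  have hℓ : ∀ w, ℓ w = Complex.I * w.1 := fun w => rfl
  have hθ : ContDiff ℝ ∞ (fun q => ψ q • ℓ) := hψ.smul contDiff_const
  have hθ' : ∀ q v w, fderiv ℝ (fun q => ψ q • ℓ) q v w = fderiv ℝ ψ q v * (Complex.I * w.1) :=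
    fun q v w => by
      rw [((hψ.differentiable (by simp) q).hasFDerivAt.smul_const ℓ).fderiv]
      change fderiv ℝ ψ q v • ℓ w = _
      rw [hℓ, Complex.real_smul]
  obtain ⟨U, c, hU, hp, hb, hc⟩ := exists_local_section (L := L) ha hF hθ (by
    intro q v w
    rw [hθ', hθ']
    have hdecomp : ∀ v : ℝ × ℝ, v = v.1 • ((1 : ℝ), (0 : ℝ)) + v.2 • ((0 : ℝ), (1 : ℝ)) :=
      fun v => by ext <;> simp
    set e₁ := mfderiv 𝓘(ℝ, ℝ × ℝ) (𝓡 m) F q ((1 : ℝ), (0 : ℝ)) with he₁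
    set e₂ := mfderiv 𝓘(ℝ, ℝ × ℝ) (𝓡 m) F q ((0 : ℝ), (1 : ℝ)) with he₂
    have hm : ∀ v : ℝ × ℝ, mfderiv 𝓘(ℝ, ℝ × ℝ) (𝓡 m) F q v = v.1 • e₁ + v.2 • e₂ := fun v => by
      have h1 := congrArg (mfderiv 𝓘(ℝ, ℝ × ℝ) (𝓡 m) F q) (hdecomp v)
      refine h1.trans ?_
      refine (map_add (mfderiv 𝓘(ℝ, ℝ × ℝ) (𝓡 m) F q) _ _).trans ?_
      exact congrArg₂ (· + ·) (map_smul (mfderiv 𝓘(ℝ, ℝ × ℝ) (𝓡 m) F q) _ _)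
        (map_smul (mfderiv 𝓘(ℝ, ℝ × ℝ) (𝓡 m) F q) _ _)
    have hψv : ∀ v : ℝ × ℝ, fderiv ℝ ψ q v =
        v.1 * fderiv ℝ ψ q (1, 0) + v.2 * fderiv ℝ ψ q (0, 1) := fun v => by
      conv_lhs => rw [hdecomp v]
      rw [map_add, map_smul, map_smul]
      rfl
    have hΩ : Ω (F q) ![mfderiv 𝓘(ℝ, ℝ × ℝ) (𝓡 m) F q v, mfderiv 𝓘(ℝ, ℝ × ℝ) (𝓡 m) F q w] =
        (v.1 * w.2 - v.2 * w.1) * Ω (F q) ![e₁, e₂] :=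
      (congrArg₂ (fun x y => Ω (F q) ![x, y]) (hm v) (hm w)).trans
        (alt_two_linearCombination (E := EuclideanSpace ℝ (Fin m)) (Ω (F q)) e₁ e₂ _ _ _ _)
    rw [hΩ, hψv v, hψv w, hψ' q]
    push_cast
    ring) p
  refine ⟨U, c, hU, hp, hb, fun q hq => ⟨(hc q hq).1, ?_⟩⟩
  have h := (hc q hq).2
  have h2 : (fun w : ℝ × ℝ => Complex.I * ψ q * w.1) = ⇑(ψ q • ℓ) := by
    funext w
    change _ = ψ q • ℓ w
    rw [hℓ, Complex.real_smul]
    ring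
  rwa [h2]

/-- A section over the strip `s ∈ [0, 1]`. -/
lemma exists_section_strip (ha : a.HasCurvature Ω)
    (hF : ContMDiff 𝓘(ℝ, ℝ × ℝ) (𝓡 m) ∞ F) (hψ : ContDiff ℝ ∞ ψ)
    (hψ' : ∀ q, fderiv ℝ ψ q (0, 1) = -(2 * Real.pi * Ω (F q)
      ![mfderiv 𝓘(ℝ, ℝ × ℝ) (𝓡 m) F q ((1 : ℝ), (0 : ℝ)),
        mfderiv 𝓘(ℝ, ℝ × ℝ) (𝓡 m) F q ((0 : ℝ), (1 : ℝ))])) (t₀ : ℝ) :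
    ∃ (c : ℝ × ℝ → Bundle.TotalSpace ℂ L), ∃ δ > 0, (∀ q, (c q).1 = F q) ∧
      ∀ q ∈ Ioo (t₀ - δ) (t₀ + δ) ×ˢ Ioo (-δ) (1 + δ), (c q).2 ≠ 0 ∧
        HasCov a c q (fun w => Complex.I * ψ q * w.1) := by
  let P : ℝ → ℝ → Prop := fun s ε => ∃ c : ℝ × ℝ → Bundle.TotalSpace ℂ L, (∀ q, (c q).1 = F q) ∧
    ∀ q ∈ Ioo (t₀ - ε) (t₀ + ε) ×ˢ Ioo (s - ε) (s + ε), (c q).2 ≠ 0 ∧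
      HasCov a c q (fun w => Complex.I * ψ q * w.1)
  -- One size of square serves for all centres (t₀, s) with 0 ≤ s ≤ 1. The strip is then covered by
  -- squares whose centres advance by ε/2, so that consecutive ones overlap.
  obtain ⟨ε, hε, hP⟩ : ∃ ε > 0, ∀ s ∈ Icc (0 : ℝ) 1, P s ε := by
    obtain ⟨ε, hε, h⟩ := exists_pos_forall_of_compact (K := Icc (0 : ℝ) 1) (Q := fun ε s => P s ε)
      (fun ε ε' s hle ⟨c, hb, hc⟩ => ⟨c, hb, fun q hq => hc q
        ⟨Ioo_subset_Ioo (by linarith) (by linarith) hq.1,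
          Ioo_subset_Ioo (by linarith) (by linarith) hq.2⟩⟩) fun s => by
        obtain ⟨U, c, hU, hp, hb, hc⟩ :=
          exists_local_section_plane (L := L) ha hF hψ hψ' (t₀, (s : ℝ))
        obtain ⟨r, hr, hrU⟩ := Metric.isOpen_iff.1 hU _ hp
        refine ⟨r / 2, by linarith, ?_⟩
        have hnear : ∀ᶠ s' : Icc (0 : ℝ) 1 in 𝓝 s, dist (s' : ℝ) s < r / 2 :=
          (continuous_subtype_val.tendsto s).eventually (Metric.ball_mem_nhds _ (by linarith))
        filter_upwards [hnear] with s' hs'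
        refine ⟨c, hb, fun q hq => hc q (hrU ?_)⟩
        rw [Real.dist_eq, abs_lt] at hs'
        rw [Metric.mem_ball, Prod.dist_eq, max_lt_iff, Real.dist_eq, Real.dist_eq, abs_lt, abs_lt]
        refine ⟨⟨?_, ?_⟩, ?_, ?_⟩
        · linarith [hq.1.1]
        · linarith [hq.1.2]
        · linarith [hq.2.1, hs'.1]
        · linarith [hq.2.2, hs'.2]
    exact ⟨ε, hε, fun s hs => h ⟨s, hs⟩⟩
  have key : ∀ n : ℕ, n * (ε / 2) ≤ 1 → ∃ c : ℝ × ℝ → Bundle.TotalSpace ℂ L,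
      (∀ q, (c q).1 = F q) ∧
      ∀ q ∈ Ioo (t₀ - ε) (t₀ + ε) ×ˢ Ioo (-ε) (n * (ε / 2) + ε), (c q).2 ≠ 0 ∧
        HasCov a c q (fun w => Complex.I * ψ q * w.1) := by
    intro n
    induction n with
    | zero =>
      intro _
      have := hP 0 (by simp)
      simpa [P] using this
    | succ n ih =>
      intro hn
      push_cast at hn ⊢
      have hn0 : 0 ≤ (n : ℝ) * (ε / 2) := by positivity
      obtain ⟨c, hb, hc⟩ := ih (by linarith)
      obtain ⟨c', hb', hc'⟩ := hP ((n + 1) * (ε / 2)) ⟨by positivity, hn⟩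
      exact exists_section_glue (t₀ := t₀) isOpen_Ioo (convex_Ioo _ _)
        (by constructor <;> linarith)
        (by linarith) (by linarith) (by linarith) hb hb' hc hc'
  -- The last centre is at most 1, as `hP` demands, and within ε/2 of it, so the domain reaches
  -- beyond 1 + ε/2.
  obtain ⟨n, hn, hn'⟩ : ∃ n : ℕ, n * (ε / 2) ≤ 1 ∧ 1 < (n + 1) * (ε / 2) := by
    have hε2 : 0 < ε / 2 := by linarith
    refine ⟨⌊1 / (ε / 2)⌋₊, ?_, ?_⟩
    · exact (le_div_iff₀ hε2).1 (Nat.floor_le (by positivity))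
    · exact (div_lt_iff₀ hε2).1 (Nat.lt_floor_add_one _)
  obtain ⟨c, hb, hc⟩ := key n hn
  refine ⟨c, ε / 2, by linarith, hb, fun q hq => hc q ⟨⟨?_, ?_⟩, ?_, ?_⟩⟩
  · linarith [hq.1.1]
  · linarith [hq.1.2]
  · linarith [hq.2.1]
  · linarith [hq.2.2]

/-- The holonomy of the curves `F (t, ·)`, when these are loops. -/
theorem exists_holonomy (ha : a.HasCurvature Ω)
    (hF : ContMDiff 𝓘(ℝ, ℝ × ℝ) (𝓡 m) ∞ F) (hψ : ContDiff ℝ ∞ ψ)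
    (hψ' : ∀ q, fderiv ℝ ψ q (0, 1) = -(2 * Real.pi * Ω (F q)
      ![mfderiv 𝓘(ℝ, ℝ × ℝ) (𝓡 m) F q ((1 : ℝ), (0 : ℝ)),
        mfderiv 𝓘(ℝ, ℝ × ℝ) (𝓡 m) F q ((0 : ℝ), (1 : ℝ))]))
    (hloop : ∀ t, F (t, 1) = F (t, 0)) (t₀ : ℝ) :
    ∃ δ > 0, ∃ (w : ℝ → ℂ) (C : ℝ → ℝ → Bundle.TotalSpace ℂ L), ∀ t ∈ Ioo (t₀ - δ) (t₀ + δ),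
      HasDerivAt w (Complex.I * (ψ (t, 1) - ψ (t, 0)) * w t) t ∧ w t ≠ 0 ∧
      a.IsParallel (C t) ∧ (∀ s, (C t s).1 = F (t, Real.smoothTransition s)) ∧
      (∀ s, (C t s).2 ≠ 0) ∧ C t 1 = ⟨(C t 0).1, w t • (C t 0).2⟩ := by
  classical
  obtain ⟨c, δ, hδ, hb, hc⟩ := exists_section_strip (L := L) ha hF hψ hψ' t₀
  have hm : ∀ t ∈ Ioo (t₀ - δ) (t₀ + δ), ∀ s ∈ Icc (0 : ℝ) 1,
      (t, s) ∈ Ioo (t₀ - δ) (t₀ + δ) ×ˢ Ioo (-δ) (1 + δ) := fun t ht s hs =>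
    ⟨ht, by linarith [hs.1], by linarith [hs.2]⟩
  have h0 : (0 : ℝ) ∈ Icc (0 : ℝ) 1 := by simp
  have h1 : (1 : ℝ) ∈ Icc (0 : ℝ) 1 := by simp
  -- The edges s = 0 and s = 1 lie over the same points. Their ratio is the holonomy, and ∇_t c = iψ
  -- c on both edges determines its logarithmic derivative.
  choose! w hw using fun t (ht : t ∈ Ioo (t₀ - δ) (t₀ + δ)) =>
    exists_eq_smul_totalSpace (l := c (t, 0)) (l' := c (t, 1))
      ((hb _).trans ((hloop t).trans (hb _).symm)) (hc _ (hm t ht 0 h0)).1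
  -- Parallel curves are parametrized by all of ℝ, while c is controlled only near 0 ≤ s ≤ 1; the
  -- smooth transition stays in [0, 1] and stops at both ends.
  refine ⟨δ, hδ, w, fun t s => c (t, Real.smoothTransition s), fun t ht => ?_⟩
  have hcov : ∀ s ∈ Icc (0 : ℝ) 1, HasCov a (fun t => c (t, s)) t
      (fun τ => Complex.I * ψ (t, s) * τ) := fun s hs =>
    (hc _ (hm t ht s hs)).2.comp (g := fun t => (t, s))
      (contDiff_id.prodMk contDiff_const).contDiffAt (hasFDerivAt_prodMk_left t s)
  have hr := (hcov 0 h0).ratio (hcov 1 h1) (hc _ (hm t ht 0 h0)).1 (r := w) (by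
    filter_upwards [isOpen_Ioo.mem_nhds ht] with y hy using hw y hy)
  have hst : ∀ s, Real.smoothTransition s ∈ Icc (0 : ℝ) 1 := fun s =>
    ⟨Real.smoothTransition.nonneg s, Real.smoothTransition.le_one s⟩
  refine ⟨?_, ?_, ?_, fun s => hb _, fun s => (hc _ (hm t ht _ (hst s))).1, ?_⟩
  · have h := hr.1.hasDerivAt
    have h2 := hr.2 1
    rw [Complex.ofReal_one, mul_one, mul_one, ← mul_sub] at h2
    rwa [← fderiv_apply_one_eq_deriv, h2] at h
  · intro hw0
    refine (hc _ (hm t ht 1 h1)).1 ?_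
    rw [hw t ht, hw0]
    exact zero_smul ℂ _
  · refine isParallel_of_hasCov fun s => ?_
    have hsd : HasFDerivAt (fun s => (t, Real.smoothTransition s))
        ((0 : ℝ →L[ℝ] ℝ).prod (fderiv ℝ Real.smoothTransition s)) s :=
      (hasFDerivAt_const t s).prodMk
        ((Real.smoothTransition.contDiff (n := ⊤)).differentiable (by simp) s).hasFDerivAt
    have h := (hc _ (hm t ht _ (hst s))).2.comp (g := fun s => (t, Real.smoothTransition s))
      (contDiff_const.prodMk Real.smoothTransition.contDiff).contDiffAt hsd
    convert h using 1
    funext τ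
    simp
  · have := hw t ht
    change c (t, Real.smoothTransition 1) = ⟨(c (t, Real.smoothTransition 0)).1,
      w t • (c (t, Real.smoothTransition 0)).2⟩
    rw [Real.smoothTransition.zero, Real.smoothTransition.one]
    exact this

end Holonomy

/-! ### Closed forms without periods are exact -/

section Periods

variable {n : ℕ} {Λ : Type*} [TopologicalSpace Λ] [ChartedSpace (EuclideanSpace ℝ (Fin n)) Λ]
  [IsManifold (𝓡 n) ∞ Λ]

/-- Near `s`, the curve `lam` is smooth, and `p` is a primitive of the pullback of `α` at `s`. -/
def IsLiftAt (α : DForm n Λ 1) (lam : ℝ → Λ) (p : ℝ → ℝ) (s : ℝ) : Prop :=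
  ContMDiffAt 𝓘(ℝ, ℝ) (𝓡 n) ∞ lam s ∧
    HasDerivAt p (α (lam s) (fun _ => mfderiv 𝓘(ℝ, ℝ) (𝓡 n) lam s (1 : ℝ))) s

variable {α : DForm n Λ 1} {lam : ℝ → Λ} {p : ℝ → ℝ} {s : ℝ}

lemma IsLiftAt.congr {lam' : ℝ → Λ} {p' : ℝ → ℝ} (h : IsLiftAt α lam p s)
    (hl : lam' =ᶠ[𝓝 s] lam) (hp : p' =ᶠ[𝓝 s] p) : IsLiftAt α lam' p' s := by
  refine ⟨h.1.congr_of_eventuallyEq hl, ?_⟩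
  have h1 := h.2.congr_of_eventuallyEq hp
  rwa [← hl.mfderiv_eq, ← hl.self_of_nhds] at h1

lemma IsLiftAt.comp {g : ℝ → ℝ} {g' : ℝ} (h : IsLiftAt α lam p (g s)) (hg : ContDiffAt ℝ ∞ g s)
    (hg' : HasDerivAt g g' s) : IsLiftAt α (fun s => lam (g s)) (fun s => p (g s)) s := by
  refine ⟨ContMDiffAt.comp s h.1 hg.contMDiffAt, ?_⟩
  have h1 := h.2.comp s hg'
  have h2 := mfderiv_comp_of_hasFDerivAt (F := lam) (h.1.mdifferentiableAt (by simp))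
    hg'.hasFDerivAt (1 : ℝ)
  have h3 : (ContinuousLinearMap.toSpanSingleton ℝ g') (1 : ℝ) = g' • (1 : ℝ) := by simp
  have h4 := h2.trans ((congrArg (mfderiv 𝓘(ℝ, ℝ) (𝓡 n) lam (g s)) h3).trans
    (map_smul (mfderiv 𝓘(ℝ, ℝ) (𝓡 n) lam (g s)) g' (1 : ℝ)))
  have h5 : α (lam (g s)) (fun _ => mfderiv 𝓘(ℝ, ℝ) (𝓡 n) (fun s => lam (g s)) s (1 : ℝ)) =
      α (lam (g s)) (fun _ => mfderiv 𝓘(ℝ, ℝ) (𝓡 n) lam (g s) (1 : ℝ)) * g' := by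
    refine (congrArg (fun v => α (lam (g s)) (fun _ => v)) h4).trans ?_
    refine (map_smul (altOne (EuclideanSpace ℝ (Fin n)) (α (lam (g s)))) g' _).trans ?_
    exact mul_comm _ _
  rw [h5]
  exact h1

lemma IsPrimitiveOn.isLiftAt {f : Λ → ℝ} {W : Set Λ} (hf : IsPrimitiveOn α f W) (hW : IsOpen W)
    (hl : ContMDiffAt 𝓘(ℝ, ℝ) (𝓡 n) ∞ lam s) (hs : lam s ∈ W) :
    IsLiftAt α lam (fun s => f (lam s)) s := by
  have hfd : MDifferentiableAt (𝓡 n) 𝓘(ℝ, ℝ) f (lam s) :=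
    (hf.1.contMDiffAt (hW.mem_nhds hs)).mdifferentiableAt (by simp)
  have hld : MDifferentiableAt 𝓘(ℝ, ℝ) (𝓡 n) lam s := hl.mdifferentiableAt (by simp)
  refine ⟨hl, ?_⟩
  have h1 := mfderiv_comp_apply (I'' := 𝓘(ℝ, ℝ)) s hfd hld (1 : ℝ)
  rw [mfderiv_eq_fderiv] at h1
  have h2 : DifferentiableAt ℝ (fun s => f (lam s)) s := (hfd.comp s hld).differentiableAt
  rw [← hf.2 _ hs]
  refine h2.hasDerivAt.congr_deriv ?_
  rw [← fderiv_apply_one_eq_deriv]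
  exact h1

/-- `(x, u)` and `(y, v)` are joined if a curve from `x` to `y` has `α`-integral `v - u`. -/
def Joined (α : DForm n Λ 1) (a b : Λ × ℝ) : Prop :=
  ∃ (lam : ℝ → Λ) (p : ℝ → ℝ), (∀ s, IsLiftAt α lam p s) ∧ (∀ s ≤ 0, lam s = a.1 ∧ p s = a.2) ∧
    ∀ s, 1 ≤ s → lam s = b.1 ∧ p s = b.2

lemma joined_of_isLiftAt (h : ∀ s, IsLiftAt α lam p s) :
    Joined α (lam 0, p 0) (lam 1, p 1) := by
  refine ⟨fun s => lam (Real.smoothTransition s), fun s => p (Real.smoothTransition s),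
    fun s => (h _).comp Real.smoothTransition.contDiff.contDiffAt
      ((Real.smoothTransition.contDiff (n := ⊤)).differentiable (by simp) s).hasDerivAt,
    fun s hs => ?_, fun s hs => ?_⟩
  · have h1 := Real.smoothTransition.zero_of_nonpos hs
    exact ⟨congrArg lam h1, congrArg p h1⟩
  · have h1 := Real.smoothTransition.one_of_one_le hs
    exact ⟨congrArg lam h1, congrArg p h1⟩

lemma Joined.add_const {a b : Λ × ℝ} (h : Joined α a b) (c : ℝ) :
    Joined α (a.1, a.2 + c) (b.1, b.2 + c) := by
  obtain ⟨lam, p, hl, h0, h1⟩ := h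
  refine ⟨lam, fun s => p s + c, fun s => ⟨(hl s).1, (hl s).2.add_const c⟩, fun s hs => ?_,
    fun s hs => ?_⟩
  · exact ⟨(h0 s hs).1, congrArg (· + c) (h0 s hs).2⟩
  · exact ⟨(h1 s hs).1, congrArg (· + c) (h1 s hs).2⟩

lemma Joined.refl (a : Λ × ℝ) : Joined α a a := by
  refine ⟨fun _ => a.1, fun _ => a.2, fun s => ⟨contMDiffAt_const, ?_⟩, fun _ _ => ⟨rfl, rfl⟩,
    fun _ _ => ⟨rfl, rfl⟩⟩
  have h1 : mfderiv 𝓘(ℝ, ℝ) (𝓡 n) (fun _ : ℝ => a.1) s (1 : ℝ) = 0 :=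
    DFunLike.congr_fun mfderiv_const (1 : ℝ)
  have h2 : α a.1 (fun _ => mfderiv 𝓘(ℝ, ℝ) (𝓡 n) (fun _ : ℝ => a.1) s (1 : ℝ)) = 0 :=
    (congrArg (fun v => α a.1 (fun _ => v)) h1).trans
      (map_zero (altOne (EuclideanSpace ℝ (Fin n)) (α a.1)))
  rw [h2]
  exact hasDerivAt_const s a.2

lemma Joined.symm {a b : Λ × ℝ} (h : Joined α a b) : Joined α b a := by
  obtain ⟨lam, p, hl, h0, h1⟩ := h
  refine ⟨fun s => lam (1 - s), fun s => p (1 - s), fun s => ?_, fun s hs => h1 _ (by linarith),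
    fun s hs => h0 _ (by linarith)⟩
  exact (hl (1 - s)).comp (g := fun s => 1 - s) (contDiff_const.sub contDiff_id).contDiffAt
    ((hasDerivAt_id s).const_sub 1)

lemma Joined.trans {a b c : Λ × ℝ} (h : Joined α a b) (h' : Joined α b c) : Joined α a c := by
  classical
  obtain ⟨lam, p, hl, h0, h1⟩ := h
  obtain ⟨lam', p', hl', h0', h1'⟩ := h'
  -- Each curve is run at triple speed, which leaves the interval [1/3, 2/3] on which both are at
  -- rest at the common point; so the concatenation is smooth.
  let q : ℝ → Λ := fun s => if s < 1 / 2 then lam (3 * s) else lam' (3 * s - 2)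
  let r : ℝ → ℝ := fun s => if s < 1 / 2 then p (3 * s) else p' (3 * s - 2)
  have hq : ∀ s < 2 / 3, q s = lam (3 * s) ∧ r s = p (3 * s) := fun s hs => by
    by_cases h : s < 1 / 2
    · exact ⟨if_pos h, if_pos h⟩
    · have h2 := h1 (3 * s) (by linarith)
      have h3 := h0' (3 * s - 2) (by linarith)
      exact ⟨(if_neg h).trans (h3.1.trans h2.1.symm), (if_neg h).trans (h3.2.trans h2.2.symm)⟩
  have hq' : ∀ s, 1 / 3 < s → q s = lam' (3 * s - 2) ∧ r s = p' (3 * s - 2) := fun s hs => by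
    by_cases h : s < 1 / 2
    · have h2 := h1 (3 * s) (by linarith)
      have h3 := h0' (3 * s - 2) (by linarith)
      exact ⟨(if_pos h).trans (h2.1.trans h3.1.symm), (if_pos h).trans (h2.2.trans h3.2.symm)⟩
    · exact ⟨if_neg h, if_neg h⟩
  refine ⟨q, r, fun s => ?_, fun s hs => ?_, fun s hs => ?_⟩
  · by_cases hs : s < 2 / 3
    · have h2 := (hl (3 * s)).comp (g := fun s => 3 * s)
        (contDiff_const.mul contDiff_id).contDiffAt ((hasDerivAt_id s).const_mul 3)
      refine h2.congr ?_ ?_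
      · filter_upwards [Iio_mem_nhds hs] with y hy using (hq y hy).1
      · filter_upwards [Iio_mem_nhds hs] with y hy using (hq y hy).2
    · have hs' : 1 / 3 < s := by linarith
      have h2 := (hl' (3 * s - 2)).comp (g := fun s => 3 * s - 2)
        ((contDiff_const.mul contDiff_id).sub contDiff_const).contDiffAt
        (((hasDerivAt_id s).const_mul 3).sub_const 2)
      refine h2.congr ?_ ?_
      · filter_upwards [Ioi_mem_nhds hs'] with y hy using (hq' y hy).1
      · filter_upwards [Ioi_mem_nhds hs'] with y hy using (hq' y hy).2
  · have h2 := hq s (by linarith)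
    have h3 := h0 (3 * s) (by linarith)
    exact ⟨h2.1.trans h3.1, h2.2.trans h3.2⟩
  · have h2 := hq' s (by linarith)
    have h3 := h1' (3 * s - 2) (by linarith)
    exact ⟨h2.1.trans h3.1, h2.2.trans h3.2⟩

/-- Near every point, the graph of a local primitive consists of joined points. -/
lemma exists_primitive_joined (hα : α ∈ closedForms n Λ 1) (z : Λ) :
    ∃ (W : Set Λ) (f : Λ → ℝ), IsOpen W ∧ z ∈ W ∧ IsPrimitiveOn α f W ∧
      ∀ x ∈ W, Joined α (z, f z) (x, f x) := by
  obtain ⟨W, hW, hz, -, ⟨f, hf⟩, -⟩ := exists_primitive_nhds hα z univ_mem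
  set κ := extChartAt (𝓡 n) z with hκ
  have ho : IsOpen (κ.target ∩ κ.symm ⁻¹' W) :=
    (continuousOn_extChartAt_symm z).isOpen_inter_preimage (isOpen_extChartAt_target z) hW
  have hzm : κ z ∈ κ.target ∩ κ.symm ⁻¹' W := ⟨mem_extChartAt_target z, by
    rw [mem_preimage, κ.left_inv (mem_extChartAt_source z)]; exact hz⟩
  obtain ⟨r, hr, hrs⟩ := Metric.isOpen_iff.1 ho _ hzm
  have hW' : IsOpen (κ.source ∩ κ ⁻¹' Metric.ball (κ z) r) :=
    (continuousOn_extChartAt z).isOpen_inter_preimage (isOpen_extChartAt_source z)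
      Metric.isOpen_ball
  have hsub : κ.source ∩ κ ⁻¹' Metric.ball (κ z) r ⊆ W := fun x hx => by
    have := (hrs hx.2).2
    rwa [mem_preimage, κ.left_inv hx.1] at this
  refine ⟨_, f, hW', ⟨mem_extChartAt_source z, Metric.mem_ball_self hr⟩, hf.mono hsub,
    fun x hx => ?_⟩
  let lam : ℝ → Λ := fun s => κ.symm (κ z + Real.smoothTransition s • (κ x - κ z))
  have hmem : ∀ s, κ z + Real.smoothTransition s • (κ x - κ z) ∈ Metric.ball (κ z) r := fun s => by
    have h1 := Real.smoothTransition.nonneg s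
    have h2 := Real.smoothTransition.le_one s
    have h3 : ‖κ x - κ z‖ < r := by
      have := hx.2
      rwa [mem_preimage, Metric.mem_ball, dist_eq_norm] at this
    rw [Metric.mem_ball, dist_eq_norm, add_sub_cancel_left, norm_smul, Real.norm_of_nonneg h1]
    nlinarith [norm_nonneg (κ x - κ z)]
  have hl : ContMDiff 𝓘(ℝ, ℝ) (𝓡 n) ∞ lam := fun s => by
    refine ContMDiffAt.comp (g := κ.symm) s ((contMDiffOn_extChartAt_symm z).contMDiffAt
      ((isOpen_extChartAt_target z).mem_nhds (hrs (hmem s)).1)) ?_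
    exact (contDiff_const.add
      (Real.smoothTransition.contDiff.smul contDiff_const)).contDiffAt.contMDiffAt
  have h := joined_of_isLiftAt fun s => hf.isLiftAt hW (hl s) (hrs (hmem s)).2
  have hl0 : lam 0 = z := by
    change κ.symm (κ z + Real.smoothTransition 0 • (κ x - κ z)) = z
    rw [Real.smoothTransition.zero, zero_smul, add_zero, κ.left_inv (mem_extChartAt_source z)]
  have hl1 : lam 1 = x := by
    change κ.symm (κ z + Real.smoothTransition 1 • (κ x - κ z)) = x
    rw [Real.smoothTransition.one, one_smul, add_sub_cancel, κ.left_inv hx.1]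
  rwa [hl0, hl1] at h

/-- A closed `1`-form is exact if its integrals over smooth loops vanish. -/
theorem mem_exactOneForms_of_periods (hα : α ∈ closedForms n Λ 1)
    (hper : ∀ (lam : ℝ → Λ) (p : ℝ → ℝ), (∀ s, IsLiftAt α lam p s) → lam 1 = lam 0 → p 1 = p 0) :
    α ∈ exactOneForms n Λ := by
  classical
  have huniq : ∀ {x y : Λ} {u v v' : ℝ}, Joined α (x, u) (y, v) → Joined α (x, u) (y, v') →
      v = v' := by
    intro x y u v v' h h'
    obtain ⟨lam, p, hl, h0, h1⟩ := h.symm.trans h'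
    have h2 := hper lam p hl ((h1 1 le_rfl).1.trans (h0 0 le_rfl).1.symm)
    rw [(h1 1 le_rfl).2, (h0 0 le_rfl).2] at h2
    exact h2.symm
  -- `Λ` may be disconnected: each class of points that can be joined receives its own base point,
  -- and the primitive is the integral along curves from there.
  let S : Setoid Λ :=
    { r := fun x y => ∃ v, Joined α (x, 0) (y, v)
      iseqv := by
        refine ⟨fun x => ⟨0, Joined.refl _⟩, ?_, ?_⟩
        · rintro x y ⟨v, h⟩
          have h1 := h.symm.add_const (-v)
          simp only [add_neg_cancel] at h1
          exact ⟨_, h1⟩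
        · rintro x y z ⟨v, h⟩ ⟨v', h'⟩
          have h1 := h'.add_const v
          simp only [zero_add] at h1
          exact ⟨_, h.trans h1⟩ }
  have hrep : ∀ x, ∃ v, Joined α ((Quotient.mk S x).out, 0) (x, v) := fun x =>
    Quotient.exact (Quotient.out_eq (Quotient.mk S x))
  choose f hf using hrep
  have hloc : ∀ z, ∃ (W : Set Λ) (g : Λ → ℝ) (c : ℝ), IsOpen W ∧ z ∈ W ∧ IsPrimitiveOn α g W ∧
      ∀ x ∈ W, f x = g x + c := by
    intro z
    obtain ⟨W, g, hW, hz, hg, hj⟩ := exists_primitive_joined hα z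
    refine ⟨W, g, f z - g z, hW, hz, hg, fun x hx => ?_⟩
    have h1 := (hj x hx).add_const (-g z)
    simp only [add_neg_cancel] at h1
    have hrel : Quotient.mk S z = Quotient.mk S x := Quotient.sound ⟨_, h1⟩
    have h2 := (hj x hx).add_const (f z - g z)
    simp only [add_sub_cancel] at h2
    have h3 := (hf z).trans h2
    rw [hrel] at h3
    exact huniq (hf x) h3
  refine ⟨f, fun z => ?_, fun z u => ?_⟩
  · obtain ⟨W, g, c, hW, hz, hg, hfg⟩ := hloc z
    have h1 : ContMDiffAt (𝓡 n) 𝓘(ℝ, ℝ) ∞ (fun x => g x + c) z :=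
      (hg.1.contMDiffAt (hW.mem_nhds hz)).add contMDiffAt_const
    refine h1.congr_of_eventuallyEq ?_
    filter_upwards [hW.mem_nhds hz] with x hx using hfg x hx
  · obtain ⟨W, g, c, hW, hz, hg, hfg⟩ := hloc z
    have hev : f =ᶠ[𝓝 z] fun x => g x - (-c) := by
      filter_upwards [hW.mem_nhds hz] with x hx
      rw [hfg x hx, sub_neg_eq_add]
    rw [← hg.2 z hz u]
    have h1 := mfderiv_sub_const_apply ((hg.1.contMDiffAt (hW.mem_nhds hz)).mdifferentiableAt
      (by simp)) (-c) u
    refine h1.symm.trans ?_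
    exact (DFunLike.congr_fun (hev.mfderiv_eq (I := 𝓡 n) (I' := 𝓘(ℝ, ℝ))) u).symm

end Periods

/-! ### Holonomy of a loop as a well-defined number -/

section LoopHolonomy

variable {m : ℕ} {X : Type*} [TopologicalSpace X] [ChartedSpace (EuclideanSpace ℝ (Fin m)) X]
  [IsManifold (𝓡 m) ∞ X]
  {L : X → Type*} [TopologicalSpace (Bundle.TotalSpace ℂ L)]
  [∀ x, AddCommGroup (L x)] [∀ x, Module ℂ (L x)] [∀ x, TopologicalSpace (L x)]
  [∀ x, IsTopologicalAddGroup (L x)] [∀ x, ContinuousSMul ℝ (L x)] [FiberBundle ℂ L]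
  [VectorBundle ℂ ℂ L] [VectorBundle ℝ ℂ L] [ContMDiffVectorBundle ∞ ℂ L (𝓡 m)]
  (a : HermitianConnection m L)

/-- `w` is the holonomy of the loop `γ`, run through with a smooth stopping parametrization. -/
def HasHolonomy (γ : ℝ → X) (w : ℂ) : Prop :=
  ∃ C : ℝ → Bundle.TotalSpace ℂ L, a.IsParallel C ∧
    (∀ s, (C s).1 = γ (Real.smoothTransition s)) ∧ (∀ s, (C s).2 ≠ 0) ∧
    C 1 = ⟨(C 0).1, w • (C 0).2⟩

variable {a}

lemma HasHolonomy.eq_of_isParallel [T2Space X] {γ : ℝ → X} {w z : ℂ} (h : HasHolonomy a γ w)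
    {c : ℝ → Bundle.TotalSpace ℂ L} (hc : a.IsParallel c)
    (hb : ∀ s, (c s).1 = γ (Real.smoothTransition s)) (h0 : (c 0).2 ≠ 0)
    (h1 : c 1 = ⟨(c 0).1, z • (c 0).2⟩) : w = z := by
  obtain ⟨C, hC, hCb, hC0, hC1⟩ := h
  obtain ⟨r, hr⟩ := HasCov.exists_const_ratio (U := univ) (β := fun _ => 0) isOpen_univ
    isPreconnected_univ (fun s _ => hasCov_of_isParallel hC s)
    (fun s _ => hasCov_of_isParallel hc s) (fun s _ => hC0 s)
    (fun s _ => (hb s).trans (hCb s).symm)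
  -- The two parallel curves differ by one constant r at both ends, so z r = r w, and r is nonzero.
  have key : ∀ {l l' k k' : Bundle.TotalSpace ℂ L}, l.2 ≠ 0 → l'.2 ≠ 0 → k = ⟨l.1, w • l.2⟩ →
      k' = ⟨l'.1, z • l'.2⟩ → l' = ⟨l.1, r • l.2⟩ → k' = ⟨k.1, r • k.2⟩ → w = z := by
    rintro ⟨x, v⟩ l' k k' hl hl' rfl rfl rfl h
    have h2 : z • r • v = r • w • v := Bundle.TotalSpace.mk_injective x h
    rw [smul_smul, smul_smul, mul_comm] at h2
    have h3 := smul_left_injective_fibre hl h2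
    have hr : r ≠ 0 := by
      rintro rfl
      exact hl' (zero_smul ℂ v)
    exact (mul_left_cancel₀ hr h3).symm
  exact key (hC0 0) h0 hC1 h1 (hr 0 trivial) (hr 1 trivial)

lemma HasHolonomy.unique [T2Space X] {γ : ℝ → X} {w w' : ℂ} (h : HasHolonomy a γ w)
    (h' : HasHolonomy a γ w') : w = w' := by
  obtain ⟨C', hC', hb', h0', h1'⟩ := h'
  exact h.eq_of_isParallel hC' hb' (h0' 0) h1'

lemma HermitianConnection.TrivialCharacter.pow_eq_one {k : ℕ} {N : Set X}
    (h : a.TrivialCharacter k N) {γ : ℝ → X} (hγ : ∀ s, γ s ∈ N) {w : ℂ}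
    (hw : HasHolonomy a γ w) : w ^ k = 1 := by
  obtain ⟨C, hC, hb, h0, h1⟩ := hw
  exact h C hC (fun s => by rw [hb]; exact hγ _) (h0 0) w h1

/-- The holonomy may be computed with any parametrization. -/
lemma HasHolonomy.eq_of_isParallel_lift [T2Space X] {γ : ℝ → X} {w z : ℂ}
    (h : HasHolonomy a γ w) {c : ℝ → Bundle.TotalSpace ℂ L} (hc : a.IsParallel c)
    (hb : ∀ s, (c s).1 = γ s) (h0 : (c 0).2 ≠ 0)
    (h1 : c 1 = Bundle.TotalSpace.mk' ℂ (c 0).1 (z • (c 0).2)) : w = z := by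
  refine h.eq_of_isParallel (c := fun s => c (Real.smoothTransition s))
    (isParallel_of_hasCov fun s => ?_) (fun s => hb _) ?_ ?_
  · exact (hasCov_of_isParallel hc (Real.smoothTransition s)).comp
      (g := Real.smoothTransition) (p := s) Real.smoothTransition.contDiff.contDiffAt
      ((Real.smoothTransition.contDiff (n := ⊤)).differentiable (by simp) s).hasFDerivAt
  · rwa [Real.smoothTransition.zero]
  · rw [Real.smoothTransition.zero, Real.smoothTransition.one]
    exact h1

/-- The variation of the holonomy in a family of loops. -/
theorem exists_holonomy_function [T2Space X] {Ω : DForm m X 2} {F : ℝ × ℝ → X} {ψ : ℝ × ℝ → ℝ}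
    (ha : a.HasCurvature Ω) (hF : ContMDiff 𝓘(ℝ, ℝ × ℝ) (𝓡 m) ∞ F) (hψ : ContDiff ℝ ∞ ψ)
    (hψ' : ∀ q, fderiv ℝ ψ q (0, 1) = -(2 * Real.pi * Ω (F q)
      ![mfderiv 𝓘(ℝ, ℝ × ℝ) (𝓡 m) F q ((1 : ℝ), (0 : ℝ)),
        mfderiv 𝓘(ℝ, ℝ × ℝ) (𝓡 m) F q ((0 : ℝ), (1 : ℝ))]))
    (hloop : ∀ t, F (t, 1) = F (t, 0)) :
    ∃ W : ℝ → ℂ, ∀ t, HasHolonomy a (fun s => F (t, s)) (W t) ∧ W t ≠ 0 ∧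
      HasDerivAt W (Complex.I * (ψ (t, 1) - ψ (t, 0)) * W t) t := by
  have hloc := exists_holonomy (L := L) ha hF hψ hψ' hloop
  have hex : ∀ t, ∃ w, HasHolonomy a (fun s => F (t, s)) w := fun t => by
    obtain ⟨δ, hδ, w, C, h⟩ := hloc t
    obtain ⟨-, -, hC, hb, h0, h1⟩ := h t ⟨by linarith, by linarith⟩
    exact ⟨w t, C t, hC, hb, h0, h1⟩
  choose W hW using hex
  refine ⟨W, fun t => ⟨hW t, ?_⟩⟩
  obtain ⟨δ, hδ, w, C, h⟩ := hloc t
  -- Uniqueness of the holonomy makes the locally constructed functions restrictions of one global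
  -- function, which inherits their differential equation.
  have hWw : ∀ t' ∈ Ioo (t - δ) (t + δ), W t' = w t' := fun t' ht' => by
    obtain ⟨-, -, hC, hb, h0, h1⟩ := h t' ht'
    exact (hW t').unique ⟨C t', hC, hb, h0, h1⟩
  have ht : t ∈ Ioo (t - δ) (t + δ) := ⟨by linarith, by linarith⟩
  rw [hWw t ht]
  refine ⟨(h t ht).2.1, (h t ht).1.congr_of_eventuallyEq ?_⟩
  filter_upwards [isOpen_Ioo.mem_nhds ht] with t' ht' using hWw t' ht'

end LoopHolonomy

lemma hasDerivAt_snd {ψ : ℝ × ℝ → ℝ} (hψ : ContDiff ℝ ∞ ψ) (q : ℝ × ℝ) :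
    HasDerivAt (fun s => ψ (q.1, s)) (fderiv ℝ ψ q (0, 1)) q.2 :=
  HasFDerivAt.comp_hasDerivAt (f := fun s => (q.1, s)) q.2
    (hψ.differentiable (by simp) q).hasFDerivAt
    ((hasDerivAt_const q.2 q.1).prodMk (hasDerivAt_id q.2))

/-! ### Tangent vectors to the Bohr–Sommerfeld locus -/

section BohrSommerfeldTangent

variable {n : ℕ} {X : Type*} [TopologicalSpace X]
  [ChartedSpace (EuclideanSpace ℝ (Fin (2 * n))) X] [IsManifold (𝓡 (2 * n)) ∞ X]
  {Λ : Type*} [TopologicalSpace Λ] [ChartedSpace (EuclideanSpace ℝ (Fin n)) Λ]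
  [IsManifold (𝓡 n) ∞ Λ]

section Families

variable {Φ : ℝ → Λ → X} {lam : ℝ → Λ}

lemma contMDiff_loopFamily
    (hΦ : ContMDiff (𝓘(ℝ, ℝ).prod (𝓡 n)) (𝓡 (2 * n)) ∞ (fun p : ℝ × Λ => Φ p.1 p.2))
    (hl : ContMDiff 𝓘(ℝ, ℝ) (𝓡 n) ∞ lam) :
    ContMDiff 𝓘(ℝ, ℝ × ℝ) (𝓡 (2 * n)) ∞ (fun q : ℝ × ℝ => Φ q.1 (lam q.2)) :=
  hΦ.comp (f := fun q : ℝ × ℝ => (q.1, lam q.2))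
    (contDiff_fst.contMDiff.prodMk (hl.comp contDiff_snd.contMDiff))

lemma mfderiv_loopFamily_left
    (hΦ : ContMDiff (𝓘(ℝ, ℝ).prod (𝓡 n)) (𝓡 (2 * n)) ∞ (fun p : ℝ × Λ => Φ p.1 p.2))
    (hl : ContMDiff 𝓘(ℝ, ℝ) (𝓡 n) ∞ lam) (q : ℝ × ℝ) :
    mfderiv 𝓘(ℝ, ℝ × ℝ) (𝓡 (2 * n)) (fun q : ℝ × ℝ => Φ q.1 (lam q.2)) q ((1 : ℝ), (0 : ℝ)) =
      mfderiv 𝓘(ℝ, ℝ) (𝓡 (2 * n)) (fun t => Φ t (lam q.2)) q.1 (1 : ℝ) :=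
  (mfderiv_left ((contMDiff_loopFamily hΦ hl).mdifferentiableAt (by simp))).symm

lemma mfderiv_loopFamily_right
    (hΦ : ContMDiff (𝓘(ℝ, ℝ).prod (𝓡 n)) (𝓡 (2 * n)) ∞ (fun p : ℝ × Λ => Φ p.1 p.2))
    (hl : ContMDiff 𝓘(ℝ, ℝ) (𝓡 n) ∞ lam) (q : ℝ × ℝ) :
    mfderiv 𝓘(ℝ, ℝ × ℝ) (𝓡 (2 * n)) (fun q : ℝ × ℝ => Φ q.1 (lam q.2)) q ((0 : ℝ), (1 : ℝ)) =
      mfderiv (𝓡 n) (𝓡 (2 * n)) (Φ q.1) (lam q.2)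
        (mfderiv 𝓘(ℝ, ℝ) (𝓡 n) lam q.2 (1 : ℝ)) := by
  refine (mfderiv_right ((contMDiff_loopFamily hΦ hl).mdifferentiableAt (by simp))
    (1 : ℝ)).symm.trans ?_
  exact mfderiv_comp_apply q.2
    ((contMDiff_slice isOpen_univ hΦ.contMDiffOn (mem_univ q.1)).mdifferentiableAt (by simp))
    (hl.mdifferentiableAt (by simp)) (1 : ℝ)

end Families

variable {L : X → Type*} [TopologicalSpace (Bundle.TotalSpace ℂ L)]
  [∀ x, AddCommGroup (L x)] [∀ x, Module ℂ (L x)] [∀ x, TopologicalSpace (L x)]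
  [∀ x, IsTopologicalAddGroup (L x)] [∀ x, ContinuousSMul ℝ (L x)] [FiberBundle ℂ L]
  [VectorBundle ℂ ℂ L] [VectorBundle ℝ ℂ L] [ContMDiffVectorBundle ∞ ℂ L (𝓡 (2 * n))]
  {a : HermitianConnection (2 * n) L} {Ω : DForm (2 * n) X 2}

lemma tangentVectors_mono {S T : Set (Set X)} (h : S ⊆ T) (ι : Λ → X) :
    tangentVectors Ω S ι ⊆ tangentVectors Ω T ι := by
  rintro α ⟨Φ, h1, h2, h3, h4⟩
  exact ⟨Φ, h1, h2, fun t => h (h3 t), h4⟩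

/-- Differentiation gives k W^(k-1) W' = 0, and the first two factors are nonzero. This is where a
positive level is needed. -/
lemma hasDerivAt_eq_zero_of_pow_eq_one {W : ℝ → ℂ} {W' : ℂ} {t : ℝ} {k : ℕ} (hk : k ≠ 0)
    (hW : HasDerivAt W W' t) (h1 : ∀ t, W t ^ k = 1) : W' = 0 := by
  have h2 := hW.pow k
  have h3 : HasDerivAt (W ^ k) 0 t := by
    have : W ^ k = fun _ => (1 : ℂ) := funext h1
    rw [this]
    exact hasDerivAt_const t 1
  have h4 := h2.unique h3
  have h5 : W t ≠ 0 := fun h0 => by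
    have := h1 t
    rw [h0, zero_pow hk] at this
    exact zero_ne_one this
  have h6 : (k : ℂ) * W t ^ (k - 1) ≠ 0 := mul_ne_zero (Nat.cast_ne_zero.2 hk) (pow_ne_zero _ h5)
  exact (mul_eq_zero.1 h4).resolve_left h6

/-- The periods of a tangent vector to the Bohr-Sommerfeld locus vanish. -/
lemma period_eq_zero [T2Space X] (hΩ : IsSymplectic Ω) (ha : a.HasCurvature Ω) {k : ℕ}
    (hk : k ≠ 0) {ι : Λ → X} {α : DForm n Λ 1}
    (hα : α ∈ tangentVectors Ω (bohrSommerfeldCycles Λ Ω a k) ι) {lam : ℝ → Λ} {p : ℝ → ℝ}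
    (hp : ∀ s, IsLiftAt α lam p s) (hlam : lam 1 = lam 0) : p 1 = p 0 := by
  obtain ⟨Φ, hΦ, -, hBS, -, hαΦ⟩ := hα
  have hl : ContMDiff 𝓘(ℝ, ℝ) (𝓡 n) ∞ lam := fun s => (hp s).1
  set F : ℝ × ℝ → X := fun q => Φ q.1 (lam q.2) with hFdef
  have hF : ContMDiff 𝓘(ℝ, ℝ × ℝ) (𝓡 (2 * n)) ∞ F := contMDiff_loopFamily hΦ hl
  set b : ℝ × ℝ → ℝ := fun q => Ω (F q)
    ![mfderiv 𝓘(ℝ, ℝ × ℝ) (𝓡 (2 * n)) F q ((1 : ℝ), (0 : ℝ)),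
      mfderiv 𝓘(ℝ, ℝ × ℝ) (𝓡 (2 * n)) F q ((0 : ℝ), (1 : ℝ))] with hb
  have hbs : ContDiff ℝ ∞ b := contDiffOn_univ.1
    (hΩ.smooth.contDiffOn_two isOpen_univ hF.contMDiffOn (1, 0) (0, 1))
  obtain ⟨ψ, hψ, hψd⟩ := exists_contDiff_primitive_snd
    (b := fun q => -(2 * Real.pi * b q)) (contDiff_const.mul hbs).neg
  have hψ' : ∀ q, fderiv ℝ ψ q (0, 1) = -(2 * Real.pi * b q) := fun q =>
    (hasDerivAt_snd hψ q).unique (hψd q.1 q.2)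
  obtain ⟨W, hW⟩ := exists_holonomy_function (L := L) ha hF hψ hψ'
    (fun t => congrArg (Φ t) hlam)
  have hWk : ∀ t, W t ^ k = 1 := fun t =>
    (hBS t).2.pow_eq_one (fun s => mem_range_self (lam s)) (hW t).1
  have h0 := hasDerivAt_eq_zero_of_pow_eq_one hk (hW 0).2.2 hWk
  have h1 : (ψ (0, 1) : ℂ) - ψ (0, 0) = 0 := by
    have := (mul_eq_zero.1 h0).resolve_right (hW 0).2.1
    exact (mul_eq_zero.1 this).resolve_left Complex.I_ne_zero
  have h2 : ψ (0, 1) = ψ (0, 0) := by exact_mod_cast sub_eq_zero.1 h1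
  have hbα : ∀ s, b (0, s) = α (lam s) (fun _ => mfderiv 𝓘(ℝ, ℝ) (𝓡 n) lam s (1 : ℝ)) := by
    intro s
    rw [hαΦ]
    exact congrArg₂ (fun u v => Ω (F (0, s)) ![u, v]) (mfderiv_loopFamily_left hΦ hl (0, s))
      (mfderiv_loopFamily_right hΦ hl (0, s))
  -- At t = 0 both ψ/(-2π) and p are primitives of α along the loop, so the vanishing increment of ψ
  -- is that of p.
  have hconst : ∀ s, HasDerivAt (fun s => ψ (0, s) + 2 * Real.pi * p s) 0 s := fun s => by
    have h3 := (hψd 0 s).add ((hp s).2.const_mul (2 * Real.pi))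
    rw [← hbα, neg_add_cancel] at h3
    exact h3
  have h3 := is_const_of_deriv_eq_zero (fun s => (hconst s).differentiableAt)
    (fun s => (hconst s).deriv) 1 0
  simp only [h2, add_right_inj] at h3
  exact mul_left_cancel₀ (by positivity) h3

/-- Tangent vectors to the Bohr-Sommerfeld locus are exact. -/
theorem tangentVectors_bohrSommerfeldCycles_subset [T2Space X] (hΩ : IsSymplectic Ω)
    (ha : a.HasCurvature Ω) {k : ℕ} (hk : k ≠ 0) (ι : Λ → X) :
    tangentVectors Ω (bohrSommerfeldCycles Λ Ω a k) ι ⊆ exactOneForms n Λ := fun _ hα =>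
  mem_exactOneForms_of_periods
    (tangentVectors_lagrangianCycles_subset hΩ.smooth hΩ.closed ι
      (tangentVectors_mono (fun _ hN => hN.1) ι hα))
    fun _ _ hp hlam => period_eq_zero hΩ ha hk hα hp hlam

/-- A curve in the image of an embedding is the image of a curve. -/
lemma exists_curve_lift [T2Space X] [CompactSpace Λ] {f : Λ → X}
    (hf : IsLagrangianEmbedding Ω f) {γ : ℝ → X} (hγ : ContMDiff 𝓘(ℝ, ℝ) (𝓡 (2 * n)) ∞ γ)
    (hr : ∀ s, γ s ∈ range f) :
    ∃ lam : ℝ → Λ, ContMDiff 𝓘(ℝ, ℝ) (𝓡 n) ∞ lam ∧ ∀ s, f (lam s) = γ s := by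
  choose lam hlam using hr
  refine ⟨lam, fun s => ?_, hlam⟩
  have hemb := hf.smooth.continuous.isClosedEmbedding hf.injective
  obtain ⟨U, ret, hU, hsU, hret, hrf⟩ :=
    exists_local_left_inverse hf.smooth hemb.isInducing (hf.immersion (lam s))
  rw [hlam] at hsU
  refine (ContMDiffAt.comp (g := ret) s (hret.contMDiffAt (hU.mem_nhds hsU))
    (hγ s)).congr_of_eventuallyEq ?_
  filter_upwards [hγ.continuous.continuousAt.preimage_mem_nhds (hU.mem_nhds hsU)] with y hy
  have h1 := hrf (lam y) (by rw [hlam]; exact hy)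
  rw [hlam] at h1
  exact h1.symm

/-- A Hamiltonian family of Lagrangian cycles stays in the Bohr-Sommerfeld locus. -/
lemma range_mem_bohrSommerfeldCycles [T2Space X] [CompactSpace Λ] (ha : a.HasCurvature Ω) {k : ℕ}
    {Φ : ℝ → Λ → X} {κ : ℝ → ℝ} {h : X → ℝ} (hκ : ContDiff ℝ ∞ κ)
    (hh : ContMDiff (𝓡 (2 * n)) 𝓘(ℝ, ℝ) ∞ h)
    (hΦ : ContMDiff (𝓘(ℝ, ℝ).prod (𝓡 n)) (𝓡 (2 * n)) ∞ (fun p : ℝ × Λ => Φ p.1 p.2))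
    (hL : ∀ t, IsLagrangianEmbedding Ω (Φ t))
    (hv : ∀ t x w, Ω (Φ t x) ![mfderiv 𝓘(ℝ, ℝ) (𝓡 (2 * n)) (fun t => Φ t x) t (1 : ℝ), w] =
      κ t * realDeriv h (Φ t x) w)
    (hBS : range (Φ 0) ∈ bohrSommerfeldCycles Λ Ω a k) (t : ℝ) :
    range (Φ t) ∈ bohrSommerfeldCycles Λ Ω a k := by
  refine ⟨⟨Φ t, hL t, rfl⟩, fun c hc hcr hc0 z hz => ?_⟩
  have hγ : ContMDiff 𝓘(ℝ, ℝ) (𝓡 (2 * n)) ∞ fun s => (c s).1 := fun s =>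
    (hasCov_of_isParallel hc s).1
  -- The given loop lies in the cycle at time t. Lifted to `Λ`, it is carried to all other times, in
  -- particular to time 0, where triviality is known.
  obtain ⟨lam, hl, hlam⟩ := exists_curve_lift (hL t) hγ hcr
  have hloop : lam 1 = lam 0 := (hL t).injective (by rw [hlam, hlam, hz])
  set F : ℝ × ℝ → X := fun q => Φ q.1 (lam q.2) with hFdef
  have hF : ContMDiff 𝓘(ℝ, ℝ × ℝ) (𝓡 (2 * n)) ∞ F := contMDiff_loopFamily hΦ hl
  have hhF : ContDiff ℝ ∞ fun q => h (F q) := contMDiff_iff_contDiff.1 (hh.comp hF)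
  -- For a Hamiltonian family the primitive in s is explicit, and it depends on s only through the
  -- point F(t, s). It is therefore equal at the two ends of a loop.
  set ψ : ℝ × ℝ → ℝ := fun q => -(2 * Real.pi * κ q.1) * h (F q) with hψdef
  have hψ : ContDiff ℝ ∞ ψ :=
    (contDiff_const.mul (hκ.comp contDiff_fst)).neg.mul hhF
  have hψ' : ∀ q, fderiv ℝ ψ q (0, 1) = -(2 * Real.pi * Ω (F q)
      ![mfderiv 𝓘(ℝ, ℝ × ℝ) (𝓡 (2 * n)) F q ((1 : ℝ), (0 : ℝ)),
        mfderiv 𝓘(ℝ, ℝ × ℝ) (𝓡 (2 * n)) F q ((0 : ℝ), (1 : ℝ))]) := fun q => by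
    rw [(hasDerivAt_snd hψ q).unique
      ((hasDerivAt_snd hhF q).const_mul (-(2 * Real.pi * κ q.1)))]
    have h3 : fderiv ℝ (fun q => h (F q)) q (0, 1) = realDeriv h (F q)
        (mfderiv 𝓘(ℝ, ℝ × ℝ) (𝓡 (2 * n)) F q ((0 : ℝ), (1 : ℝ))) := by
      rw [← mfderiv_eq_fderiv]
      exact mfderiv_comp_apply q (hh.mdifferentiableAt (by simp))
        (hF.mdifferentiableAt (by simp)) _
    have h4 := (congrArg (fun u => Ω (F q) ![u, _]) (mfderiv_loopFamily_left hΦ hl q)).trans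
      (hv q.1 (lam q.2) (mfderiv 𝓘(ℝ, ℝ × ℝ) (𝓡 (2 * n)) F q ((0 : ℝ), (1 : ℝ))))
    rw [h3]
    refine Eq.trans ?_ (congrArg (fun x => -(2 * Real.pi * x)) h4.symm)
    change _ = -(2 * Real.pi * (κ q.1 * realDeriv h (F q) _))
    ring
  obtain ⟨W, hW⟩ := exists_holonomy_function (L := L) ha hF hψ hψ'
    (fun t => congrArg (Φ t) hloop)
  have hW0 : W 0 ^ k = 1 :=
    hBS.2.pow_eq_one (fun s => mem_range_self (lam s)) (hW 0).1
  have hd : ∀ t, HasDerivAt W 0 t := fun t => by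
    have h1 := (hW t).2.2
    have h2 : ψ (t, 1) = ψ (t, 0) := by
      simp only [hψdef, hFdef, hloop]
    rwa [h2, sub_self, mul_zero, zero_mul] at h1
  have hWt : W t = W 0 :=
    is_const_of_deriv_eq_zero (fun s => (hd s).differentiableAt) (fun s => (hd s).deriv) t 0
  have hWz : W t = z := (hW t).1.eq_of_isParallel_lift hc (fun s => (hlam s).symm) hc0 hz
  rw [← hWz, hWt, hW0]

/-- The tangent vectors to the Bohr-Sommerfeld locus are the exact forms. -/
theorem tangentVectors_bohrSommerfeldCycles [T2Space X] [SecondCountableTopology X] [T2Space Λ]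
    [CompactSpace Λ] (hΩ : IsSymplectic Ω) (ha : a.HasCurvature Ω) {k : ℕ} (hk : k ≠ 0)
    {ι : Λ → X} (hι : IsLagrangianEmbedding Ω ι)
    (hBS : range ι ∈ bohrSommerfeldCycles Λ Ω a k) :
    tangentVectors Ω (bohrSommerfeldCycles Λ Ω a k) ι = exactOneForms n Λ := by
  refine Subset.antisymm (tangentVectors_bohrSommerfeldCycles_subset hΩ ha hk ι) ?_
  rintro α ⟨f, hf, hαf⟩
  -- A global function on `X` is wanted, rather than a closed form near the image: its
  -- single-valuedness is what keeps the holonomy constant.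
  obtain ⟨h, hh, hhf⟩ := exists_contMDiff_extension hι.smooth hι.injective hι.immersion hf
  obtain ⟨Φ, κ, hκ, hκ0, hΦ, hΦ0, hL, hv⟩ := exists_lagrangian_family hΩ hι
    (fun p q => h q - h p) fun z => ⟨univ, isOpen_univ, mem_univ _, h, hh.contMDiffOn,
      fun p _ q _ => rfl⟩
  have hv' : ∀ t x w, Ω (Φ t x)
      ![mfderiv 𝓘(ℝ, ℝ) (𝓡 (2 * n)) (fun t => Φ t x) t (1 : ℝ), w] =
      κ t * realDeriv h (Φ t x) w := fun t x w => by
    refine (hv t x w).trans (congrArg (κ t * ·) ?_)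
    exact mfderiv_sub_const_apply (hh.mdifferentiableAt (by simp)) (h (Φ t x)) w
  subst hΦ0
  refine ⟨Φ, hΦ, hL, range_mem_bohrSommerfeldCycles ha hκ hh hΦ hL hv' hBS, rfl, fun x u => ?_⟩
  rw [hv', hκ0, one_mul, hαf x u]
  refine Eq.trans ?_ (realDeriv_comp (hh.mdifferentiableAt (by simp))
    (hι.smooth.mdifferentiableAt (by simp)) u)
  have : f = fun z => h (Φ 0 z) := funext fun z => (hhf z).symm
  rw [this]

end BohrSommerfeldTangent

/-! ### Assembly of the theorem -/

/-- Equal submodules have equivalent quotients. -/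
lemma exists_quotient_submoduleOf_equiv {M : Type*} [AddCommGroup M] [Module ℝ M]
    {A A' B B' : Submodule ℝ M} (hA : A = A') (hB : B = B') :
    ∃ e : (A ⧸ B.submoduleOf A) ≃ₗ[ℝ] (A' ⧸ B'.submoduleOf A'),
      ∀ (x : M) (hx : x ∈ A) (hx' : x ∈ A'),
        e (Submodule.Quotient.mk ⟨x, hx⟩) = Submodule.Quotient.mk ⟨x, hx'⟩ := by
  subst hA hB
  exact ⟨LinearEquiv.refl ℝ _, fun _ _ _ => rfl⟩

/-- The span adds nothing once the tangent vectors are known to form a submodule. -/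
lemma tangentSpace_eq {n : ℕ} {X : Type*} [TopologicalSpace X]
    [ChartedSpace (EuclideanSpace ℝ (Fin (2 * n))) X] {Λ : Type*} [TopologicalSpace Λ]
    [ChartedSpace (EuclideanSpace ℝ (Fin n)) Λ] {Ω : DForm (2 * n) X 2} {S : Set (Set X)}
    {ι : Λ → X} {A : Submodule ℝ (DForm n Λ 1)} (h : tangentVectors Ω S ι = A) :
    tangentSpace Ω S ι = A := by
  rw [tangentSpace, h, Submodule.span_eq]

end BohrSommerfeld

open BohrSommerfeld in
theorem proposition1p1 {n : ℕ}
    {X : Type*} [TopologicalSpace X] [T2Space X] [SecondCountableTopology X]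
    [ChartedSpace (EuclideanSpace ℝ (Fin (2 * n))) X] [IsManifold (𝓡 (2 * n)) ∞ X]
    (Ω : DForm (2 * n) X 2) (hΩ : IsSymplectic Ω)
    {L : X → Type*} [TopologicalSpace (Bundle.TotalSpace ℂ L)]
    [∀ x, AddCommGroup (L x)] [∀ x, Module ℂ (L x)] [∀ x, TopologicalSpace (L x)]
    [∀ x, IsTopologicalAddGroup (L x)] [∀ x, ContinuousSMul ℝ (L x)] [FiberBundle ℂ L]
    [VectorBundle ℂ ℂ L] [VectorBundle ℝ ℂ L] [ContMDiffVectorBundle ∞ ℂ L (𝓡 (2 * n))]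
    (a : HermitianConnection (2 * n) L) (ha : a.HasCurvature Ω)
    (k : ℕ) (hk : k ≠ 0)
    {Λ : Type*} [TopologicalSpace Λ] [T2Space Λ] [CompactSpace Λ]
    [ChartedSpace (EuclideanSpace ℝ (Fin n)) Λ] [IsManifold (𝓡 n) ∞ Λ]
    (ι : Λ → X) (hι : IsLagrangianEmbedding Ω ι)
    (hBS : Set.range ι ∈ bohrSommerfeldCycles Λ Ω a k) :
    tangentVectors Ω (lagrangianCycles Λ Ω) ι = closedForms n Λ 1 ∧
    tangentVectors Ω (bohrSommerfeldCycles Λ Ω a k) ι = exactOneForms n Λ ∧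
    ∃ e : normalSpace Ω (bohrSommerfeldCycles Λ Ω a k) (lagrangianCycles Λ Ω) ι ≃ₗ[ℝ] H1 n Λ,
      ∀ (α : DForm n Λ 1) (hα : α ∈ tangentSpace Ω (lagrangianCycles Λ Ω) ι)
        (hα' : α ∈ closedForms n Λ 1),
        e (Submodule.Quotient.mk ⟨α, hα⟩) = Submodule.Quotient.mk ⟨α, hα'⟩ := by
  have h1 := tangentVectors_lagrangianCycles hΩ hι
  have h2 := tangentVectors_bohrSommerfeldCycles hΩ ha hk hι hBS
  exact ⟨h1, h2, exists_quotient_submoduleOf_equiv (tangentSpace_eq h1) (tangentSpace_eq h2)⟩
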